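/- Let $V$ be an 11-dimensional real vector space with a Lorentzian inner product $\eta$ of signature $(1,10)$ (mostly minus), let $C\ell(V)$ be its Clifford algebra with the convention $v\cdot v=-\eta(v,v)$, and let $S$ be an irreducible real $C\ell(V)$-module, on which $\mathfrak{so}(V)$ acts through the spin representation. Let $\langle-,-\rangle$ be an $\mathfrak{so}(V)$-invariant symplectic structure on $S$ and let $\kappa:S\times S\to V$ be the symmetric bilinear map with $\eta(\kappa(s,s),v)=\langle s,v\cdot s\rangle$ for all $s\in S$, $v\in V$. The $D=11$ Poincaré superalgebra is the $\mathbb Z$-graded Lie superalgebra $\mathfrak p=\mathfrak p_0\oplus\mathfrak p_{-1}\oplus\mathfrak p_{-2}=\mathfrak{so}(V)\oplus S\oplus V$, with odd part $S$ and even part $\mathfrak{so}(V)\oplus V$, whose nontrivial brackets are the bracket of $\mathfrak{so}(V)$, the natural actions of $\mathfrak{so}(V)$ on $S$ and $V$, and $[s,t]=\kappa(s,t)$ for $s,t\in S$. Let $\mathfrak m=S\oplus V$ be its supertranslation ideal. For $d\in\mathbb Z$ let $C^{d,q}(\mathfrak m,\mathfrak p)$ be the space of $q$-linear maps $\mathfrak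 m^q\to\mathfrak p$ that are skew-symmetric in the super sense and of degree $d$ (that is, they map $\mathfrak m_{i_1}\times\dots\times\mathfrak m_{i_q}$ to $\mathfrak p_{i_1+\dots+i_q+d}$, where $\mathfrak m_{-1}=S$, $\mathfrak m_{-2}=V$); their $\mathbb Z_2$-parity is that of $d$. Let $\partial:C^{d,q}(\mathfrak m,\mathfrak p)\to C^{d,q+1}(\mathfrak m,\mathfrak p)$ be the Chevalley–Eilenberg differential of the Lie superalgebra $\mathfrak m$ with values in its adjoint module $\mathfrak p$, and let $H^{d,2}(\mathfrak m,\mathfrak p)=\ker(\partial|_{C^{d,2}})/\partial(C^{d,1})$, with the $\mathfrak{so}(V)$-action induced by that on cochains. Let $Z$ be the grading element, which acts on $\mathfrak p_k$ as multiplication by $k$, and let $\mathbb RZ\oplus\mathfrak p$ be the corresponding extension of $\mathfrak p$. Then: 1. $H^{1,2}(\mathfrak m,\mathfrak p)\cong S$ as an $\mathfrak{so}(V)$-representation; in particular it is odd, nontrivial and irreducible. More precisely, for each $\phi\in S^*$ the cochain $\partial(Z\otimes\phi)$, computed with values in $\mathbb RZ\oplus\mathfrak p$, takes values in $\mathfrak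 p$ and is a cocycle in $C^{1,2}(\mathfrak m,\mathfrak p)$, and $\phi\mapsto[\partial(Z\otimes\phi)]$ is an $\mathfrak{so}(V)$-equivariant isomorphism $S^*\to H^{1,2}(\mathfrak m,\mathfrak p)$. 2. $H^{2,2}(\mathfrak m,\mathfrak p)\cong\Lambda^4V$ as an $\mathfrak{so}(V)$-representation; in particular it is even, nontrivial and irreducible. 3. $H^{3,2}(\mathfrak m,\mathfrak p)=H^{4,2}(\mathfrak m,\mathfrak p)=0$. 4. For all $d\ge5$ one has $C^{d,2}(\mathfrak m,\mathfrak p)=0$, and hence $H^{d,2}(\mathfrak m,\mathfrak p)=0$. -/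

import Mathlib

set_option maxSynthPendingDepth 3

noncomputable section

attribute [local instance 100] LieRing.ofAssociativeRing

namespace Spencer

universe u w

section Lorentz

/-- A Lorentzian inner product of signature `(1,10)` (mostly minus) on a real vector space `V`;
in particular `V` has dimension `11` and the form is symmetric and nondegenerate. -/
structure LorentzForm (V : Type u) [AddCommGroup V] [Module ℝ V] where
  /-- the bilinear form `η` -/
  form : LinearMap.BilinForm ℝ V
  /-- there is an orthonormal basis with one vector of square `1` and ten of square `-1` -/
  exists_basis : ∃ e : Module.Basis (Fin 11) ℝ V, ∀ i j,
    form (e i) (e j) = if i = j then (if i = 0 then 1 else -1) else 0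

variable {V : Type u} [AddCommGroup V] [Module ℝ V] (η : LorentzForm V)

/-- The number `η(e_i, e_i)` for an orthonormal basis. -/
def sgn (i : Fin 11) : ℝ := if i = 0 then 1 else -1

/-- A chosen orthonormal basis. -/
def LorentzForm.basis : Module.Basis (Fin 11) ℝ V := η.exists_basis.choose

theorem LorentzForm.basis_spec (i j : Fin 11) :
    η.form (η.basis i) (η.basis j) = if i = j then sgn i else 0 :=
  η.exists_basis.choose_spec i j

theorem sgn_mul_self (i : Fin 11) : sgn i * sgn i = 1 := by
  unfold sgn; split_ifs <;> norm_num

theorem LorentzForm.symm (v x : V) : η.form v x = η.form x v := by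
  have h : η.form = η.form.flip := by
    refine η.basis.ext fun i => η.basis.ext fun j => ?_
    change _ = η.form (η.basis j) (η.basis i)
    rw [η.basis_spec, η.basis_spec]
    by_cases hij : i = j
    · simp [hij]
    · simp [hij, Ne.symm hij]
  exact congrArg (fun B : LinearMap.BilinForm ℝ V => B v x) h

theorem LorentzForm.form_basis (i : Fin 11) (v : V) :
    η.form (η.basis i) v = sgn i * η.basis.repr v i := by
  have h : η.form (η.basis i) = sgn i • η.basis.coord i := by
    refine η.basis.ext fun j => ?_
    rw [η.basis_spec]
    by_cases hij : i = j
    · simp [hij]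
    · simp [hij]
  rw [h]; simp

theorem LorentzForm.expand (v : V) :
    v = ∑ i, (sgn i * η.form (η.basis i) v) • η.basis i := by
  simp_rw [η.form_basis, ← mul_assoc, sgn_mul_self, one_mul]
  exact (η.basis.sum_repr v).symm

/-- The Lorentz algebra `so(V)`: the `η`-skew endomorphisms of `V`. -/
def So : Type u := skewAdjointLieSubalgebra η.form

instance : LieRing (So η) := inferInstanceAs (LieRing (skewAdjointLieSubalgebra η.form))

instance : LieAlgebra ℝ (So η) :=
  inferInstanceAs (LieAlgebra ℝ (skewAdjointLieSubalgebra η.form))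

/-- The natural representation of `so(V)` on `V`. -/
def vec : So η →ₗ⁅ℝ⁆ Module.End ℝ V := (skewAdjointLieSubalgebra η.form).incl

theorem So.skew (A : So η) (v x : V) : η.form (vec η A v) x = -η.form v (vec η A x) := by
  have h : η.form (vec η A v) x = (-η.form) v (vec η A x) := A.2 v x
  simpa using h

theorem vec_lie (A B : So η) (v : V) :
    vec η ⁅A, B⁆ v = vec η A (vec η B v) - vec η B (vec η A v) := by
  rw [LieHom.map_lie, LieRing.of_associative_ring_bracket]; rfl

/-- The quadratic form of the Clifford algebra, with the convention `v · v = -η(v,v)`. -/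
def LorentzForm.cliffordForm : QuadraticForm ℝ V := -η.form.toQuadraticMap

/-- The Clifford algebra `Cl(V)`. -/
abbrev Cl : Type u := CliffordAlgebra η.cliffordForm

end Lorentz

section Spinors

variable {V : Type u} [AddCommGroup V] [Module ℝ V] (η : LorentzForm V)
variable (S : Type w) [AddCommGroup S] [Module ℝ S] [Module (Cl η) S] [IsScalarTower ℝ (Cl η) S]

/-- Clifford multiplication `v · s` by vectors on a `Cl(V)`-module. -/
def cliff : V →ₗ[ℝ] Module.End ℝ S :=
  (Algebra.lsmul ℝ ℝ S : Cl η →ₐ[ℝ] Module.End ℝ S).toLinearMap ∘ₗ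
    CliffordAlgebra.ι η.cliffordForm

theorem cliff_apply (v : V) (s : S) :
    cliff η S v s = CliffordAlgebra.ι η.cliffordForm v • s := rfl

theorem cliff_anticomm (v x : V) :
    cliff η S v * cliff η S x = -(cliff η S x * cliff η S v) - (2 * η.form v x) • 1 := by
  ext s
  have h := CliffordAlgebra.ι_mul_ι_add_swap (Q := η.cliffordForm) v x
  have h2 := congrArg (fun a : Cl η => a • s) h
  simp only [add_smul, mul_smul, algebraMap_smul] at h2
  have h3 : QuadraticMap.polar η.cliffordForm v x = -(2 * η.form v x) := by
    simp [QuadraticMap.polar, LorentzForm.cliffordForm, η.symm x v]; ring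
  rw [h3] at h2
  simp only [Module.End.mul_apply, LinearMap.sub_apply, LinearMap.neg_apply, LinearMap.smul_apply,
    Module.End.one_apply, cliff_apply]
  rw [neg_smul] at h2
  rw [sub_eq_add_neg, ← h2]
  abel

/-- The underlying linear map of the spin representation,
`A ↦ ¼ ∑ᵢ eⁱ · A(eᵢ) ·`, where `(eⁱ)` is the `η`-dual basis of an orthonormal basis `(eᵢ)`
(the sum does not depend on the basis). -/
def spinLin : So η →ₗ[ℝ] Module.End ℝ S where
  toFun A := (1 / 4 : ℝ) • ∑ i, sgn i •
    (cliff η S (η.basis i) * cliff η S (vec η A (η.basis i)))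
  map_add' A B := by
    simp [mul_add, smul_add, Finset.sum_add_distrib]
  map_smul' c A := by
    simp only [map_smul, LinearMap.smul_apply, mul_smul_comm, RingHom.id_apply, Finset.smul_sum]
    refine Finset.sum_congr rfl fun i _ => ?_
    module

/-- The spin action satisfies `[A, v ·] = (A v) ·`. -/
theorem spinLin_cliff (A : So η) (v : V) :
    spinLin η S A * cliff η S v - cliff η S v * spinLin η S A =
      cliff η S (vec η A v) := by
  have key : ∀ i, cliff η S (η.basis i) * cliff η S (vec η A (η.basis i)) *
      cliff η S v - cliff η S v * (cliff η S (η.basis i) *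
      cliff η S (vec η A (η.basis i))) =
      (2 * η.form (η.basis i) v) • cliff η S (vec η A (η.basis i)) +
      (2 * η.form (η.basis i) (vec η A v)) • cliff η S (η.basis i) := by
    intro i
    have h1 := cliff_anticomm η S (vec η A (η.basis i)) v
    have h2 := cliff_anticomm η S v (η.basis i)
    rw [mul_assoc, h1, ← mul_assoc (cliff η S v), h2, So.skew, η.symm v]
    simp only [mul_sub, sub_mul, mul_neg, neg_mul, mul_smul_comm, smul_mul_assoc, mul_one, one_mul,
      mul_assoc]
    module
  have e1 : cliff η S (vec η A v) =
      ∑ i, (sgn i * η.form (η.basis i) v) • cliff η S (vec η A (η.basis i)) := by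
    conv_lhs => rw [η.expand v]
    simp [map_sum]
  have e2 : cliff η S (vec η A v) =
      ∑ i, (sgn i * η.form (η.basis i) (vec η A v)) • cliff η S (η.basis i) := by
    conv_lhs => rw [η.expand (vec η A v)]
    simp [map_sum]
  have e3 : (4 : ℝ) • cliff η S (vec η A v) =
      ∑ i, sgn i • ((2 * η.form (η.basis i) v) • cliff η S (vec η A (η.basis i)) +
      (2 * η.form (η.basis i) (vec η A v)) • cliff η S (η.basis i)) := by
    have : (4 : ℝ) • cliff η S (vec η A v) =
      (2 : ℝ) • cliff η S (vec η A v) +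
      (2 : ℝ) • cliff η S (vec η A v) := by module
    rw [this]
    nth_rewrite 1 [e1]
    rw [e2, Finset.smul_sum, Finset.smul_sum, ← Finset.sum_add_distrib]
    refine Finset.sum_congr rfl fun i _ => ?_
    module
  have e4 : spinLin η S A * cliff η S v - cliff η S v * spinLin η S A =
      (1 / 4 : ℝ) • ((4 : ℝ) • cliff η S (vec η A v)) := by
    rw [e3]
    simp only [← key]
    simp only [spinLin, LinearMap.coe_mk, AddHom.coe_mk, smul_mul_assoc, mul_smul_comm,
      Finset.sum_mul, Finset.mul_sum, smul_sub, Finset.sum_sub_distrib]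
  rw [e4, smul_smul]; norm_num

theorem spinLin_lie (A B : So η) :
    spinLin η S ⁅A, B⁆ = spinLin η S A * spinLin η S B - spinLin η S B * spinLin η S A := by
  have hc : ∀ v, spinLin η S A * cliff η S v = cliff η S v * spinLin η S A +
      cliff η S (vec η A v) := fun v => by
    rw [← spinLin_cliff η S A v]; abel
  -- invariance of the Casimir tensor
  have cas : ∑ i, sgn i • (cliff η S (vec η A (η.basis i)) *
      cliff η S (vec η B (η.basis i))) =
      -∑ i, sgn i • (cliff η S (η.basis i) *
        cliff η S (vec η B (vec η A (η.basis i)))) := by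
    have l1 : ∀ i, cliff η S (vec η A (η.basis i)) =
        ∑ j, (sgn j * η.form (η.basis j) (vec η A (η.basis i))) •
          cliff η S (η.basis j) := fun i => by
      conv_lhs => rw [η.expand (vec η A (η.basis i))]
      simp [map_sum]
    have l2 : ∀ i, cliff η S (vec η B (vec η A (η.basis i))) =
        ∑ j, (sgn j * η.form (η.basis j) (vec η A (η.basis i))) •
          cliff η S (vec η B (η.basis j)) := fun i => by
      conv_lhs => rw [η.expand (vec η A (η.basis i))]
      simp [map_sum]
    simp only [l1, l2, Finset.sum_mul, Finset.mul_sum, Finset.smul_sum, ← Finset.sum_neg_distrib]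
    rw [Finset.sum_comm]
    refine Finset.sum_congr rfl fun i _ => Finset.sum_congr rfl fun j _ => ?_
    rw [η.symm (η.basis i), So.skew]
    simp only [smul_mul_assoc, mul_smul_comm]
    module
  have hB : ∀ C : So η, spinLin η S C = (1 / 4 : ℝ) • ∑ i, sgn i •
    (cliff η S (η.basis i) * cliff η S (vec η C (η.basis i))) := fun C => rfl
  have comm : spinLin η S A * spinLin η S B - spinLin η S B * spinLin η S A =
      (1 / 4 : ℝ) • (∑ i, sgn i • (cliff η S (vec η A (η.basis i)) *
      cliff η S (vec η B (η.basis i))) +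
      ∑ i, sgn i • (cliff η S (η.basis i) *
        cliff η S (vec η A (vec η B (η.basis i))))) := by
    rw [hB B]
    simp only [mul_smul_comm, smul_mul_assoc, Finset.mul_sum, Finset.sum_mul]
    rw [← smul_sub, ← Finset.sum_sub_distrib, ← Finset.sum_add_distrib]
    congr 1
    refine Finset.sum_congr rfl fun i _ => ?_
    rw [← smul_sub, ← smul_add]
    congr 1
    rw [← mul_assoc, hc, add_mul, mul_assoc, hc, mul_add, mul_assoc]
    abel
  rw [comm, cas, hB, ← Finset.sum_neg_distrib, ← Finset.sum_add_distrib]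
  congr 1
  refine Finset.sum_congr rfl fun i _ => ?_
  rw [vec_lie, map_sub, mul_sub]
  module

/-- The spin representation of `so(V)` on `S`. -/
def spin : So η →ₗ⁅ℝ⁆ Module.End ℝ S :=
  { spinLin η S with
    map_lie' := fun {A B} => by
      rw [LieRing.of_associative_ring_bracket]
      exact spinLin_lie η S A B }

theorem spin_cliff (A : So η) (v : V) (s : S) :
    spin η S A (cliff η S v s) = cliff η S v (spin η S A s) +
      cliff η S (vec η A v) s := by
  have h := congrArg (fun f : Module.End ℝ S => f s) (spinLin_cliff η S A v)
  simp only [LinearMap.sub_apply, Module.End.mul_apply] at h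
  rw [← h]
  change spinLin η S A _ = cliff η S v (spinLin η S A s) + _
  abel

/-- An `so(V)`-invariant symplectic structure `⟨-,-⟩` on `S`. -/
structure SpinSymplectic where
  /-- the bilinear form `⟨-,-⟩` -/
  form : LinearMap.BilinForm ℝ S
  alt : form.IsAlt
  nondegenerate : form.Nondegenerate
  invariant : ∀ (A : So η) (s t : S), form (spin η S A s) t + form s (spin η S A t) = 0

end Spinors

section Poincare

variable {V : Type u} [AddCommGroup V] [Module ℝ V] {η : LorentzForm V}
variable {S : Type w} [AddCommGroup S] [Module ℝ S] [Module (Cl η) S] [IsScalarTower ℝ (Cl η) S]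
variable (ω : SpinSymplectic η S)

/-- The Dirac current `κ : S × S → V`, the symmetric bilinear map with
`η(κ(s,s), v) = ⟨s, v · s⟩`. -/
def dirac : S →ₗ[ℝ] S →ₗ[ℝ] V :=
  LinearMap.mk₂ ℝ
    (fun s t => ∑ i, (sgn i * ((1 / 2) * (ω.form s (cliff η S (η.basis i) t) +
      ω.form t (cliff η S (η.basis i) s)))) • η.basis i)
    (fun s s' t => by
      rw [← Finset.sum_add_distrib]
      refine Finset.sum_congr rfl fun i _ => ?_
      simp only [map_add, LinearMap.add_apply]
      module)
    (fun c s t => by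
      rw [Finset.smul_sum]
      refine Finset.sum_congr rfl fun i _ => ?_
      simp only [map_smul, LinearMap.smul_apply, smul_eq_mul]
      module)
    (fun s t t' => by
      rw [← Finset.sum_add_distrib]
      refine Finset.sum_congr rfl fun i _ => ?_
      simp only [map_add, LinearMap.add_apply]
      module)
    (fun c s t => by
      rw [Finset.smul_sum]
      refine Finset.sum_congr rfl fun i _ => ?_
      simp only [map_smul, LinearMap.smul_apply, smul_eq_mul]
      module)

theorem LorentzForm.ext_form {v x : V} (h : ∀ y, η.form v y = η.form x y) : v = x := by
  rw [η.expand v, η.expand x]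
  refine Finset.sum_congr rfl fun i _ => ?_
  rw [η.symm _ v, η.symm _ x, h]

theorem dirac_polar (s t : S) (v : V) :
    η.form (dirac ω s t) v =
      (1 / 2) * (ω.form s (cliff η S v t) + ω.form t (cliff η S v s)) := by
  have h : η.form (dirac ω s t) = (1 / 2 : ℝ) • ((ω.form s) ∘ₗ (cliff η S).flip t +
      (ω.form t) ∘ₗ (cliff η S).flip s) := by
    refine η.basis.ext fun j => ?_
    rw [η.symm, η.form_basis]
    simp only [dirac, LinearMap.mk₂_apply, Module.Basis.repr_sum_self, ← mul_assoc, sgn_mul_self]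
    simp [mul_add]
  rw [h]; simp [mul_add]

theorem dirac_spec (s : S) (v : V) : η.form (dirac ω s s) v = ω.form s (cliff η S v s) := by
  rw [dirac_polar]; ring

theorem dirac_symm (s t : S) : dirac ω s t = dirac ω t s :=
  LorentzForm.ext_form (η := η) fun v => by rw [dirac_polar, dirac_polar, add_comm]

theorem dirac_equivariant (A : So η) (s t : S) :
    vec η A (dirac ω s t) = dirac ω (spin η S A s) t + dirac ω s (spin η S A t) := by
  refine LorentzForm.ext_form (η := η) fun v => ?_
  rw [So.skew, map_add, LinearMap.add_apply, dirac_polar, dirac_polar, dirac_polar]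
  have h1 : ∀ s t : S, ω.form s (cliff η S (vec η A v) t) =
      -ω.form (spin η S A s) (cliff η S v t) - ω.form s (cliff η S v (spin η S A t)) := by
    intro s t
    have := ω.invariant A s (cliff η S v t)
    rw [spin_cliff, map_add] at this
    linarith
  rw [h1, h1]; ring

variable (η S) in
/-- The underlying space of the Poincaré superalgebra `p = so(V) ⊕ S ⊕ V`. -/
abbrev Poincare : Type (max u w) := So η × S × V

/-- The bracket of the Poincaré superalgebra:
`[A + s + v, B + t + x] = [A,B] + (A s' - B s) + (A x - B v + κ(s,t))`; it is symmetric on the odd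
part `S` and skew otherwise. -/
def bracket : Poincare η S →ₗ[ℝ] Poincare η S →ₗ[ℝ] Poincare η S :=
  LinearMap.mk₂ ℝ
    (fun x y => (⁅x.1, y.1⁆, spin η S x.1 y.2.1 - spin η S y.1 x.2.1,
      vec η x.1 y.2.2 - vec η y.1 x.2.2 + dirac ω x.2.1 y.2.1))
    (fun x x' y => by
      simp only [Prod.fst_add, Prod.snd_add, map_add, LinearMap.add_apply, add_lie,
        Prod.mk_add_mk]
      refine Prod.ext rfl (Prod.ext ?_ ?_) <;> dsimp only <;> abel)
    (fun c x y => by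
      simp only [Prod.smul_fst, Prod.smul_snd, map_smul, LinearMap.smul_apply, smul_lie,
        Prod.smul_mk, smul_add, smul_sub])
    (fun x y y' => by
      simp only [Prod.fst_add, Prod.snd_add, map_add, LinearMap.add_apply, lie_add,
        Prod.mk_add_mk]
      refine Prod.ext rfl (Prod.ext ?_ ?_) <;> dsimp only <;> abel)
    (fun c x y => by
      simp only [Prod.smul_fst, Prod.smul_snd, map_smul, LinearMap.smul_apply, lie_smul,
        Prod.smul_mk, smul_add, smul_sub])

theorem bracket_apply (x y : Poincare η S) :
    bracket ω x y = (⁅x.1, y.1⁆, spin η S x.1 y.2.1 - spin η S y.1 x.2.1,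
      vec η x.1 y.2.2 - vec η y.1 x.2.2 + dirac ω x.2.1 y.2.1) := rfl

variable (η S) in
/-- The `ℤ`-grading of `p`: `p_0 = so(V)`, `p_{-1} = S`, `p_{-2} = V`, and `p_k = 0` otherwise. -/
def grade (k : ℤ) : Submodule ℝ (Poincare η S) where
  carrier := {x | (k ≠ 0 → x.1 = 0) ∧ (k ≠ -1 → x.2.1 = 0) ∧ (k ≠ -2 → x.2.2 = 0)}
  zero_mem' := by simp
  add_mem' := by
    rintro x y ⟨h1, h2, h3⟩ ⟨g1, g2, g3⟩
    exact ⟨fun h => by simp [h1 h, g1 h], fun h => by simp [h2 h, g2 h],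
      fun h => by simp [h3 h, g3 h]⟩
  smul_mem' := by
    rintro c x ⟨h1, h2, h3⟩
    exact ⟨fun h => by simp [h1 h], fun h => by simp [h2 h], fun h => by simp [h3 h]⟩

variable (η S) in
/-- The inclusion into `p` of the supertranslation ideal `m = S ⊕ V`. -/
def incl : S × V →ₗ[ℝ] Poincare η S := LinearMap.inr ℝ (So η) (S × V)

/-- The bracket of `m`. -/
def mBracket : S × V →ₗ[ℝ] S × V →ₗ[ℝ] S × V :=
  ((dirac ω).compl₁₂ (LinearMap.fst ℝ S V) (LinearMap.fst ℝ S V)).compr₂ (LinearMap.inr ℝ S V)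

theorem mBracket_apply (x y : S × V) : mBracket ω x y = (0, dirac ω x.1 y.1) := rfl

theorem incl_mBracket (x y : S × V) :
    incl η S (mBracket ω x y) = bracket ω (incl η S x) (incl η S y) := by
  simp [incl, mBracket_apply, bracket_apply]

/-- The adjoint action of `m` on `p`. -/
def adj : S × V →ₗ[ℝ] Poincare η S →ₗ[ℝ] Poincare η S := bracket ω ∘ₗ incl η S

theorem adj_apply (x : S × V) (y : Poincare η S) :
    adj ω x y = (0, -spin η S y.1 x.1, -vec η y.1 x.2 + dirac ω x.1 y.2.1) := by
  simp [adj, incl, bracket_apply]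

variable (η S) in
/-- The grading derivation of `p`, which is multiplication by `k` on `p_k`. -/
def gradingDer : Poincare η S →ₗ[ℝ] Poincare η S :=
  LinearMap.prodMap 0 (LinearMap.prodMap ((-1 : ℝ) • LinearMap.id) ((-2 : ℝ) • LinearMap.id))

/-- The bracket of the extension `ℝZ ⊕ p` of `p` by its grading element `Z = (1,0)`:
`[aZ + x, bZ + y] = [x,y] + a [Z,y] - b [Z,x]`, where `[Z,y] = k y` for `y ∈ p_k`. -/
def extBracket : ℝ × Poincare η S →ₗ[ℝ] ℝ × Poincare η S →ₗ[ℝ] ℝ × Poincare η S :=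
  LinearMap.mk₂ ℝ
    (fun x y => (0, bracket ω x.2 y.2 + x.1 • gradingDer η S y.2 - y.1 • gradingDer η S x.2))
    (fun x x' y => by
      refine Prod.ext (by simp) ?_
      simp only [Prod.fst_add, Prod.snd_add, map_add, LinearMap.add_apply]
      module)
    (fun c x y => by
      refine Prod.ext (by simp) ?_
      simp only [Prod.smul_fst, Prod.smul_snd, map_smul, LinearMap.smul_apply, smul_eq_mul]
      module)
    (fun x y y' => by
      refine Prod.ext (by simp) ?_
      simp only [Prod.fst_add, Prod.snd_add, map_add]
      module)
    (fun c x y => by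
      refine Prod.ext (by simp) ?_
      simp only [Prod.smul_fst, Prod.smul_snd, map_smul, smul_eq_mul]
      module)

/-- The adjoint action of `m` on `ℝZ ⊕ p`. -/
def extAdj : S × V →ₗ[ℝ] ℝ × Poincare η S →ₗ[ℝ] ℝ × Poincare η S :=
  extBracket ω ∘ₗ LinearMap.inr ℝ ℝ (Poincare η S) ∘ₗ incl η S

end Poincare

section Complex

variable {V : Type u} [AddCommGroup V] [Module ℝ V] {S : Type w} [AddCommGroup S] [Module ℝ S]

/-- The grading `m_{-1} = S`, `m_{-2} = V` of `m = S ⊕ V`, with `m_k = 0` otherwise. -/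
def mGrade (S : Type w) (V : Type u) [AddCommGroup V] [Module ℝ V] [AddCommGroup S] [Module ℝ S]
    (k : ℤ) : Submodule ℝ (S × V) where
  carrier := {x | (k ≠ -1 → x.1 = 0) ∧ (k ≠ -2 → x.2 = 0)}
  zero_mem' := by simp
  add_mem' := by
    rintro x y ⟨h1, h2⟩ ⟨g1, g2⟩
    exact ⟨fun h => by simp [h1 h, g1 h], fun h => by simp [h2 h, g2 h]⟩
  smul_mem' := by
    rintro c x ⟨h1, h2⟩
    exact ⟨fun h => by simp [h1 h], fun h => by simp [h2 h]⟩

/-- The projection of `m` onto its component `m_k`. -/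
def proj (S : Type w) (V : Type u) [AddCommGroup V] [Module ℝ V] [AddCommGroup S] [Module ℝ S]
    (k : ℤ) : S × V →ₗ[ℝ] S × V :=
  LinearMap.prodMap (if k = -1 then LinearMap.id else 0) (if k = -2 then LinearMap.id else 0)

/-- The Koszul sign `(-1)^n`. The parity of a homogeneous element is that of its degree. -/
def eps (n : ℤ) : ℝ := (-1) ^ n

variable {W : Type*} [AddCommGroup W] [Module ℝ W]
variable (br : S × V →ₗ[ℝ] S × V →ₗ[ℝ] S × V) (act : S × V →ₗ[ℝ] W →ₗ[ℝ] W)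

/-- The Chevalley-Eilenberg differential of a `1`-cochain `b` of degree `d` with values in the
`m`-module `W`, for the components of degrees `i, j` of the arguments:
`∂b(x,y) = (-1)^{|x||b|} x·b(y) - (-1)^{|y|(|b|+|x|)} y·b(x) - b([x,y])`. -/
def d₁Hom (d i j : ℤ) (b : S × V →ₗ[ℝ] W) : S × V →ₗ[ℝ] S × V →ₗ[ℝ] W :=
  LinearMap.mk₂ ℝ
    (fun x y => eps (i * d) • act (proj S V i x) (b (proj S V j y))
      - eps (j * (d + i)) • act (proj S V j y) (b (proj S V i x))
      - b (br (proj S V i x) (proj S V j y)))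
    (fun x x' y => by simp only [map_add, LinearMap.add_apply]; module)
    (fun c x y => by simp only [map_smul, LinearMap.smul_apply]; module)
    (fun x y y' => by simp only [map_add, LinearMap.add_apply]; module)
    (fun c x y => by simp only [map_smul, LinearMap.smul_apply]; module)

/-- The Spencer differential on `1`-cochains of degree `d`. -/
def d₁ (d : ℤ) : (S × V →ₗ[ℝ] W) →ₗ[ℝ] (S × V →ₗ[ℝ] S × V →ₗ[ℝ] W) where
  toFun b := ∑ i ∈ ({-1, -2} : Finset ℤ), ∑ j ∈ ({-1, -2} : Finset ℤ), d₁Hom br act d i j b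
  map_add' b b' := by
    simp only [← Finset.sum_add_distrib]
    refine Finset.sum_congr rfl fun i _ => Finset.sum_congr rfl fun j _ => ?_
    refine LinearMap.ext₂ fun x y => ?_
    simp only [d₁Hom, LinearMap.mk₂_apply, map_add, LinearMap.add_apply]
    module
  map_smul' c b := by
    simp only [Finset.smul_sum]
    refine Finset.sum_congr rfl fun i _ => Finset.sum_congr rfl fun j _ => ?_
    refine LinearMap.ext₂ fun x y => ?_
    simp only [d₁Hom, LinearMap.mk₂_apply, map_smul, LinearMap.smul_apply, RingHom.id_apply]
    module

/-- The Chevalley-Eilenberg differential of a `2`-cochain `c` of degree `d` with values in the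
`m`-module `W`, for the components of degrees `i, j, k` of the arguments:
`∂c(x,y,z) = (-1)^{|x||c|} x·c(y,z) - (-1)^{|y|(|c|+|x|)} y·c(x,z)
  + (-1)^{|z|(|c|+|x|+|y|)} z·c(x,y) - c([x,y],z) + (-1)^{|y||z|} c([x,z],y) + c(x,[y,z])`. -/
def d₂Hom (d i j k : ℤ) (c : S × V →ₗ[ℝ] S × V →ₗ[ℝ] W) :
    S × V →ₗ[ℝ] S × V →ₗ[ℝ] S × V →ₗ[ℝ] W where
  toFun x := LinearMap.mk₂ ℝ
    (fun y z => eps (i * d) • act (proj S V i x) (c (proj S V j y) (proj S V k z))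
      - eps (j * (d + i)) • act (proj S V j y) (c (proj S V i x) (proj S V k z))
      + eps (k * (d + i + j)) • act (proj S V k z) (c (proj S V i x) (proj S V j y))
      - c (br (proj S V i x) (proj S V j y)) (proj S V k z)
      + eps (j * k) • c (br (proj S V i x) (proj S V k z)) (proj S V j y)
      + c (proj S V i x) (br (proj S V j y) (proj S V k z)))
    (fun y y' z => by simp only [map_add, LinearMap.add_apply]; module)
    (fun r y z => by simp only [map_smul, LinearMap.smul_apply]; module)
    (fun y z z' => by simp only [map_add, LinearMap.add_apply]; module)
    (fun r y z => by simp only [map_smul, LinearMap.smul_apply]; module)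
  map_add' x x' := by
    refine LinearMap.ext₂ fun y z => ?_
    simp only [LinearMap.mk₂_apply, map_add, LinearMap.add_apply]; module
  map_smul' r x := by
    refine LinearMap.ext₂ fun y z => ?_
    simp only [LinearMap.mk₂_apply, map_smul, LinearMap.smul_apply, RingHom.id_apply]; module

/-- The Spencer differential on `2`-cochains of degree `d`. -/
def d₂ (d : ℤ) :
    (S × V →ₗ[ℝ] S × V →ₗ[ℝ] W) →ₗ[ℝ] (S × V →ₗ[ℝ] S × V →ₗ[ℝ] S × V →ₗ[ℝ] W) where
  toFun c := ∑ i ∈ ({-1, -2} : Finset ℤ), ∑ j ∈ ({-1, -2} : Finset ℤ),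
    ∑ k ∈ ({-1, -2} : Finset ℤ), d₂Hom br act d i j k c
  map_add' b b' := by
    simp only [← Finset.sum_add_distrib]
    refine Finset.sum_congr rfl fun i _ => Finset.sum_congr rfl fun j _ =>
      Finset.sum_congr rfl fun k _ => ?_
    refine LinearMap.ext fun x => LinearMap.ext₂ fun y z => ?_
    simp only [d₂Hom, LinearMap.mk₂_apply, map_add, LinearMap.add_apply, LinearMap.coe_mk,
      AddHom.coe_mk]
    module
  map_smul' r b := by
    simp only [Finset.smul_sum]
    refine Finset.sum_congr rfl fun i _ => Finset.sum_congr rfl fun j _ =>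
      Finset.sum_congr rfl fun k _ => ?_
    refine LinearMap.ext fun x => LinearMap.ext₂ fun y z => ?_
    simp only [d₂Hom, LinearMap.mk₂_apply, map_smul, LinearMap.smul_apply, RingHom.id_apply,
      LinearMap.coe_mk, AddHom.coe_mk]
    module

/-- The space `C^{d,1}` of `1`-cochains of degree `d` with values in a graded space. -/
def C₁ (gr : ℤ → Submodule ℝ W) (d : ℤ) : Submodule ℝ (S × V →ₗ[ℝ] W) where
  carrier := {b | ∀ i, ∀ x ∈ mGrade S V i, b x ∈ gr (i + d)}
  zero_mem' := fun i x _ => by simp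
  add_mem' := fun hb hb' i x hx => add_mem (hb i x hx) (hb' i x hx)
  smul_mem' := fun c _ hb i x hx => Submodule.smul_mem _ c (hb i x hx)

/-- The space `C^{d,2}` of `2`-cochains of degree `d` with values in a graded space: bilinear maps
of degree `d` that are skew-symmetric in the super sense. -/
def C₂ (gr : ℤ → Submodule ℝ W) (d : ℤ) : Submodule ℝ (S × V →ₗ[ℝ] S × V →ₗ[ℝ] W) where
  carrier := {c | ∀ i j, ∀ x ∈ mGrade S V i, ∀ y ∈ mGrade S V j,
    c y x = -eps (i * j) • c x y ∧ c x y ∈ gr (i + j + d)}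
  zero_mem' := fun i j x _ y _ => by simp
  add_mem' := fun {c c'} hc hc' i j x hx y hy => by
    refine ⟨?_, add_mem (hc i j x hx y hy).2 (hc' i j x hx y hy).2⟩
    simp only [LinearMap.add_apply, (hc i j x hx y hy).1, (hc' i j x hx y hy).1]
    module
  smul_mem' := fun r c hc i j x hx y hy => by
    refine ⟨?_, Submodule.smul_mem _ r (hc i j x hx y hy).2⟩
    simp only [LinearMap.smul_apply, (hc i j x hx y hy).1]
    module

theorem eps_add (m n : ℤ) : eps (m + n) = eps m * eps n := zpow_add₀ (by norm_num) m n

theorem eps_neg (n : ℤ) : eps (-n) = eps n := by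
  simp [eps, zpow_neg, ← inv_zpow]

theorem eps_two_mul (n : ℤ) : eps (2 * n) = 1 := (even_two_mul n).neg_one_zpow

theorem eps_one : eps 1 = -1 := by simp [eps]

theorem eps_two : eps 2 = 1 := by simp [eps]

theorem eps_four : eps 4 = 1 := by norm_num [eps]

theorem eps_zero : eps 0 = 1 := by simp [eps]

theorem eps_cases (n : ℤ) : eps n = 1 ∨ eps n = -1 := by
  rcases Int.even_or_odd n with h | h
  · exact Or.inl h.neg_one_zpow
  · exact Or.inr h.neg_one_zpow

theorem mGrade_left (s : S) : (s, (0 : V)) ∈ mGrade S V (-1) := by simp [mGrade]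

theorem mGrade_right (v : V) : ((0 : S), v) ∈ mGrade S V (-2) := by simp [mGrade]

theorem mGrade_cases {i : ℤ} {x : S × V} (hx : x ∈ mGrade S V i) :
    (i = -1 ∧ ∃ s, x = (s, 0)) ∨ (i = -2 ∧ ∃ v, x = (0, v)) ∨ x = 0 := by
  obtain ⟨s, v⟩ := x
  obtain ⟨h1, h2⟩ := hx
  by_cases h : i = -1
  · exact Or.inl ⟨h, s, by rw [show v = 0 from h2 (by omega)]⟩
  · by_cases h' : i = -2
    · exact Or.inr (Or.inl ⟨h', v, by rw [show s = 0 from h1 h]⟩)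
    · exact Or.inr (Or.inr (by rw [show s = 0 from h1 h, show v = 0 from h2 h']; rfl))

theorem ext_m {M : Type*} [AddCommGroup M] [Module ℝ M] {f g : S × V →ₗ[ℝ] M}
    (h1 : ∀ s, f (s, 0) = g (s, 0)) (h2 : ∀ v, f (0, v) = g (0, v)) : f = g := by
  refine LinearMap.ext fun ⟨s, v⟩ => ?_
  have : ((s, v) : S × V) = (s, 0) + (0, v) := by simp
  rw [this, map_add, map_add, h1, h2]

theorem proj_of_mem {i : ℤ} (hi : i = -1 ∨ i = -2) {x : S × V} (hx : x ∈ mGrade S V i) (j : ℤ) :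
    proj S V j x = if j = i then x else 0 := by
  obtain ⟨s, v⟩ := x
  obtain ⟨h1, h2⟩ := hx
  by_cases h : j = i
  · subst h
    rcases hi with rfl | rfl
    · simp [proj, show v = 0 from h2 (by decide)]
    · simp [proj, show s = 0 from h1 (by decide)]
  · rcases hi with rfl | rfl
    · simp [proj, h, show v = 0 from h2 (by decide)]
    · simp [proj, h, show s = 0 from h1 (by decide)]

/-- The differential on homogeneous arguments. -/
theorem d₂_homog (d : ℤ) (c : S × V →ₗ[ℝ] S × V →ₗ[ℝ] W) {i j k : ℤ}
    (hi : i = -1 ∨ i = -2) (hj : j = -1 ∨ j = -2) (hk : k = -1 ∨ k = -2) {x y z : S × V}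
    (hx : x ∈ mGrade S V i) (hy : y ∈ mGrade S V j) (hz : z ∈ mGrade S V k) :
    d₂ br act d c x y z = eps (i * d) • act x (c y z) - eps (j * (d + i)) • act y (c x z)
      + eps (k * (d + i + j)) • act z (c x y) - c (br x y) z + eps (j * k) • c (br x z) y
      + c x (br y z) := by
  simp only [d₂, d₂Hom, LinearMap.coe_mk, AddHom.coe_mk, LinearMap.coe_sum, Finset.sum_apply,
    LinearMap.mk₂_apply]
  rw [Finset.sum_eq_single i, Finset.sum_eq_single j, Finset.sum_eq_single k]
  · simp [proj_of_mem hi hx, proj_of_mem hj hy, proj_of_mem hk hz]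
  · intro l _ hl; simp [proj_of_mem hk hz, hl]
  · intro h; simp at h; omega
  · intro l _ hl; simp [proj_of_mem hj hy, hl]
  · intro h; simp at h; omega
  · intro l _ hl; simp [proj_of_mem hi hx, hl]
  · intro h; simp at h; omega

/-- The differential on homogeneous arguments. -/
theorem d₁_homog (d : ℤ) (b : S × V →ₗ[ℝ] W) {i j : ℤ}
    (hi : i = -1 ∨ i = -2) (hj : j = -1 ∨ j = -2) {x y : S × V}
    (hx : x ∈ mGrade S V i) (hy : y ∈ mGrade S V j) :
    d₁ br act d b x y = eps (i * d) • act x (b y) - eps (j * (d + i)) • act y (b x)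
      - b (br x y) := by
  simp only [d₁, d₁Hom, LinearMap.coe_mk, AddHom.coe_mk, LinearMap.coe_sum, Finset.sum_apply,
    LinearMap.mk₂_apply]
  rw [Finset.sum_eq_single i, Finset.sum_eq_single j]
  · simp [proj_of_mem hi hx, proj_of_mem hj hy]
  · intro l _ hl; simp [proj_of_mem hj hy, hl]
  · intro h; simp at h; omega
  · intro l _ hl; simp [proj_of_mem hi hx, hl]
  · intro h; simp at h; omega

theorem d₁_apply {κ : S →ₗ[ℝ] S →ₗ[ℝ] V} (hbr : ∀ x y, br x y = (0, κ x.1 y.1))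
    (d : ℤ) (b : S × V →ₗ[ℝ] W) (s t : S) (v x : V) :
    d₁ br act d b (s, v) (t, x) =
      eps d • act (s, 0) (b (t, 0)) + eps d • act (t, 0) (b (s, 0)) - b (0, κ s t)
      + (eps d • act (s, 0) (b (0, x)) - act (0, x) (b (s, 0)))
      + (act (0, v) (b (t, 0)) - eps d • act (t, 0) (b (0, v)))
      + (act (0, v) (b (0, x)) - act (0, x) (b (0, v))) := by
  have h0 : b (0, 0) = 0 := map_zero b
  simp only [d₁, d₁Hom, proj, hbr, LinearMap.coe_mk, AddHom.coe_mk,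
    Finset.sum_pair (show (-1 : ℤ) ≠ -2 by decide), LinearMap.add_apply, LinearMap.mk₂_apply]
  norm_num [eps_add, eps_neg, eps_two_mul, eps_one, eps_two, eps_four, mul_add, h0]
  abel

set_option maxHeartbeats 1000000 in
set_option linter.unusedSimpArgs false in
/-- `∂ ∘ ∂ = 0` on `1`-cochains, when `act` is an action of the Lie superalgebra `m`. -/
theorem d₂_d₁ {κ : S →ₗ[ℝ] S →ₗ[ℝ] V} (hbr : ∀ x y, br x y = (0, κ x.1 y.1))
    (hSS : ∀ s t p, act (0, κ s t) p = act (s, 0) (act (t, 0) p) + act (t, 0) (act (s, 0) p))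
    (hSV : ∀ s v p, act (s, 0) (act (0, v) p) = 0) (hVS : ∀ s v p, act (0, v) (act (s, 0) p) = 0)
    (hVV : ∀ v x p, act (0, v) (act (0, x) p) = 0) (d : ℤ) (b : S × V →ₗ[ℝ] W) :
    d₂ br act d (d₁ br act d b) = 0 := by
  have h0 : b (0, 0) = 0 := map_zero b
  have hS : (-1 : ℤ) = -1 ∨ (-1 : ℤ) = -2 := Or.inl rfl
  have hV : (-2 : ℤ) = -1 ∨ (-2 : ℤ) = -2 := Or.inr rfl
  have hA : act ((0, 0) : S × V) = 0 := map_zero act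
  have hn : ∀ n : ℤ, eps (-1 * n) = eps n := fun n => by rw [neg_one_mul, eps_neg]
  have hn2 : ∀ n : ℤ, eps (-2 * n) = 1 := fun n => by rw [neg_mul, eps_neg, eps_two_mul]
  have e1 : eps (-1) = -1 := by rw [eps_neg, eps_one]
  have e2 : eps (-2) = 1 := by rw [eps_neg, eps_two]
  have hd2 : eps d * eps d = 1 := by rcases eps_cases d with hd | hd <;> rw [hd] <;> norm_num
  refine ext_m (fun s => ext_m (fun t => ext_m (fun r => ?_) (fun z => ?_))
      (fun y => ext_m (fun r => ?_) (fun z => ?_)))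
    (fun x => ext_m (fun t => ext_m (fun r => ?_) (fun z => ?_))
      (fun y => ext_m (fun r => ?_) (fun z => ?_)))
  · rw [d₂_homog _ _ _ _ hS hS hS (mGrade_left s) (mGrade_left t) (mGrade_left r)]
    simp only [hbr, d₁_apply br act hbr, hn, hn2, eps_add, e1, e2, h0, hA, map_zero,
      LinearMap.zero_apply, smul_zero, add_zero, zero_add, sub_zero, zero_sub]
    rcases eps_cases d with hd | hd <;> rw [hd] <;>
      simp only [hSS, map_add, map_sub, map_smul, hSV, hVS, hVV] <;> module
  · rw [d₂_homog _ _ _ _ hS hS hV (mGrade_left s) (mGrade_left t) (mGrade_right z)]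
    simp only [hbr, d₁_apply br act hbr, hn, hn2, eps_add, e1, e2, h0, hA, map_zero,
      LinearMap.zero_apply, smul_zero, add_zero, zero_add, sub_zero, zero_sub]
    rcases eps_cases d with hd | hd <;> rw [hd] <;>
      simp only [hSS, map_add, map_sub, map_smul, hSV, hVS, hVV] <;> module
  · rw [d₂_homog _ _ _ _ hS hV hS (mGrade_left s) (mGrade_right y) (mGrade_left r)]
    simp only [hbr, d₁_apply br act hbr, hn, hn2, eps_add, e1, e2, h0, hA, map_zero,
      LinearMap.zero_apply, smul_zero, add_zero, zero_add, sub_zero, zero_sub]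
    rcases eps_cases d with hd | hd <;> rw [hd] <;>
      simp only [hSS, map_add, map_sub, map_smul, hSV, hVS, hVV] <;> module
  · rw [d₂_homog _ _ _ _ hS hV hV (mGrade_left s) (mGrade_right y) (mGrade_right z)]
    simp only [hbr, d₁_apply br act hbr, hn, hn2, eps_add, e1, e2, h0, hA, map_zero,
      LinearMap.zero_apply, smul_zero, add_zero, zero_add, sub_zero, zero_sub]
    rcases eps_cases d with hd | hd <;> rw [hd] <;>
      simp only [hSS, map_add, map_sub, map_smul, hSV, hVS, hVV] <;> module
  · rw [d₂_homog _ _ _ _ hV hS hS (mGrade_right x) (mGrade_left t) (mGrade_left r)]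
    simp only [hbr, d₁_apply br act hbr, hn, hn2, eps_add, e1, e2, h0, hA, map_zero,
      LinearMap.zero_apply, smul_zero, add_zero, zero_add, sub_zero, zero_sub]
    rcases eps_cases d with hd | hd <;> rw [hd] <;>
      simp only [hSS, map_add, map_sub, map_smul, hSV, hVS, hVV] <;> module
  · rw [d₂_homog _ _ _ _ hV hS hV (mGrade_right x) (mGrade_left t) (mGrade_right z)]
    simp only [hbr, d₁_apply br act hbr, hn, hn2, eps_add, e1, e2, h0, hA, map_zero,
      LinearMap.zero_apply, smul_zero, add_zero, zero_add, sub_zero, zero_sub]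
    rcases eps_cases d with hd | hd <;> rw [hd] <;>
      simp only [hSS, map_add, map_sub, map_smul, hSV, hVS, hVV] <;> module
  · rw [d₂_homog _ _ _ _ hV hV hS (mGrade_right x) (mGrade_right y) (mGrade_left r)]
    simp only [hbr, d₁_apply br act hbr, hn, hn2, eps_add, e1, e2, h0, hA, map_zero,
      LinearMap.zero_apply, smul_zero, add_zero, zero_add, sub_zero, zero_sub]
    rcases eps_cases d with hd | hd <;> rw [hd] <;>
      simp only [hSS, map_add, map_sub, map_smul, hSV, hVS, hVV] <;> module
  · rw [d₂_homog _ _ _ _ hV hV hV (mGrade_right x) (mGrade_right y) (mGrade_right z)]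
    simp only [hbr, d₁_apply br act hbr, hn, hn2, eps_add, e1, e2, h0, hA, map_zero,
      LinearMap.zero_apply, smul_zero, add_zero, zero_add, sub_zero, zero_sub]
    simp only [map_sub, hVV, sub_zero, smul_zero, add_zero]

/-- The infinitesimal action `f ∘ b - b ∘ g` on `1`-cochains. -/
def twist₁ (f : W →ₗ[ℝ] W) (g : S × V →ₗ[ℝ] S × V) (b : S × V →ₗ[ℝ] W) : S × V →ₗ[ℝ] W :=
  f ∘ₗ b - b ∘ₗ g

/-- The infinitesimal action `f (c(x,y)) - c(g x, y) - c(x, g y)` on `2`-cochains. -/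
def twist₂ (f : W →ₗ[ℝ] W) (g : S × V →ₗ[ℝ] S × V) :
    Module.End ℝ (S × V →ₗ[ℝ] S × V →ₗ[ℝ] W) where
  toFun c := c.compr₂ f - c.compl₁₂ g LinearMap.id - c.compl₁₂ LinearMap.id g
  map_add' c c' := by
    refine LinearMap.ext₂ fun x y => ?_
    simp only [LinearMap.sub_apply, LinearMap.compr₂_apply, LinearMap.compl₁₂_apply,
      LinearMap.add_apply, map_add]
    abel
  map_smul' r c := by
    refine LinearMap.ext₂ fun x y => ?_
    simp only [LinearMap.sub_apply, LinearMap.compr₂_apply, LinearMap.compl₁₂_apply,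
      LinearMap.smul_apply, map_smul, RingHom.id_apply]
    module

theorem twist₂_apply (f : W →ₗ[ℝ] W) (g : S × V →ₗ[ℝ] S × V)
    (c : S × V →ₗ[ℝ] S × V →ₗ[ℝ] W) (x y : S × V) :
    twist₂ f g c x y = f (c x y) - c (g x) y - c x (g y) := rfl

theorem d₂_twist₂ (f : W →ₗ[ℝ] W) (g : S × V →ₗ[ℝ] S × V)
    (hg : ∀ i x, x ∈ mGrade S V i → g x ∈ mGrade S V i)
    (ha : ∀ x p, f (act x p) = act (g x) p + act x (f p))
    (hb : ∀ x y, g (br x y) = br (g x) y + br x (g y))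
    (d : ℤ) {c : S × V →ₗ[ℝ] S × V →ₗ[ℝ] W} (hc : d₂ br act d c = 0) :
    d₂ br act d (twist₂ f g c) = 0 := by
  have key : ∀ i j k : ℤ, (i = -1 ∨ i = -2) → (j = -1 ∨ j = -2) → (k = -1 ∨ k = -2) →
      ∀ x ∈ mGrade S V i, ∀ y ∈ mGrade S V j, ∀ z ∈ mGrade S V k,
      d₂ br act d (twist₂ f g c) x y z = 0 := by
    intro i j k hi hj hk x hx y hy z hz
    have h0 := congrArg (f) (d₂_homog br act d c hi hj hk hx hy hz)
    have h1 := d₂_homog br act d c hi hj hk (hg _ _ hx) hy hz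
    have h2 := d₂_homog br act d c hi hj hk hx (hg _ _ hy) hz
    have h3 := d₂_homog br act d c hi hj hk hx hy (hg _ _ hz)
    rw [hc] at h0 h1 h2 h3
    simp only [LinearMap.zero_apply, map_zero, map_add, map_sub, map_smul, ha] at h0 h1 h2 h3
    rw [d₂_homog _ _ _ _ hi hj hk hx hy hz]
    simp only [twist₂_apply, hb, map_add, map_sub, LinearMap.add_apply]
    have h4 := congrArg₂ (· - ·) (congrArg₂ (· - ·) (congrArg₂ (· - ·) h0 h1) h2) h3
    simp only [sub_zero] at h4
    refine Eq.trans ?_ h4.symm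
    module
  have a := @mGrade_left V _ _ S _ _
  have a' := @mGrade_right V _ _ S _ _
  have hS : (-1 : ℤ) = -1 ∨ (-1 : ℤ) = -2 := Or.inl rfl
  have hV : (-2 : ℤ) = -1 ∨ (-2 : ℤ) = -2 := Or.inr rfl
  exact ext_m
    (fun s => ext_m
      (fun t => ext_m (fun r => key _ _ _ hS hS hS _ (a s) _ (a t) _ (a r))
        (fun z => key _ _ _ hS hS hV _ (a s) _ (a t) _ (a' z)))
      (fun y => ext_m (fun r => key _ _ _ hS hV hS _ (a s) _ (a' y) _ (a r))
        (fun z => key _ _ _ hS hV hV _ (a s) _ (a' y) _ (a' z))))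
    (fun x => ext_m
      (fun t => ext_m (fun r => key _ _ _ hV hS hS _ (a' x) _ (a t) _ (a r))
        (fun z => key _ _ _ hV hS hV _ (a' x) _ (a t) _ (a' z)))
      (fun y => ext_m (fun r => key _ _ _ hV hV hS _ (a' x) _ (a' y) _ (a r))
        (fun z => key _ _ _ hV hV hV _ (a' x) _ (a' y) _ (a' z))))

theorem d₁_twist₁ (f : W →ₗ[ℝ] W) (g : S × V →ₗ[ℝ] S × V)
    (hg : ∀ i x, x ∈ mGrade S V i → g x ∈ mGrade S V i)
    (ha : ∀ x p, f (act x p) = act (g x) p + act x (f p))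
    (hb : ∀ x y, g (br x y) = br (g x) y + br x (g y))
    (d : ℤ) (b : S × V →ₗ[ℝ] W) :
    d₁ br act d (twist₁ f g b) = twist₂ f g (d₁ br act d b) := by
  have key : ∀ i j : ℤ, (i = -1 ∨ i = -2) → (j = -1 ∨ j = -2) →
      ∀ x ∈ mGrade S V i, ∀ y ∈ mGrade S V j,
      d₁ br act d (twist₁ f g b) x y =
        twist₂ f g (d₁ br act d b) x y := by
    intro i j hi hj x hx y hy
    rw [twist₂_apply, d₁_homog _ _ _ _ hi hj hx hy, d₁_homog _ _ _ _ hi hj hx hy,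
      d₁_homog _ _ _ _ hi hj (hg _ _ hx) hy, d₁_homog _ _ _ _ hi hj hx (hg _ _ hy)]
    simp only [twist₁, LinearMap.sub_apply, LinearMap.comp_apply, map_sub, map_smul, ha,
      hb, map_add]
    module
  have hS : (-1 : ℤ) = -1 ∨ (-1 : ℤ) = -2 := Or.inl rfl
  have hV : (-2 : ℤ) = -1 ∨ (-2 : ℤ) = -2 := Or.inr rfl
  exact ext_m
    (fun s => ext_m (fun t => key _ _ hS hS _ (mGrade_left s) _ (mGrade_left t))
      (fun y => key _ _ hS hV _ (mGrade_left s) _ (mGrade_right y)))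
    (fun x => ext_m (fun t => key _ _ hV hS _ (mGrade_right x) _ (mGrade_left t))
      (fun y => key _ _ hV hV _ (mGrade_right x) _ (mGrade_right y)))

end Complex

section Cohomology

variable {V : Type u} [AddCommGroup V] [Module ℝ V] {η : LorentzForm V}
variable {S : Type w} [AddCommGroup S] [Module ℝ S] [Module (Cl η) S] [IsScalarTower ℝ (Cl η) S]
variable (ω : SpinSymplectic η S)

/-- The `2`-cocycles `Z^{d,2}(m,p)`. -/
def Z₂ (d : ℤ) : Submodule ℝ (S × V →ₗ[ℝ] S × V →ₗ[ℝ] Poincare η S) :=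
  C₂ (grade η S) d ⊓ LinearMap.ker (d₂ (mBracket ω) (adj ω) d)

/-- The `2`-coboundaries `B^{d,2}(m,p)`. -/
def B₂ (d : ℤ) : Submodule ℝ (S × V →ₗ[ℝ] S × V →ₗ[ℝ] Poincare η S) :=
  (C₁ (grade η S) d).map (d₁ (mBracket ω) (adj ω) d)

theorem adj_SV (s : S) (v : V) (p : Poincare η S) : adj ω (s, 0) (adj ω (0, v) p) = 0 := by
  simp [adj_apply]

theorem adj_VS (s : S) (v : V) (p : Poincare η S) : adj ω (0, v) (adj ω (s, 0) p) = 0 := by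
  simp [adj_apply]

theorem adj_VV (v x : V) (p : Poincare η S) : adj ω (0, v) (adj ω (0, x) p) = 0 := by
  simp [adj_apply]

theorem adj_SS (s t : S) (p : Poincare η S) :
    adj ω (0, dirac ω s t) p = adj ω (s, 0) (adj ω (t, 0) p) + adj ω (t, 0) (adj ω (s, 0) p) := by
  simp only [adj_apply, dirac_equivariant, map_zero, neg_zero, LinearMap.zero_apply,
    Prod.mk_add_mk, add_zero, zero_add, map_neg]
  rw [dirac_symm ω (spin η S p.1 s) t, neg_add, add_comm]

theorem adj_grade {i k : ℤ} {x : S × V} (hx : x ∈ mGrade S V i) {p : Poincare η S}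
    (hp : p ∈ grade η S k) : adj ω x p ∈ grade η S (i + k) := by
  obtain ⟨h1, h2⟩ := hx
  obtain ⟨g1, g2, g3⟩ := hp
  rw [adj_apply]
  refine ⟨fun _ => rfl, fun h => ?_, fun h => ?_⟩
  · by_cases hk : k = 0
    · simp [h1 (by omega)]
    · simp [g1 hk]
  · by_cases hk : k = 0
    · simp [h2 (by omega), g2 (by omega)]
    · by_cases hi : i = -1
      · simp [g1 hk, g2 (by omega)]
      · simp [g1 hk, h1 hi]

theorem mBracket_grade {i j : ℤ} {x y : S × V} (hx : x ∈ mGrade S V i) (hy : y ∈ mGrade S V j) :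
    mBracket ω x y ∈ mGrade S V (i + j) := by
  refine ⟨fun _ => rfl, fun h => ?_⟩
  by_cases hi : i = -1
  · simp [mBracket_apply, hy.1 (by omega)]
  · simp [mBracket_apply, hx.1 hi]

theorem mBracket_skew {i j : ℤ} {x y : S × V} (hx : x ∈ mGrade S V i) (hy : y ∈ mGrade S V j) :
    mBracket ω y x = -eps (i * j) • mBracket ω x y := by
  by_cases h : i = -1 ∧ j = -1
  · obtain ⟨rfl, rfl⟩ := h
    simp [mBracket_apply, dirac_symm ω y.1, eps_one]
  · rcases not_and_or.1 h with h | h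
    · simp [mBracket_apply, hx.1 h]
    · simp [mBracket_apply, hy.1 h]

theorem mGrade_zero_or {i : ℤ} {x : S × V} (hx : x ∈ mGrade S V i) :
    (i = -1 ∨ i = -2) ∨ x = 0 := by
  rcases mGrade_cases hx with h | h | h
  · exact Or.inl (Or.inl h.1)
  · exact Or.inl (Or.inr h.1)
  · exact Or.inr h

theorem eps_mul_self (n : ℤ) : eps n * eps n = 1 := by
  rcases eps_cases n with h | h <;> rw [h] <;> norm_num

/-- `∂` maps `C^{d,1}` into `C^{d,2}`. -/
theorem d₁_mem {d : ℤ} {b : S × V →ₗ[ℝ] Poincare η S} (hb : b ∈ C₁ (grade η S) d) :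
    d₁ (mBracket ω) (adj ω) d b ∈ C₂ (grade η S) d := by
  intro i j x hx y hy
  rcases mGrade_zero_or hx with hi | rfl
  swap
  · simp
  rcases mGrade_zero_or hy with hj | rfl
  swap
  · simp
  rw [d₁_homog _ _ _ _ hj hi hy hx, d₁_homog _ _ _ _ hi hj hx hy]
  constructor
  · rw [mBracket_skew ω hx hy, map_smul]
    have e : eps (j * (d + i)) = eps (j * d) * eps (i * j) := by
      rw [mul_add, eps_add, mul_comm j i]
    have e' : eps (i * (d + j)) = eps (i * d) * eps (i * j) := by
      rw [mul_add, eps_add]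
    rw [e, e']
    simp only [smul_sub, smul_smul]
    have e2 : -eps (i * j) * (eps (j * d) * eps (i * j)) = -eps (j * d) := by
      linear_combination (-eps (j * d)) * eps_mul_self (i * j)
    rw [e2]
    module
  · refine sub_mem (sub_mem (Submodule.smul_mem _ _ ?_) (Submodule.smul_mem _ _ ?_)) ?_
    · have := adj_grade ω hx (hb j y hy)
      rwa [← add_assoc] at this
    · have := adj_grade ω hy (hb i x hx)
      rwa [← add_assoc, add_comm j i] at this
    · exact hb _ _ (mBracket_grade ω hx hy)

/-- Coboundaries are cocycles. -/
theorem B₂_le_Z₂ (d : ℤ) : B₂ ω d ≤ Z₂ ω d := by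
  rintro _ ⟨b, hb, rfl⟩
  exact ⟨d₁_mem ω hb, d₂_d₁ _ _ (mBracket_apply ω) (adj_SS ω) (adj_SV ω) (adj_VS ω) (adj_VV ω) d b⟩

/-- The Spencer cohomology group `H^{d,2}(m,p) = Z^{d,2}(m,p) / B^{d,2}(m,p)`. -/
abbrev H₂ (d : ℤ) : Type (max u w) := Z₂ ω d ⧸ (B₂ ω d).submoduleOf (Z₂ ω d)

/-- The class in `H^{d,2}(m,p)` of a cocycle. -/
def cls (d : ℤ) : Z₂ ω d →ₗ[ℝ] H₂ ω d := Submodule.mkQ _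

variable (η S) in
/-- The action of `so(V)` on `m = S ⊕ V`. -/
def soM (A : So η) : S × V →ₗ[ℝ] S × V :=
  LinearMap.prodMap (spin η S A) (vec η A)

/-- The adjoint action of `p_0 = so(V)` on `p`. -/
def soP (A : So η) : Poincare η S →ₗ[ℝ] Poincare η S := bracket ω (A, 0, 0)

theorem soM_apply (A : So η) (x : S × V) :
    soM η S A x = (spin η S A x.1, vec η A x.2) := rfl

theorem soP_apply (A : So η) (p : Poincare η S) :
    soP ω A p = (⁅A, p.1⁆, spin η S A p.2.1, vec η A p.2.2) := by
  simp [soP, bracket_apply]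

theorem incl_soM (A : So η) (x : S × V) : incl η S (soM η S A x) = soP ω A (incl η S x) := by
  simp [incl, soM_apply, soP_apply]

theorem spin_lie_apply (A B : So η) (s : S) : spin η S ⁅A, B⁆ s =
    spin η S A (spin η S B s) - spin η S B (spin η S A s) := by
  rw [LieHom.map_lie, LieRing.of_associative_ring_bracket]; rfl

theorem soP_adj (A : So η) (x : S × V) (p : Poincare η S) :
    soP ω A (adj ω x p) = adj ω (soM η S A x) p + adj ω x (soP ω A p) := by
  simp only [adj_apply, soP_apply, soM_apply, lie_zero, map_neg, map_add, dirac_equivariant,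
    spin_lie_apply, vec_lie]
  refine Prod.ext (by simp) (Prod.ext ?_ ?_) <;> dsimp only [Prod.snd_add, Prod.fst_add] <;> abel

theorem soM_mBracket (A : So η) (x y : S × V) : soM η S A (mBracket ω x y) =
    mBracket ω (soM η S A x) y + mBracket ω x (soM η S A y) := by
  simp [mBracket_apply, soM_apply, dirac_equivariant]

theorem soM_lie (A B : So η) (x : S × V) : soM η S ⁅A, B⁆ x =
    soM η S A (soM η S B x) - soM η S B (soM η S A x) := by
  simp only [soM_apply, spin_lie_apply, vec_lie]; rfl

theorem soP_lie (A B : So η) (p : Poincare η S) : soP ω ⁅A, B⁆ p =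
    soP ω A (soP ω B p) - soP ω B (soP ω A p) := by
  simp only [soP_apply, spin_lie_apply, vec_lie, lie_lie]; rfl

theorem soM_grade (A : So η) {i : ℤ} {x : S × V} (hx : x ∈ mGrade S V i) :
    soM η S A x ∈ mGrade S V i :=
  ⟨fun h => by simp [soM_apply, hx.1 h], fun h => by simp [soM_apply, hx.2 h]⟩

theorem soP_grade (A : So η) {i : ℤ} {p : Poincare η S} (hp : p ∈ grade η S i) :
    soP ω A p ∈ grade η S i := by
  rw [soP_apply]
  exact ⟨fun h => by simp [hp.1 h], fun h => by simp [hp.2.1 h], fun h => by simp [hp.2.2 h]⟩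

/-- The action of `so(V)` on `1`-cochains. -/
def soC₁ (A : So η) (b : S × V →ₗ[ℝ] Poincare η S) : S × V →ₗ[ℝ] Poincare η S :=
  twist₁ (soP ω A) (soM η S A) b

/-- The action of `so(V)` on `2`-cochains: `(A · c)(x,y) = A · c(x,y) - c(A x, y) - c(x, A y)`. -/
def soC₂ (A : So η) : Module.End ℝ (S × V →ₗ[ℝ] S × V →ₗ[ℝ] Poincare η S) :=
  twist₂ (soP ω A) (soM η S A)

theorem soC₂_apply (A : So η) (c : S × V →ₗ[ℝ] S × V →ₗ[ℝ] Poincare η S) (x y : S × V) :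
    soC₂ ω A c x y = soP ω A (c x y) - c (soM η S A x) y - c x (soM η S A y) := rfl

theorem soC₂_mem (A : So η) {d : ℤ} {c : S × V →ₗ[ℝ] S × V →ₗ[ℝ] Poincare η S}
    (hc : c ∈ C₂ (grade η S) d) : soC₂ ω A c ∈ C₂ (grade η S) d := by
  intro i j x hx y hy
  have h1 := hc i j x hx y hy
  have h2 := hc i j _ (soM_grade A hx) y hy
  have h3 := hc i j x hx _ (soM_grade A hy)
  rw [soC₂_apply, soC₂_apply]
  refine ⟨?_, sub_mem (sub_mem (soP_grade ω A h1.2) h2.2) h3.2⟩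
  rw [h1.1, h2.1, h3.1, map_smul]
  module

theorem soC₂_Z₂ (A : So η) (d : ℤ) : ∀ c ∈ Z₂ ω d, soC₂ ω A c ∈ Z₂ ω d :=
  fun _ hc => ⟨soC₂_mem ω A hc.1, d₂_twist₂ _ _ _ _ (fun _ _ h => soM_grade A h) (soP_adj ω A)
    (soM_mBracket ω A) d hc.2⟩

theorem soC₁_mem (A : So η) {d : ℤ} {b : S × V →ₗ[ℝ] Poincare η S}
    (hb : b ∈ C₁ (grade η S) d) : soC₁ ω A b ∈ C₁ (grade η S) d :=
  fun i x hx => sub_mem (soP_grade ω A (hb i x hx)) (hb i _ (soM_grade A hx))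

theorem soC₂_B₂ (A : So η) (d : ℤ) : ∀ c ∈ B₂ ω d, soC₂ ω A c ∈ B₂ ω d := by
  rintro _ ⟨b, hb, rfl⟩
  exact ⟨soC₁ ω A b, soC₁_mem ω A hb, d₁_twist₁ _ _ _ _ (fun _ _ h => soM_grade A h)
    (soP_adj ω A) (soM_mBracket ω A) d b⟩

theorem soC₂_lie (A B : So η) (c : S × V →ₗ[ℝ] S × V →ₗ[ℝ] Poincare η S) :
    soC₂ ω ⁅A, B⁆ c = soC₂ ω A (soC₂ ω B c) - soC₂ ω B (soC₂ ω A c) := by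
  refine LinearMap.ext₂ fun x y => ?_
  simp only [LinearMap.sub_apply, soC₂_apply, soM_lie, soP_lie, map_sub]
  abel

/-- The action of an element of `so(V)` on `H^{d,2}(m,p)`. -/
def soHLin (d : ℤ) (A : So η) : Module.End ℝ (H₂ ω d) :=
  Submodule.mapQ _ _ ((soC₂ ω A).restrict (soC₂_Z₂ ω A d)) fun _ hc => soC₂_B₂ ω A d _ hc

theorem soHLin_cls (d : ℤ) (A : So η) (z : Z₂ ω d) :
    soHLin ω d A (cls ω d z) = cls ω d ⟨soC₂ ω A z, soC₂_Z₂ ω A d z z.2⟩ := rfl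

theorem cls_surjective (d : ℤ) (h : H₂ ω d) : ∃ z, cls ω d z = h := Submodule.mkQ_surjective _ h

theorem soHLin_add (d : ℤ) (A B : So η) : soHLin ω d (A + B) = soHLin ω d A + soHLin ω d B := by
  refine LinearMap.ext fun h => ?_
  obtain ⟨z, rfl⟩ := cls_surjective ω d h
  have h1 : ∀ x, soM η S (A + B) x = soM η S A x + soM η S B x := fun x => by simp [soM_apply]
  have h2 : ∀ x, soP ω (A + B) x = soP ω A x + soP ω B x := fun x => by simp [soP_apply]
  rw [LinearMap.add_apply, soHLin_cls, soHLin_cls, soHLin_cls, ← map_add]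
  refine congrArg _ (Subtype.ext (LinearMap.ext₂ fun x y => ?_))
  simp only [Submodule.coe_add, LinearMap.add_apply, soC₂_apply, h1, h2, map_add]
  abel

theorem soHLin_smul (d : ℤ) (r : ℝ) (A : So η) : soHLin ω d (r • A) = r • soHLin ω d A := by
  refine LinearMap.ext fun h => ?_
  obtain ⟨z, rfl⟩ := cls_surjective ω d h
  have h1 : ∀ x, soM η S (r • A) x = r • soM η S A x := fun x => by simp [soM_apply]
  have h2 : ∀ x, soP ω (r • A) x = r • soP ω A x := fun x => by simp [soP_apply]
  rw [LinearMap.smul_apply, soHLin_cls, soHLin_cls, ← map_smul]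
  refine congrArg _ (Subtype.ext (LinearMap.ext₂ fun x y => ?_))
  simp only [Submodule.coe_smul, LinearMap.smul_apply, soC₂_apply, h1, h2, map_smul]
  module

theorem soHLin_lie (d : ℤ) (A B : So η) :
    soHLin ω d ⁅A, B⁆ = soHLin ω d A * soHLin ω d B - soHLin ω d B * soHLin ω d A := by
  refine LinearMap.ext fun h => ?_
  obtain ⟨z, rfl⟩ := cls_surjective ω d h
  rw [LinearMap.sub_apply, Module.End.mul_apply, Module.End.mul_apply]
  simp only [soHLin_cls]
  rw [← map_sub]
  exact congrArg _ (Subtype.ext (soC₂_lie ω A B z.1))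

/-- The representation of `so(V)` on `H^{d,2}(m,p)` induced from its action on cochains. -/
def soH (d : ℤ) : So η →ₗ⁅ℝ⁆ Module.End ℝ (H₂ ω d) where
  toFun := soHLin ω d
  map_add' := soHLin_add ω d
  map_smul' := soHLin_smul ω d
  map_lie' {A B} := (soHLin_lie ω d A B).trans (LieRing.of_associative_ring_bracket _ _).symm

end Cohomology

section Exterior

variable {V : Type u} [AddCommGroup V] [Module ℝ V]

/-- The alternating map `(v₁, …, vₙ) ↦ ∑ᵢ v₁ ∧ ⋯ ∧ A vᵢ ∧ ⋯ ∧ vₙ`. -/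
def extAlt (n : ℕ) (A : Module.End ℝ V) : V [⋀^Fin n]→ₗ[ℝ] ⋀[ℝ]^n V where
  toMultilinearMap := ∑ i, (exteriorPower.ιMulti ℝ n (M := V)).toMultilinearMap.compLinearMap
    (fun j => if j = i then A else LinearMap.id)
  map_eq_zero_of_eq' := by
    intro v a b hab hne
    change (∑ i, _ : MultilinearMap ℝ (fun _ : Fin n => V) (⋀[ℝ]^n V)) v = 0
    rw [sum_apply, Finset.sum_eq_add_of_mem a b (Finset.mem_univ _)
      (Finset.mem_univ _) hne]
    · simp only [MultilinearMap.compLinearMap_apply, AlternatingMap.coe_multilinearMap]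
      refine Eq.trans ?_ (AlternatingMap.map_swap_add (exteriorPower.ιMulti ℝ n)
        (fun j => (if j = b then A else LinearMap.id) (v j)) hne)
      refine congrArg (fun x => exteriorPower.ιMulti ℝ n x + _) (funext fun j => ?_)
      by_cases ha : j = a
      · subst ha; simp [hab, hne, Ne.symm hne]
      · by_cases hb : j = b
        · subst hb; simp [hab, hne, Ne.symm hne]
        · simp [ha, hb, Equiv.swap_apply_of_ne_of_ne]
    · intro i _ hi
      simp only [MultilinearMap.compLinearMap_apply, AlternatingMap.coe_multilinearMap]
      exact AlternatingMap.map_eq_zero_of_eq _ _ (by simp [hi.1.symm, hi.2.symm, hab]) hne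

/-- The natural action on `Λⁿ V` of an endomorphism of `V`, as a derivation. -/
def extDer (n : ℕ) (A : Module.End ℝ V) : Module.End ℝ (⋀[ℝ]^n V) :=
  exteriorPower.alternatingMapLinearEquiv (extAlt n A)

theorem extDer_ιMulti (n : ℕ) (A : Module.End ℝ V) (v : Fin n → V) :
    extDer n A (exteriorPower.ιMulti ℝ n v) =
      ∑ i, exteriorPower.ιMulti ℝ n (Function.update v i (A (v i))) := by
  rw [extDer, exteriorPower.alternatingMapLinearEquiv_apply_ιMulti]
  change (∑ i, _ : MultilinearMap ℝ (fun _ : Fin n => V) (⋀[ℝ]^n V)) v = _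
  rw [sum_apply]
  refine Finset.sum_congr rfl fun i _ => ?_
  simp only [MultilinearMap.compLinearMap_apply, AlternatingMap.coe_multilinearMap]
  congr 1
  funext j
  by_cases h : j = i
  · subst h; simp
  · simp [h]

theorem extDer_lie (n : ℕ) (A B : Module.End ℝ V) :
    extDer n (A * B - B * A) = extDer n A * extDer n B - extDer n B * extDer n A := by
  refine exteriorPower.linearMap_ext (AlternatingMap.ext fun v => ?_)
  change extDer n _ (exteriorPower.ιMulti ℝ n v) =
    extDer n A (extDer n B (exteriorPower.ιMulti ℝ n v)) -
      extDer n B (extDer n A (exteriorPower.ιMulti ℝ n v))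
  simp only [extDer_ιMulti, map_sum]
  rw [Finset.sum_comm (f := fun i j => exteriorPower.ιMulti ℝ n (Function.update
    (Function.update v i (A (v i))) j (B (Function.update v i (A (v i)) j)))),
    ← Finset.sum_sub_distrib]
  refine Finset.sum_congr rfl fun i _ => ?_
  rw [← Finset.sum_sub_distrib, Finset.sum_eq_single i]
  · simp only [Function.update_self, Function.update_idem, LinearMap.sub_apply,
      Module.End.mul_apply, AlternatingMap.map_update_sub]
  · intro j _ hj
    rw [Function.update_of_ne hj, Function.update_of_ne hj.symm, Function.update_comm hj, sub_self]
  · intro h; exact absurd (Finset.mem_univ i) h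

/-- The natural representation of `so(V)` on `Λⁿ V`. -/
def extRep (η : LorentzForm V) (n : ℕ) : So η →ₗ⁅ℝ⁆ Module.End ℝ (⋀[ℝ]^n V) where
  toFun A := extDer n (vec η A)
  map_add' A B := by
    refine exteriorPower.linearMap_ext (AlternatingMap.ext fun v => ?_)
    change extDer n _ (exteriorPower.ιMulti ℝ n v) =
      extDer n _ (exteriorPower.ιMulti ℝ n v) + extDer n _ (exteriorPower.ιMulti ℝ n v)
    simp only [extDer_ιMulti, map_add, LinearMap.add_apply, AlternatingMap.map_update_add,
      Finset.sum_add_distrib]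
  map_smul' r A := by
    refine exteriorPower.linearMap_ext (AlternatingMap.ext fun v => ?_)
    change extDer n _ (exteriorPower.ιMulti ℝ n v) = r • extDer n _ (exteriorPower.ιMulti ℝ n v)
    simp only [extDer_ιMulti, map_smul, LinearMap.smul_apply, AlternatingMap.map_update_smul,
      Finset.smul_sum]
  map_lie' {A B} := by
    rw [LieHom.map_lie, LieRing.of_associative_ring_bracket,
      LieRing.of_associative_ring_bracket, extDer_lie]

end Exterior

section Representations

/-- A representation of a Lie algebra is irreducible if it is nonzero and has no invariant
subspaces besides `0` and the whole space. -/
def IsIrreducibleRep {L : Type*} [LieRing L] [LieAlgebra ℝ L] {M : Type*} [AddCommGroup M]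
    [Module ℝ M] (ρ : L →ₗ⁅ℝ⁆ Module.End ℝ M) : Prop :=
  Nontrivial M ∧ ∀ U : Submodule ℝ M, (∀ A, ∀ m ∈ U, ρ A m ∈ U) → U = ⊥ ∨ U = ⊤

/-- A linear isomorphism `e : M ≃ N` is an isomorphism of representations if it intertwines the
actions. -/
def Intertwines {L : Type*} [LieRing L] [LieAlgebra ℝ L] {M N : Type*} [AddCommGroup M]
    [Module ℝ M] [AddCommGroup N] [Module ℝ N] (ρ : L →ₗ⁅ℝ⁆ Module.End ℝ M)
    (τ : L →ₗ⁅ℝ⁆ Module.End ℝ N) (e : M ≃ₗ[ℝ] N) : Prop :=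
  ∀ A m, e (ρ A m) = τ A (e m)

end Representations

section GradingElement

variable {V : Type u} [AddCommGroup V] [Module ℝ V] {η : LorentzForm V}
variable {S : Type w} [AddCommGroup S] [Module ℝ S] [Module (Cl η) S] [IsScalarTower ℝ (Cl η) S]

/-- The dual `ρ^*` of a representation `ρ`: `(A · φ)(m) = -φ(A · m)`. -/
def dualRep {L : Type*} [LieRing L] [LieAlgebra ℝ L] {M : Type*} [AddCommGroup M]
    [Module ℝ M] (ρ : L →ₗ⁅ℝ⁆ Module.End ℝ M) : L →ₗ⁅ℝ⁆ Module.End ℝ (Module.Dual ℝ M) where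
  toFun A := -Module.Dual.transpose (R := ℝ) (ρ A)
  map_add' A B := by
    ext φ m; simp [add_comm]
  map_smul' r A := by
    ext φ m; simp
  map_lie' {A B} := by
    ext φ m
    rw [LieHom.map_lie, LieRing.of_associative_ring_bracket,
      LieRing.of_associative_ring_bracket]
    simp [Module.Dual.transpose_apply]

theorem dualRep_apply {L : Type*} [LieRing L] [LieAlgebra ℝ L] {M : Type*} [AddCommGroup M]
    [Module ℝ M] (ρ : L →ₗ⁅ℝ⁆ Module.End ℝ M) (A : L) (φ : Module.Dual ℝ M) (m : M) :
    dualRep ρ A φ m = -φ (ρ A m) := rfl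

variable (η) in
/-- The `1`-cochain `Z ⊗ φ` of degree `1` with values in `ℝZ ⊕ p`, for `φ ∈ S^*` extended by zero
to `m = S ⊕ V`. -/
def gradingCochain (φ : Module.Dual ℝ S) : S × V →ₗ[ℝ] ℝ × Poincare η S :=
  LinearMap.inl ℝ ℝ (Poincare η S) ∘ₗ φ ∘ₗ LinearMap.fst ℝ S V

theorem gradingCochain_apply (φ : Module.Dual ℝ S) (x : S × V) :
    gradingCochain η φ x = (φ x.1, 0) := rfl

/-- The differential `∂(Z ⊗ φ)`, computed with values in `ℝZ ⊕ p`. -/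
def gradingCocycle (ω : SpinSymplectic η S) (φ : Module.Dual ℝ S) :
    S × V →ₗ[ℝ] S × V →ₗ[ℝ] ℝ × Poincare η S :=
  d₁ (mBracket ω) (extAdj ω) 1 (gradingCochain η φ)

end GradingElement

end Spencer

end

/-! Everything is reduced to sign counting with the ordered products γ_I of gamma matrices g_a,
where I runs over subsets of the eleven indices. The volume element is central with square 1, hence
acts as a sign on the irreducible module S. So γ_I agrees up to sign with the product over the
complement of I, and the 1024 products with |I| even suffice. Five commuting involutions, four of
them taken from the extended Hamming code, have a common eigenvector whose joint eigenspace is a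
line, so only real scalars commute with the Clifford action (`eq_smul_one_of_commute`). Averaging
over the even products then yields dim S = 32, the Fierz identity, and the fact that the even γ_I
form a basis of End S. Invariance of the symplectic form makes γ_I symmetric for |I| ≡ 0 and skew
for |I| ≡ 2 mod 4.

A cocycle condition on odd arguments is a quadratic or cubic identity in s. The operators ⟨s,-⟩s
span the skew endomorphisms (`eq_zero_of_skew`), and they are combinations of the γ_K with K in
`skewSets`. Hence such an identity, polarised once in the cubic case, is equivalent to finitely many
linear equations, one for each K. The signs in these equations depend only on memberships and on
sizes of intersections.

For d ≥ 5 all values lie in positive degree, where p vanishes. In degree 4 faithfulness of the spin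
representation suffices. In degree 3 the equations of `eq_zero_of_spin_eq_dirac` have only the zero
solution. In both degrees the cocycles themselves vanish.

In degree 1 a cocycle consists of σ : S × S → S and β : S × V → V with κ(s,σ(s,s)) = β(s,κ(s,s)).
The equations force the η-symmetric part of β to come from a linear map V → S
(`exists_symmetric_part`), so β is removed by a coboundary. With β = 0 the map σ is determined by
one spinor, its component at a single six-element set (`cubic_eq_zero`). The cocycle ∂(Z ⊗ ⟨ψ,-⟩),
brought to the same form, has component 12 γ_K ψ there. This gives both injectivity and surjectivity
of φ ↦ [∂(Z ⊗ φ)].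

In degree 2 the component V × V → V is a torsion, removed by a unique so(V)-valued form. Write β(-,
e_a) = g_a N_a for the component S × V → S. The skewness and cubic conditions decouple over the
components γ_J of N_a, and their only solutions are N_a = (1 − 3χ_J(a)) γ_J with |J| = 4, where χ_J
is −1 on J and 1 off J. Equivalently β(s,v) = v·Φs − 3Φ(v·s) with Φ in the span of four-fold
products. Antisymmetrised Clifford multiplication identifies that span with Λ⁴V, and commutators
with the pairs g_a g_b show that it is irreducible. -/

set_option maxSynthPendingDepth 3

noncomputable section

attribute [local instance 100] LieRing.ofAssociativeRing

namespace Spencer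

universe u w

/-! ### Products of gamma matrices and their signs -/

section GammaProducts

variable {S : Type*} [AddCommGroup S] [Module ℝ S]

/-- Eleven anticommuting endomorphisms with squares `-sgn a`. -/
structure IsGamma (g : Fin 11 → Module.End ℝ S) : Prop where
  sq : ∀ a, g a * g a = (-sgn a) • 1
  anti : ∀ a b, a ≠ b → g a * g b = -(g b * g a)

/-- A real number which is `1` or `-1`. -/
def IsSign (r : ℝ) : Prop := r = 1 ∨ r = -1

theorem IsSign.mul {r s : ℝ} (hr : IsSign r) (hs : IsSign s) : IsSign (r * s) := by
  rcases hr with rfl | rfl <;> rcases hs with rfl | rfl <;> simp [IsSign]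

theorem IsSign.neg {r : ℝ} (hr : IsSign r) : IsSign (-r) := by
  rcases hr with rfl | rfl <;> simp [IsSign]

theorem IsSign.mul_self {r : ℝ} (hr : IsSign r) : r * r = 1 := by
  rcases hr with rfl | rfl <;> norm_num

theorem IsSign.ne_zero {r : ℝ} (hr : IsSign r) : r ≠ 0 := by
  rcases hr with rfl | rfl <;> norm_num

theorem isSign_one : IsSign 1 := Or.inl rfl

theorem isSign_neg_one : IsSign (-1) := Or.inr rfl

theorem isSign_sgn (a : Fin 11) : IsSign (sgn a) := by
  unfold sgn; split_ifs <;> simp [IsSign]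

theorem isSign_prod {ι : Type*} {s : Finset ι} {f : ι → ℝ} (h : ∀ i ∈ s, IsSign (f i)) :
    IsSign (∏ i ∈ s, f i) :=
  Finset.prod_induction _ _ (fun _ _ => IsSign.mul) isSign_one h

theorem IsSign.smul_smul {r : ℝ} (hr : IsSign r) {M : Type*} [AddCommGroup M] [Module ℝ M]
    (m : M) : r • r • m = m := by
  rw [_root_.smul_smul, hr.mul_self, one_smul]

/-- The sign `1` or `-1` according to whether `a` lies outside or in `I`. -/
def chi (I : Finset (Fin 11)) (a : Fin 11) : ℝ := if a ∈ I then -1 else 1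

theorem isSign_chi (I : Finset (Fin 11)) (a : Fin 11) : IsSign (chi I a) := by
  unfold chi; split_ifs <;> simp [IsSign]

variable (g : Fin 11 → Module.End ℝ S)

/-- The product over a list of indices of the `g i` with `i ∈ I`. -/
def gammaList (l : List (Fin 11)) (I : Finset (Fin 11)) : Module.End ℝ S :=
  (l.map fun i => if i ∈ I then g i else 1).prod

/-- The ordered product of the `g i` with `i ∈ I`. -/
def gamma (I : Finset (Fin 11)) : Module.End ℝ S := gammaList g (List.finRange 11) I

/-- The sign with which `g a` commutes with the `g i` with `i ∈ I` on the list. -/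
def commSign (l : List (Fin 11)) (I : Finset (Fin 11)) (a : Fin 11) : ℤ :=
  (l.map fun i => if i ∈ I then (if i = a then 1 else -1) else 1).prod

theorem isSign_commSign (l : List (Fin 11)) (I : Finset (Fin 11)) (a : Fin 11) :
    IsSign (commSign l I a) := by
  induction l with
  | nil => simp [commSign, IsSign]
  | cons b l ih =>
    have : (commSign (b :: l) I a : ℝ) =
        (if b ∈ I then (if b = a then 1 else -1) else 1) * commSign l I a := by
      simp [commSign]
    rw [this]
    refine IsSign.mul ?_ ih
    split_ifs <;> simp [IsSign]

/-- The sign of the square of a product of gamma matrices. -/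
def squareSign : List (Fin 11) → Finset (Fin 11) → ℤ
  | [], _ => 1
  | b :: l, I => if b ∈ I then (if b = 0 then -1 else 1) * commSign l I b * squareSign l I
      else squareSign l I

theorem gammaList_cons (b : Fin 11) (l : List (Fin 11)) (I : Finset (Fin 11)) :
    gammaList g (b :: l) I = (if b ∈ I then g b else 1) * gammaList g l I := by
  simp [gammaList]

variable {g}

theorem IsGamma.mul_gammaList (hg : IsGamma g) (l : List (Fin 11)) (I : Finset (Fin 11))
    (a : Fin 11) : g a * gammaList g l I = (commSign l I a : ℝ) • (gammaList g l I * g a) := by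
  induction l with
  | nil => simp [gammaList, commSign]
  | cons b l ih =>
    have e : (commSign (b :: l) I a : ℝ) =
        (if b ∈ I then (if b = a then 1 else -1) else 1) * commSign l I a := by
      simp [commSign]
    rw [gammaList_cons, e]
    by_cases hb : b ∈ I
    · by_cases hba : b = a
      · subst hba
        simp only [hb, if_true, one_mul]
        rw [mul_assoc, ih, mul_smul_comm]
      · simp only [hb, if_true, hba, if_false]
        rw [← mul_assoc, hg.anti a b (Ne.symm hba), neg_mul, mul_assoc, ih, mul_smul_comm,
          mul_assoc]
        module
    · simp only [hb, if_false, one_mul]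
      exact ih

theorem IsGamma.gammaList_sq (hg : IsGamma g) (l : List (Fin 11)) (I : Finset (Fin 11)) :
    gammaList g l I * gammaList g l I = (squareSign l I : ℝ) • 1 := by
  induction l with
  | nil => simp [gammaList, squareSign]
  | cons b l ih =>
    rw [gammaList_cons, squareSign]
    by_cases hb : b ∈ I
    · simp only [hb, if_true]
      have h1 : gammaList g l I * g b = (commSign l I b : ℝ) • (g b * gammaList g l I) := by
        rw [hg.mul_gammaList, (isSign_commSign l I b).smul_smul]
      rw [mul_assoc, ← mul_assoc (gammaList g l I), h1, smul_mul_assoc, mul_smul_comm, mul_assoc,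
        ih, ← mul_assoc, hg.sq]
      simp only [smul_smul, mul_smul_comm, mul_one]
      congr 1
      by_cases h0 : b = 0 <;> simp [sgn, h0]
    · simp only [hb, if_false, one_mul]
      exact ih

theorem isSign_squareSign (l : List (Fin 11)) (I : Finset (Fin 11)) :
    IsSign (squareSign l I) := by
  induction l with
  | nil => simp [squareSign, IsSign]
  | cons b l ih =>
    rw [squareSign]
    split_ifs
    · push_cast
      exact (isSign_neg_one.mul (isSign_commSign l I b)).mul ih
    · push_cast
      exact (isSign_one.mul (isSign_commSign l I b)).mul ih
    · exact ih

theorem gammaList_congr {l : List (Fin 11)} {I J : Finset (Fin 11)}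
    (h : ∀ i ∈ l, (i ∈ I ↔ i ∈ J)) : gammaList g l I = gammaList g l J := by
  unfold gammaList
  congr 1
  refine List.map_congr_left fun i hi => ?_
  simp [h i hi]

theorem IsGamma.mul_gammaList_symmDiff (hg : IsGamma g) {l : List (Fin 11)} (hl : l.Nodup)
    (I : Finset (Fin 11)) {a : Fin 11} (ha : a ∈ l) :
    ∃ r, IsSign r ∧ g a * gammaList g l I = r • gammaList g l (symmDiff I {a}) := by
  induction l with
  | nil => simp at ha
  | cons b l ih =>
    rw [List.nodup_cons] at hl
    simp only [gammaList_cons]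
    by_cases hba : b = a
    · subst hba
      have e : gammaList g l (symmDiff I {b}) = gammaList g l I :=
        gammaList_congr fun i hi => by
          have : i ≠ b := fun h => hl.1 (h ▸ hi)
          simp [Finset.mem_symmDiff, this]
      rw [e]
      by_cases hb : b ∈ I
      · refine ⟨-sgn b, (isSign_sgn b).neg, ?_⟩
        have : b ∉ symmDiff I {b} := by simp [Finset.mem_symmDiff, hb]
        simp only [hb, this, if_true, if_false, one_mul]
        rw [← mul_assoc, hg.sq, smul_mul_assoc, one_mul]
      · refine ⟨1, isSign_one, ?_⟩
        have : b ∈ symmDiff I {b} := by simp [Finset.mem_symmDiff, hb]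
        simp only [hb, this, if_true, if_false, one_mul, one_smul]
    · obtain ⟨r, hr, h⟩ := ih hl.2 (by simpa [Ne.symm hba] using ha)
      have hb' : b ∈ symmDiff I {a} ↔ b ∈ I := by simp [Finset.mem_symmDiff, hba]
      by_cases hb : b ∈ I
      · refine ⟨-r, hr.neg, ?_⟩
        simp only [hb, hb'.2 hb, if_true]
        rw [← mul_assoc, hg.anti a b (Ne.symm hba), neg_mul, mul_assoc, h, mul_smul_comm, neg_smul]
      · refine ⟨r, hr, ?_⟩
        rw [if_neg hb, if_neg fun h => hb (hb'.1 h), one_mul, one_mul]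
        exact h

theorem IsGamma.mul_gamma_symmDiff (hg : IsGamma g) (I : Finset (Fin 11)) (a : Fin 11) :
    ∃ r, IsSign r ∧ g a * gamma g I = r • gamma g (symmDiff I {a}) :=
  hg.mul_gammaList_symmDiff (List.nodup_finRange 11) I (List.mem_finRange a)

theorem gamma_empty : gamma g ∅ = 1 := by
  simp [gamma, gammaList]

/-- The sign of the square of `gamma g I`. -/
def gammaSign (I : Finset (Fin 11)) : ℝ := squareSign (List.finRange 11) I

theorem isSign_gammaSign (I : Finset (Fin 11)) : IsSign (gammaSign I) := isSign_squareSign _ I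

theorem IsGamma.gamma_sq (hg : IsGamma g) (I : Finset (Fin 11)) :
    gamma g I * gamma g I = gammaSign I • 1 := hg.gammaList_sq _ I

/-- Every factor of γ_I other than g_a contributes −1: there are |I| of them if a ∉ I, and |I| − 1
if a ∈ I. -/
theorem commSign_finRange (I : Finset (Fin 11)) (a : Fin 11) :
    (commSign (List.finRange 11) I a : ℝ) = (-1) ^ I.card * chi I a := by
  unfold commSign
  rw [← Fin.prod_univ_def]
  push_cast
  rw [Finset.prod_ite_mem, Finset.univ_inter]
  by_cases ha : a ∈ I
  · rw [← Finset.mul_prod_erase _ _ ha, if_pos rfl, one_mul,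
      Finset.prod_congr rfl (g := fun _ => (-1 : ℝ)) fun i hi => if_neg (Finset.ne_of_mem_erase hi),
      Finset.prod_const, ← Finset.card_erase_add_one ha, pow_succ, chi, if_pos ha]
    ring
  · rw [Finset.prod_congr rfl (g := fun _ => (-1 : ℝ)) fun i hi =>
      if_neg (ne_of_mem_of_not_mem hi ha), Finset.prod_const, chi, if_neg ha, mul_one]

theorem IsGamma.mul_gamma (hg : IsGamma g) (I : Finset (Fin 11)) (a : Fin 11) :
    g a * gamma g I = ((-1) ^ I.card * chi I a) • (gamma g I * g a) := by
  rw [← commSign_finRange]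
  exact hg.mul_gammaList _ I a

theorem IsGamma.mul_gamma_even (hg : IsGamma g) {I : Finset (Fin 11)} (hI : Even I.card)
    (a : Fin 11) : g a * gamma g I = chi I a • (gamma g I * g a) := by
  rw [hg.mul_gamma, hI.neg_one_pow, one_mul]

theorem IsGamma.gamma_mul_even (hg : IsGamma g) {I : Finset (Fin 11)} (hI : Even I.card)
    (a : Fin 11) : gamma g I * g a = chi I a • (g a * gamma g I) := by
  rw [hg.mul_gamma_even hI, (isSign_chi I a).smul_smul]

/-- The sign with which `gamma g I` and `gamma g J` commute. -/
def pairSign (I J : Finset (Fin 11)) : ℝ := ∏ a ∈ J, chi I a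

theorem isSign_pairSign (I J : Finset (Fin 11)) : IsSign (pairSign I J) :=
  isSign_prod fun a _ => isSign_chi I a

theorem pairSign_eq (I J : Finset (Fin 11)) : pairSign I J = (-1) ^ (I ∩ J).card := by
  unfold pairSign chi
  rw [Finset.prod_ite, Finset.prod_const, Finset.prod_const_one, mul_one,
    Finset.filter_mem_eq_inter,
    Finset.inter_comm]

theorem pairSign_comm (I J : Finset (Fin 11)) : pairSign I J = pairSign J I := by
  rw [pairSign_eq, pairSign_eq, Finset.inter_comm]

/-- For |I| even, moving g_j past γ_I costs just χ_I(j). The total sign is (−1)^|I ∩ J|, so even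
sets under symmetric difference behave like a symplectic space over F₂. -/
theorem IsGamma.gamma_mul_gamma_comm (hg : IsGamma g) {I : Finset (Fin 11)} (hI : Even I.card)
    (J : Finset (Fin 11)) :
    gamma g I * gamma g J = pairSign I J • (gamma g J * gamma g I) := by
  have key : ∀ l : List (Fin 11), gamma g I * gammaList g l J =
      (l.map fun i => if i ∈ J then chi I i else 1).prod • (gammaList g l J * gamma g I) := by
    intro l
    induction l with
    | nil => simp [gammaList]
    | cons b l ih =>
      rw [gammaList_cons, List.map_cons, List.prod_cons]
      by_cases hb : b ∈ J
      · simp only [hb, if_true]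
        rw [← mul_assoc, hg.gamma_mul_even hI, smul_mul_assoc, mul_assoc, ih, mul_smul_comm,
          smul_smul, mul_assoc]
      · simp only [hb, if_false, one_mul]
        exact ih
  have := key (List.finRange 11)
  rwa [← Fin.prod_univ_def, Finset.prod_ite_mem, Finset.univ_inter] at this

theorem IsGamma.gamma_mul_gamma (hg : IsGamma g) (I J : Finset (Fin 11)) :
    ∃ r, IsSign r ∧ gamma g I * gamma g J = r • gamma g (symmDiff I J) := by
  have key : ∀ l : List (Fin 11), l.Nodup → ∃ r, IsSign r ∧ gammaList g l I * gamma g J =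
      r • gamma g (symmDiff J (I.filter (· ∈ l))) := by
    intro l
    induction l with
    | nil => intro _; exact ⟨1, isSign_one, by simp [gammaList, ← Finset.bot_eq_empty]⟩
    | cons b l ih =>
      intro hl
      rw [List.nodup_cons] at hl
      obtain ⟨r, hr, h⟩ := ih hl.2
      rw [gammaList_cons]
      by_cases hb : b ∈ I
      · simp only [hb, if_true]
        obtain ⟨r', hr', h'⟩ := hg.mul_gamma_symmDiff (symmDiff J (I.filter (· ∈ l))) b
        refine ⟨r * r', hr.mul hr', ?_⟩
        rw [mul_assoc, h, mul_smul_comm, h', smul_smul, symmDiff_assoc]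
        congr 3
        ext i
        by_cases hi : i = b
        · subst hi; simp [Finset.mem_symmDiff, hb, hl.1]
        · simp [Finset.mem_symmDiff, hi]
      · simp only [hb, if_false, one_mul]
        refine ⟨r, hr, h.trans ?_⟩
        congr 3
        ext i
        by_cases hi : i = b
        · subst hi; simp [hb]
        · simp [hi]
  obtain ⟨r, hr, h⟩ := key _ (List.nodup_finRange 11)
  refine ⟨r, hr, ?_⟩
  rw [gamma, h, symmDiff_comm J]
  congr 3
  ext i; simp

/-- Reversing eleven anticommuting factors costs (−1)^55, and the squares multiply to −1 because
only g_0 squares to −1. It is the signature that makes the volume element an involution. -/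
theorem IsGamma.gamma_univ_sq (hg : IsGamma g) : gamma g Finset.univ * gamma g Finset.univ = 1 := by
  have : gammaSign Finset.univ = 1 := by
    have : squareSign (List.finRange 11) Finset.univ = 1 := by decide
    simp [gammaSign, this]
  rw [hg.gamma_sq, this, one_smul]

theorem IsGamma.gamma_univ_comm (hg : IsGamma g) (a : Fin 11) :
    g a * gamma g Finset.univ = gamma g Finset.univ * g a := by
  rw [hg.mul_gamma]
  simp [chi, Odd.neg_one_pow (show Odd 11 by decide)]

end GammaProducts

/-! ### Irreducible gamma matrices: commutant, dimension 32, Fierz identity -/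

section IrreducibleGamma

variable {S : Type*} [AddCommGroup S] [Module ℝ S]

/-- Gamma matrices without common invariant subspaces. -/
structure IsIrreducibleGamma (g : Fin 11 → Module.End ℝ S) : Prop extends IsGamma g where
  nontrivial : Nontrivial S
  irreducible : ∀ U : Submodule ℝ S, (∀ a, ∀ s ∈ U, g a s ∈ U) → U = ⊥ ∨ U = ⊤

variable {g : Fin 11 → Module.End ℝ S}

theorem even_card_symmDiff {I J : Finset (Fin 11)} (hI : Even I.card) (hJ : Even J.card) :
    Even (symmDiff I J).card := by
  have h1 : (symmDiff I J).card = (I \ J).card + (J \ I).card := by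
    rw [symmDiff_def, Finset.sup_eq_union, Finset.card_union_of_disjoint disjoint_sdiff_sdiff]
  have h2 := Finset.card_sdiff_add_card_inter I J
  have h3 := Finset.card_sdiff_add_card_inter J I
  rw [Finset.inter_comm] at h3
  rw [Nat.even_iff] at *
  omega

/-- The even subsets of the index set. -/
def evenSets : Finset (Finset (Fin 11)) := Finset.univ.filter fun I => Even I.card

theorem mem_evenSets {I : Finset (Fin 11)} : I ∈ evenSets ↔ Even I.card := by simp [evenSets]

theorem card_evenSets : evenSets.card = 1024 := by
  have h := Finset.sum_card_slice (α := Fin 11) evenSets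
  rw [← h]
  have : ∀ r ∈ Finset.Iic (Fintype.card (Fin 11)), (evenSets.slice r).card =
      if Even r then Nat.choose 11 r else 0 := by
    intro r _
    have e : evenSets.slice r = if Even r then Finset.powersetCard r Finset.univ else ∅ := by
      ext I
      rw [Finset.mem_slice, mem_evenSets]
      split_ifs with hr
      · rw [Finset.mem_powersetCard]
        exact ⟨fun h => ⟨Finset.subset_univ _, h.2⟩, fun h => ⟨h.2 ▸ hr, h.2⟩⟩
      · simp only [Finset.notMem_empty, iff_false, not_and]
        exact fun h h' => hr (h' ▸ h)
    rw [e]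
    split_ifs <;> simp
  rw [Finset.sum_congr rfl this]
  decide

/-- The kernel of N − r is stable under all g_a and contains s ≠ 0, so irreducibility makes it the
whole space. -/
theorem IsIrreducibleGamma.eq_smul_one (hg : IsIrreducibleGamma g) {N : Module.End ℝ S}
    (hN : ∀ a, g a * N = N * g a) {r : ℝ} {s : S} (hs : s ≠ 0) (h : N s = r • s) : N = r • 1 := by
  have := hg.irreducible (LinearMap.ker (N - r • 1)) fun a t ht => by
    rw [LinearMap.mem_ker] at ht ⊢
    have e : (N - r • 1) * g a = g a * (N - r • 1) := by
      rw [sub_mul, mul_sub, hN]; simp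
    have e' := congrArg (fun f : Module.End ℝ S => f t) e
    simp only [Module.End.mul_apply] at e'
    rw [e', ht, map_zero]
  rcases this with h' | h'
  · exact absurd ((Submodule.mem_bot ℝ).1 (h' ▸ (LinearMap.mem_ker.2 (by simp [h])))) hs
  · exact sub_eq_zero.1 (LinearMap.ker_eq_top.1 h')

/-- The volume element is a central involution. Either s is a (−1)-eigenvector, or s plus its image
is a nonzero 1-eigenvector. -/
theorem IsIrreducibleGamma.gamma_univ (hg : IsIrreducibleGamma g) :
    ∃ r, IsSign r ∧ gamma g Finset.univ = r • 1 := by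
  obtain ⟨s, hs⟩ := @exists_ne S hg.nontrivial 0
  have hsq := congrArg (fun f : Module.End ℝ S => f s) hg.gamma_univ_sq
  simp only [Module.End.mul_apply, Module.End.one_apply] at hsq
  by_cases h : gamma g Finset.univ s = -s
  · exact ⟨-1, isSign_neg_one, hg.eq_smul_one hg.gamma_univ_comm hs (by rw [h, neg_one_smul])⟩
  · refine ⟨1, isSign_one, hg.eq_smul_one (s := s + gamma g Finset.univ s) hg.gamma_univ_comm
      (fun h' => h (eq_neg_of_add_eq_zero_right h')) ?_⟩
    rw [map_add, hsq, one_smul, add_comm]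

theorem IsIrreducibleGamma.gamma_compl (hg : IsIrreducibleGamma g) (I : Finset (Fin 11)) :
    ∃ r, IsSign r ∧ gamma g I = r • gamma g Iᶜ := by
  obtain ⟨r, hr, h⟩ := hg.gamma_univ
  obtain ⟨q, hq, h'⟩ := hg.gamma_mul_gamma Finset.univ I
  have e : symmDiff Finset.univ I = Iᶜ := by
    ext i; simp [Finset.mem_symmDiff]
  rw [h, e, smul_mul_assoc, one_mul] at h'
  refine ⟨r * q, hr.mul hq, ?_⟩
  rw [← smul_smul, ← h', hr.smul_smul]

theorem card_erase_univ (a : Fin 11) : (Finset.univ.erase a).card = 10 := by simp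

theorem even_card_erase_univ (a : Fin 11) : Even (Finset.univ.erase a).card := by
  rw [card_erase_univ]; decide

/-- Since the volume element is a sign, g_a can be traded for the product of the other ten gammas;
this is why even products suffice throughout. -/
theorem IsIrreducibleGamma.eq_smul_gamma_erase (hg : IsIrreducibleGamma g) (a : Fin 11) :
    ∃ r, IsSign r ∧ g a = r • gamma g (Finset.univ.erase a) := by
  obtain ⟨r, hr, h⟩ := hg.mul_gamma_symmDiff ∅ a
  obtain ⟨q, hq, h'⟩ := hg.gamma_compl {a}
  have e : symmDiff (∅ : Finset (Fin 11)) {a} = {a} := bot_symmDiff _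
  have e' : ({a} : Finset (Fin 11))ᶜ = Finset.univ.erase a := by ext i; simp
  rw [gamma_empty, mul_one, e, h', e', smul_smul] at h
  exact ⟨_, hr.mul hq, h⟩

/-- The span is stable under even products, hence under each g_a, which is an even product up to
sign. In particular S is finite-dimensional. -/
theorem IsIrreducibleGamma.span_gamma (hg : IsIrreducibleGamma g) {s : S} (hs : s ≠ 0) :
    Submodule.span ℝ ((fun I => gamma g I s) '' {I | Even I.card}) = ⊤ := by
  refine (hg.irreducible _ fun a t ht => ?_).resolve_left fun h => hs ?_
  · induction ht using Submodule.span_induction with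
    | mem x hx =>
      obtain ⟨I, hI, rfl⟩ := hx
      obtain ⟨r, hr, h⟩ := hg.eq_smul_gamma_erase a
      obtain ⟨q, hq, h'⟩ := hg.gamma_mul_gamma (Finset.univ.erase a) I
      have e : g a (gamma g I s) = (r * q) • gamma g (symmDiff (Finset.univ.erase a) I) s := by
        rw [h, LinearMap.smul_apply, ← Module.End.mul_apply, h', LinearMap.smul_apply, smul_smul]
      change g a (gamma g I s) ∈ _
      rw [e]
      exact Submodule.smul_mem _ _ (Submodule.subset_span
        ⟨_, even_card_symmDiff (even_card_erase_univ a) hI, rfl⟩)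
    | zero => simp
    | add x y _ _ hx hy => rw [map_add]; exact add_mem hx hy
    | smul c x _ hx => rw [map_smul]; exact Submodule.smul_mem _ _ hx
  · rw [Submodule.span_eq_bot] at h
    have := h (gamma g ∅ s) ⟨∅, by simp, rfl⟩
    simpa [gamma_empty] using this

theorem IsIrreducibleGamma.finite (hg : IsIrreducibleGamma g) : Module.Finite ℝ S := by
  obtain ⟨s, hs⟩ := @exists_ne S hg.nontrivial 0
  exact ⟨⟨(Set.Finite.image _ (Set.toFinite _)).toFinset, by
    rw [Set.Finite.coe_toFinset]; exact hg.span_gamma hs⟩⟩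

/-- At each step either s is already a (−1)-eigenvector of the involution γ_I, or s + γ_I s is a
nonzero 1-eigenvector. The earlier eigenvalues persist because the products commute. -/
theorem IsIrreducibleGamma.exists_eigenvector (hg : IsIrreducibleGamma g)
    (L : List (Finset (Fin 11))) (hL : ∀ I ∈ L, Even I.card ∧ gammaSign I = 1)
    (hp : L.Pairwise fun I J => pairSign I J = 1) :
    ∃ s : S, s ≠ 0 ∧ ∀ I ∈ L, ∃ r, IsSign r ∧ gamma g I s = r • s := by
  induction L with
  | nil =>
    obtain ⟨s, hs⟩ := @exists_ne S hg.nontrivial 0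
    exact ⟨s, hs, by simp⟩
  | cons I L ih =>
    rw [List.pairwise_cons] at hp
    obtain ⟨s, hs, h⟩ := ih (fun J hJ => hL J (by simp [hJ])) hp.2
    have hI := hL I (by simp)
    by_cases h0 : gamma g I s = -s
    · refine ⟨s, hs, fun J hJ => ?_⟩
      rcases List.mem_cons.1 hJ with rfl | hJ
      · exact ⟨-1, isSign_neg_one, by rw [h0, neg_one_smul]⟩
      · exact h J hJ
    · refine ⟨s + gamma g I s, fun h' => h0 (eq_neg_of_add_eq_zero_right h'), fun J hJ => ?_⟩
      rcases List.mem_cons.1 hJ with rfl | hJ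
      · refine ⟨1, isSign_one, ?_⟩
        rw [map_add, ← Module.End.mul_apply, hg.gamma_sq, hI.2, one_smul, one_smul,
          Module.End.one_apply, add_comm]
      · obtain ⟨r, hr, e⟩ := h J hJ
        refine ⟨r, hr, ?_⟩
        rw [map_add, ← Module.End.mul_apply, hg.gamma_mul_gamma_comm (hL J (by simp [hJ])).1,
          pairSign_comm, hp.1 J hJ, one_smul, Module.End.mul_apply, e, map_smul, smul_add]

/-- Each γ_I s is an eigenvector of γ_J, with the eigenvalue of s multiplied by `pairSign I J`. The
projector onto the eigenspace of s fixes u, fixes γ_I s if I commutes with J, and kills it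
otherwise; the members of L are treated one after another. -/
theorem IsIrreducibleGamma.mem_span_of_eigenvector (hg : IsIrreducibleGamma g)
    {s : S} (hs : s ≠ 0) (L : List (Finset (Fin 11)))
    (hL : ∀ I ∈ L, ∃ r, IsSign r ∧ gamma g I s = r • s) {u : S}
    (hu : ∀ I ∈ L, ∀ r : ℝ, gamma g I s = r • s → gamma g I u = r • u) :
    u ∈ Submodule.span ℝ ((fun I => gamma g I s) ''
      {I | Even I.card ∧ ∀ J ∈ L, pairSign I J = 1}) := by
  induction L with
  | nil => simp [hg.span_gamma hs]
  | cons J L ih =>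
    have h := ih (fun I hI => hL I (by simp [hI])) (fun I hI => hu I (by simp [hI]))
    obtain ⟨r, hr, e⟩ := hL J (by simp)
    have e' := hu J (by simp) r e
    let P : Module.End ℝ S := (1 / 2 : ℝ) • (1 + r • gamma g J)
    have hPu : P u = u := by
      simp only [P, LinearMap.smul_apply, LinearMap.add_apply, Module.End.one_apply, e',
        hr.smul_smul]
      module
    rw [← hPu]
    have := Submodule.mem_map_of_mem (f := P) h
    rw [Submodule.map_span] at this
    refine (Submodule.span_le.2 ?_) this
    rintro _ ⟨_, ⟨I, hI, rfl⟩, rfl⟩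
    have hc : gamma g J (gamma g I s) = pairSign I J • r • gamma g I s := by
      have := congrArg (fun f : Module.End ℝ S => f s) (hg.gamma_mul_gamma_comm hI.1 J)
      simp only [Module.End.mul_apply, LinearMap.smul_apply, e, map_smul] at this
      rw [this, (isSign_pairSign I J).smul_smul]
    have hP : P (gamma g I s) = (1 / 2 : ℝ) • (gamma g I s + pairSign I J • gamma g I s) := by
      simp only [P, LinearMap.smul_apply, LinearMap.add_apply, Module.End.one_apply, hc]
      rw [smul_comm r, hr.smul_smul]
    rw [SetLike.mem_coe]
    change P (gamma g I s) ∈ _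
    rw [hP]
    rcases isSign_pairSign I J with h1 | h1
    · rw [h1]
      refine Submodule.smul_mem _ _ (add_mem ?_ (Submodule.smul_mem _ _ ?_)) <;>
      · refine Submodule.subset_span ⟨I, ⟨hI.1, fun K hK => ?_⟩, rfl⟩
        rcases List.mem_cons.1 hK with rfl | hK
        · exact h1
        · exact hI.2 K hK
    · rw [h1, neg_one_smul, add_neg_cancel, smul_zero]
      exact zero_mem _

/-- Generators of a maximal isotropic subspace: the extended Hamming code on `1, …, 8`, and
`{0, 9}`. -/
def hammingSets : List (Finset (Fin 11)) :=
  [{0, 9}, {1, 6, 7, 8}, {2, 5, 7, 8}, {3, 5, 6, 8}, {4, 5, 6, 7}]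

set_option maxRecDepth 10000 in
theorem hammingSets_spec : ∀ I ∈ hammingSets, Even I.card ∧ gammaSign I = 1 := by
  have : ∀ I ∈ hammingSets, Even I.card ∧ squareSign (List.finRange 11) I = 1 := by decide
  intro I hI
  exact ⟨(this I hI).1, by rw [gammaSign, (this I hI).2, Int.cast_one]⟩

set_option maxRecDepth 10000 in
theorem hammingSets_pairwise : hammingSets.Pairwise fun I J => pairSign I J = 1 := by
  have : hammingSets.Pairwise fun I J => Even (I ∩ J).card := by decide
  exact this.imp fun h => by rw [pairSign_eq, h.neg_one_pow]

theorem even_sum_of_pairSign {I J : Finset (Fin 11)} (h : pairSign I J = 1) :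
    Even (∑ j ∈ J, if j ∈ I then 1 else 0) := by
  rw [Finset.sum_boole, Finset.filter_mem_eq_inter, Nat.cast_id]
  rw [pairSign_eq, Finset.inter_comm] at h
  exact neg_one_pow_eq_one_iff_even (by norm_num) |>.1 h

theorem mem_ite_empty {p : Prop} [Decidable p] {A : Finset (Fin 11)} {i : Fin 11} :
    (i ∈ if p then A else ∅) ↔ p ∧ i ∈ A := by
  split_ifs with h <;> simp [h]

theorem toNat_decide_mem (I : Finset (Fin 11)) (i : Fin 11) :
    (if i ∈ I then 1 else 0) = (decide (i ∈ I)).toNat := by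
  by_cases h : i ∈ I <;> simp [h]

-- The four parity checks express the last four bits by the first four, which reproduces the
-- generators: the extended Hamming code is self-dual.
set_option maxRecDepth 10000 in
theorem hamming_parity : ∀ x1 x2 x3 x4 x5 x6 x7 x8 : Bool,
    (x1.toNat + (x6.toNat + (x7.toNat + x8.toNat))) % 2 = 0 →
    (x2.toNat + (x5.toNat + (x7.toNat + x8.toNat))) % 2 = 0 →
    (x3.toNat + (x5.toNat + (x6.toNat + x8.toNat))) % 2 = 0 →
    (x4.toNat + (x5.toNat + (x6.toNat + x7.toNat))) % 2 = 0 →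
      x5 = (x2 ^^ (x3 ^^ x4)) ∧ x6 = (x1 ^^ (x3 ^^ x4)) ∧ x7 = (x1 ^^ (x2 ^^ x4)) ∧
        x8 = (x1 ^^ (x2 ^^ x3)) := by
  decide

/-- Maximality of the isotropic subspace: the bits 0 to 4 are free, the Hamming checks determine 5
to 8, the check {0, 9} determines 9, and evenness of |I| excludes 10. -/
theorem eq_symmDiff_of_isotropic {I : Finset (Fin 11)} (hI : Even I.card)
    (h : ∀ J ∈ hammingSets, pairSign I J = 1) :
    I = symmDiff (if 0 ∈ I then {0, 9} else ∅) (symmDiff (if 1 ∈ I then {1, 6, 7, 8} else ∅)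
      (symmDiff (if 2 ∈ I then {2, 5, 7, 8} else ∅) (symmDiff
        (if 3 ∈ I then {3, 5, 6, 8} else ∅) (if 4 ∈ I then {4, 5, 6, 7} else ∅)))) := by
  have h0 : Even (∑ j : Fin 11, if j ∈ I then 1 else 0) := by simpa using hI
  have h1 := even_sum_of_pairSign (h {0, 9} (by simp [hammingSets]))
  have h2 := even_sum_of_pairSign (h {1, 6, 7, 8} (by simp [hammingSets]))
  have h3 := even_sum_of_pairSign (h {2, 5, 7, 8} (by simp [hammingSets]))
  have h4 := even_sum_of_pairSign (h {3, 5, 6, 8} (by simp [hammingSets]))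
  have h5 := even_sum_of_pairSign (h {4, 5, 6, 7} (by simp [hammingSets]))
  rw [Finset.sum_pair (by decide)] at h1
  rw [Finset.sum_insert (by decide), Finset.sum_insert (by decide), Finset.sum_pair (by decide)]
    at h2 h3 h4 h5
  simp only [Fin.sum_univ_succ, Fin.sum_univ_zero, add_zero] at h0
  simp only [toNat_decide_mem, Nat.even_iff] at h0 h1 h2 h3 h4 h5
  obtain ⟨k5, k6, k7, k8⟩ := hamming_parity _ _ _ _ _ _ _ _ h2 h3 h4 h5
  have k9 : (9 : Fin 11) ∈ I ↔ (0 : Fin 11) ∈ I := by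
    by_cases m0 : (0 : Fin 11) ∈ I <;> by_cases m9 : (9 : Fin 11) ∈ I <;> simp [m0, m9] at h1 ⊢
  have k10 : (10 : Fin 11) ∉ I := by
    intro m10
    have : (decide ((10 : Fin 11) ∈ I)).toNat = 1 := by simp [m10]
    change (_ + (_ + (_ + (_ + (_ + (_ + (_ + (_ + (_ + (_ + (decide
      ((10 : Fin 11) ∈ I)).toNat))))))))))
      % 2 = 0 at h0
    simp only [Fin.succ_zero_eq_one, Fin.reduceSucc] at h0
    omega
  clear h0 h1 h2 h3 h4 h5 h
  ext i
  simp only [Finset.mem_symmDiff, mem_ite_empty]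
  fin_cases i
  all_goals simp [k9, k10]
  · by_cases m2 : 2 ∈ I <;> by_cases m3 : 3 ∈ I <;> by_cases m4 : 4 ∈ I <;>
      simp [m2, m3, m4] at k5 ⊢ <;> exact k5
  · by_cases m1 : 1 ∈ I <;> by_cases m3 : 3 ∈ I <;> by_cases m4 : 4 ∈ I <;>
      simp [m1, m3, m4] at k6 ⊢ <;> exact k6
  · by_cases m1 : 1 ∈ I <;> by_cases m2 : 2 ∈ I <;> by_cases m4 : 4 ∈ I <;>
      simp [m1, m2, m4] at k7 ⊢ <;> exact k7
  · by_cases m1 : 1 ∈ I <;> by_cases m2 : 2 ∈ I <;> by_cases m3 : 3 ∈ I <;>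
      simp [m1, m2, m3] at k8 ⊢ <;> exact k8

/-- Endomorphisms that commute with irreducible gamma matrices are scalars. -/
theorem IsIrreducibleGamma.eq_smul_one_of_commute (hg : IsIrreducibleGamma g)
    {N : Module.End ℝ S} (hN : ∀ a, g a * N = N * g a) : ∃ r : ℝ, N = r • 1 := by
  obtain ⟨s, hs, he⟩ := hg.exists_eigenvector hammingSets hammingSets_spec hammingSets_pairwise
  have hNI : ∀ I, gamma g I * N = N * gamma g I := by
    intro I
    unfold gamma
    induction List.finRange 11 with
    | nil => simp [gammaList]
    | cons b l ih =>
      rw [gammaList_cons]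
      split_ifs
      · rw [mul_assoc, ih, ← mul_assoc, hN, mul_assoc]
      · rw [one_mul, ih]
  -- As N commutes with all γ_I, the vector N s has the same eigenvalues as s.
  have hNs := hg.mem_span_of_eigenvector hs hammingSets he (u := N s) fun I _ r h => by
    rw [← Module.End.mul_apply, hNI, Module.End.mul_apply, h, map_smul]
  -- An even I that commutes with the five generators is a symmetric difference of some of them, so
  -- γ_I s = ±s. The joint eigenspace is thus a real line, which rules out a complex or quaternionic
  -- commutant.
  have hle : Submodule.span ℝ ((fun I => gamma g I s) ''
      {I | Even I.card ∧ ∀ J ∈ hammingSets, pairSign I J = 1}) ≤ Submodule.span ℝ {s} := by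
    rw [Submodule.span_le]
    rintro _ ⟨I, hI, rfl⟩
    have hmul : ∀ A B, (∃ r, IsSign r ∧ gamma g A s = r • s) →
        (∃ r, IsSign r ∧ gamma g B s = r • s) →
        ∃ r, IsSign r ∧ gamma g (symmDiff A B) s = r • s := by
      rintro A B ⟨r, hr, h⟩ ⟨q, hq, h'⟩
      obtain ⟨p, hp, e⟩ := hg.gamma_mul_gamma A B
      refine ⟨p * (q * r), hp.mul (hq.mul hr), ?_⟩
      have e' := congrArg (fun f : Module.End ℝ S => f s) e
      simp only [Module.End.mul_apply, LinearMap.smul_apply, h', map_smul, h] at e'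
      rw [← smul_smul, ← smul_smul, e', hp.smul_smul]
    have hite : ∀ (p : Prop) [Decidable p] (A), A ∈ hammingSets →
        ∃ r, IsSign r ∧ gamma g (if p then A else ∅) s = r • s := by
      intro p _ A hA
      split_ifs
      · exact he A hA
      · exact ⟨1, isSign_one, by simp [gamma_empty]⟩
    have h := eq_symmDiff_of_isotropic hI.1 hI.2
    have : ∃ r, IsSign r ∧ gamma g I s = r • s := by
      rw [h]
      refine hmul _ _ (hite _ _ ?_) (hmul _ _ (hite _ _ ?_) (hmul _ _ (hite _ _ ?_)
        (hmul _ _ (hite _ _ ?_) (hite _ _ ?_)))) <;> simp [hammingSets]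
    obtain ⟨r, _, h⟩ := this
    exact Submodule.mem_span_singleton.2 ⟨r, h.symm⟩
  obtain ⟨r, hr⟩ := Submodule.mem_span_singleton.1 (hle hNs)
  exact ⟨r, hg.eq_smul_one hN hs hr.symm⟩

theorem IsGamma.gamma_inv (hg : IsGamma g) (I : Finset (Fin 11)) :
    gamma g I * (gammaSign I • gamma g I) = 1 := by
  rw [mul_smul_comm, hg.gamma_sq, (isSign_gammaSign I).smul_smul]

/-- Since `gammaSign I • gamma g I` is the inverse of γ_I, the sum averages M over conjugation by
the even products. It commutes with them, in particular with g_a, and is therefore a scalar. -/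
theorem IsIrreducibleGamma.exists_average (hg : IsIrreducibleGamma g) (M : Module.End ℝ S) :
    ∃ r : ℝ, ∑ I ∈ evenSets, gammaSign I • (gamma g I * M * gamma g I) = r • 1 := by
  refine hg.eq_smul_one_of_commute fun a => ?_
  obtain ⟨r, -, h⟩ := hg.eq_smul_gamma_erase a
  rw [h, smul_mul_assoc, mul_smul_comm]
  congr 1
  set J := Finset.univ.erase a
  have hJ : Even J.card := even_card_erase_univ a
  rw [Finset.mul_sum, Finset.sum_mul]
  -- Reindexing by I ↦ J ∆ I moves γ_J from one side to the other. The undetermined sign q with γ_J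
  -- γ_I = q γ_{J ∆ I} occurs twice and cancels.
  refine Finset.sum_nbij' (symmDiff J) (symmDiff J) ?_ ?_ ?_ ?_ ?_
  · exact fun I hI => mem_evenSets.2 (even_card_symmDiff hJ (mem_evenSets.1 hI))
  · exact fun I hI => mem_evenSets.2 (even_card_symmDiff hJ (mem_evenSets.1 hI))
  · intro I _; simp
  · intro I _; simp
  · intro I _
    obtain ⟨q, hq, e⟩ := hg.gamma_mul_gamma J I
    have e1 : gamma g (symmDiff J I) = q • (gamma g J * gamma g I) := by
      rw [e, hq.smul_smul]
    have e2 : gammaSign (symmDiff J I) • gamma g (symmDiff J I) =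
        (q * gammaSign I * gammaSign J) • (gamma g I * gamma g J) := by
      have h1 := hg.gamma_inv (symmDiff J I)
      have h2 : ((q * gammaSign I * gammaSign J) • (gamma g I * gamma g J)) *
          gamma g (symmDiff J I) = 1 := by
        have h3 : gamma g I * gamma g J * (gamma g J * gamma g I) =
            (gammaSign J * gammaSign I) • 1 := by
          rw [mul_assoc, ← mul_assoc (gamma g J), hg.gamma_sq, smul_mul_assoc, one_mul,
            mul_smul_comm, hg.gamma_sq, smul_smul]
        rw [e1, smul_mul_assoc, mul_smul_comm, h3, smul_smul, smul_smul]
        have : q * gammaSign I * gammaSign J * (q * (gammaSign J * gammaSign I)) = 1 := by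
          linear_combination (gammaSign I * gammaSign I * (gammaSign J * gammaSign J)) *
            hq.mul_self + (gammaSign J * gammaSign J) * (isSign_gammaSign I).mul_self +
            (isSign_gammaSign J).mul_self
        simp only [← mul_assoc] at this ⊢
        rw [this, one_smul]
      exact (left_inv_eq_right_inv h2 h1).symm
    rw [← mul_smul_comm (gammaSign (symmDiff J I)), e2, e1]
    simp only [smul_mul_assoc, mul_smul_comm, smul_smul, mul_assoc, hg.gamma_sq, mul_one]
    congr 1
    have := hq.mul_self
    have := (isSign_gammaSign J).mul_self
    linear_combination (-gammaSign I) * this - gammaSign I * gammaSign J * gammaSign J * hq.mul_self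

/-- With the scalar square c = g_a², cyclicity gives tr(g_a N g_a) = c tr N, and anticommutation
gives −c tr N. -/
theorem IsGamma.trace_eq_zero (hg : IsGamma g) {N : Module.End ℝ S} {a : Fin 11}
    (h : g a * N = -(N * g a)) : LinearMap.trace ℝ S N = 0 := by
  have h1 : LinearMap.trace ℝ S (g a * N * g a) = LinearMap.trace ℝ S (N * (g a * g a)) := by
    rw [mul_assoc, LinearMap.trace_mul_comm, mul_assoc]
  rw [h, neg_mul, mul_assoc, map_neg, hg.sq, mul_smul_comm, mul_one, map_smul, smul_eq_mul] at h1
  rcases isSign_sgn a with h0 | h0 <;> rw [h0] at h1 <;> linarith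

theorem IsGamma.trace_gamma (hg : IsGamma g) {I : Finset (Fin 11)} (hI : Even I.card)
    (h : I ≠ ∅) : LinearMap.trace ℝ S (gamma g I) = 0 := by
  obtain ⟨a, ha⟩ := Finset.nonempty_iff_ne_empty.2 h
  refine hg.trace_eq_zero (a := a) ?_
  rw [hg.mul_gamma_even hI, chi, if_pos ha, neg_one_smul]

/-- The average of the rank one operator φ(-) s, evaluated at u. Each of its 1024 conjugates has
trace φ(s), and this determines the scalar r. -/
theorem IsIrreducibleGamma.sum_gamma (hg : IsIrreducibleGamma g) (φ : Module.Dual ℝ S) (s u : S) :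
    ∃ r : ℝ, r * Module.finrank ℝ S = 1024 * φ s ∧
      ∑ I ∈ evenSets, (gammaSign I * φ (gamma g I u)) • gamma g I s = r • u := by
  have := hg.finite
  obtain ⟨r, hr⟩ := hg.exists_average (φ.smulRight s)
  refine ⟨r, ?_, ?_⟩
  · have h := congrArg (LinearMap.trace ℝ S) hr
    rw [map_smul, LinearMap.trace_one, smul_eq_mul, map_sum] at h
    rw [← h, Finset.sum_congr rfl (g := fun _ => φ s) fun I _ => ?_]
    · rw [Finset.sum_const, card_evenSets, nsmul_eq_mul]; norm_num
    · rw [map_smul, LinearMap.trace_mul_comm, ← mul_assoc, hg.gamma_sq, smul_mul_assoc, one_mul,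
        map_smul, (isSign_gammaSign I).smul_smul, LinearMap.trace_smulRight]
  · have h := congrArg (fun f : Module.End ℝ S => f u) hr
    simp only [LinearMap.sum_apply, LinearMap.smul_apply, Module.End.mul_apply,
      LinearMap.smulRight_apply, map_smul, Module.End.one_apply, smul_smul] at h
    exact h

/-- Read as an identity of operators in s, `sum_gamma` writes φ(-) u as a combination of the γ_I. In
its trace only I = ∅ survives, so dim · φ(u) = (1024 / dim) φ(u) and dim² = 1024. -/
theorem IsIrreducibleGamma.finrank_eq (hg : IsIrreducibleGamma g) : Module.finrank ℝ S = 32 := by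
  have := hg.finite
  obtain ⟨u, hu⟩ := @exists_ne S hg.nontrivial 0
  obtain ⟨φ, hφ⟩ : ∃ φ : Module.Dual ℝ S, φ u ≠ 0 := by
    by_contra! h
    exact hu ((Module.forall_dual_apply_eq_zero_iff ℝ u).1 h)
  have hn : (Module.finrank ℝ S : ℝ) ≠ 0 := by
    have := hg.nontrivial
    exact_mod_cast (Module.finrank_pos (R := ℝ) (M := S)).ne'
  have key : ∑ I ∈ evenSets, (gammaSign I * φ (gamma g I u)) • gamma g I =
      (1024 / (Module.finrank ℝ S : ℝ)) • φ.smulRight u := by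
    ext s
    obtain ⟨r, hr, h⟩ := hg.sum_gamma φ s u
    simp only [LinearMap.sum_apply, LinearMap.smul_apply, LinearMap.smulRight_apply, h, smul_smul]
    congr 1
    field_simp
    linarith
  have h := congrArg (LinearMap.trace ℝ S) key
  rw [map_smul, LinearMap.trace_smulRight, map_sum, Finset.sum_eq_single ∅] at h
  · have h1 : gammaSign ∅ = 1 := by
      have := hg.gamma_sq ∅
      rw [gamma_empty, mul_one] at this
      have h2 := congrArg (fun f : Module.End ℝ S => φ (f u)) this
      simp only [Module.End.one_apply, LinearMap.smul_apply, map_smul, smul_eq_mul] at h2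
      exact (mul_right_cancel₀ hφ (by linarith) : (1 : ℝ) = gammaSign ∅).symm
    rw [gamma_empty, map_smul, LinearMap.trace_one, h1, Module.End.one_apply, smul_eq_mul,
      smul_eq_mul, one_mul] at h
    field_simp at h
    have : Module.finrank ℝ S ^ 2 = 32 ^ 2 := by exact_mod_cast (by linarith :
      (Module.finrank ℝ S : ℝ) ^ 2 = 32 ^ 2)
    exact (Nat.pow_left_injective (n := 2) (by norm_num)) this
  · intro I hI h0
    rw [map_smul, hg.trace_gamma (mem_evenSets.1 hI) h0, smul_zero]
  · intro h0; exact absurd (mem_evenSets.2 (by simp)) h0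

/-- The Fierz identity. -/
theorem IsIrreducibleGamma.fierz (hg : IsIrreducibleGamma g) (φ : Module.Dual ℝ S) (s u : S) :
    ∑ I ∈ evenSets, (gammaSign I * φ (gamma g I u)) • gamma g I s = (32 * φ s) • u := by
  obtain ⟨r, hr, h⟩ := hg.sum_gamma φ s u
  rw [hg.finrank_eq] at hr
  rw [h]
  congr 1
  push_cast at hr
  linarith

theorem IsIrreducibleGamma.smulRight_eq_sum (hg : IsIrreducibleGamma g) (φ : Module.Dual ℝ S)
    (u : S) : φ.smulRight u =
      ∑ I ∈ evenSets, (1 / 32 * (gammaSign I * φ (gamma g I u))) • gamma g I := by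
  ext s
  simp only [LinearMap.sum_apply, LinearMap.smul_apply, LinearMap.smulRight_apply, mul_smul _ _
    (_ : S), ← Finset.smul_sum]
  have := hg.fierz φ s u
  simp only [mul_smul] at this
  rw [this, smul_smul]; norm_num

/-- The trace of an endomorphism that commutes with all gamma matrices. -/
theorem IsIrreducibleGamma.trace_smul_one (hg : IsIrreducibleGamma g) {N : Module.End ℝ S}
    (h : ∀ a, g a * N = N * g a) : LinearMap.trace ℝ S N • (1 : Module.End ℝ S) = (32 : ℝ) • N := by
  have := hg.finite
  obtain ⟨r, rfl⟩ := hg.eq_smul_one_of_commute h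
  rw [map_smul, LinearMap.trace_one, hg.finrank_eq, smul_smul, smul_eq_mul, mul_comm]; norm_num

theorem IsIrreducibleGamma.trace_gamma_mul_gamma (hg : IsIrreducibleGamma g)
    {I J : Finset (Fin 11)} (hI : Even I.card) (hJ : Even J.card) :
    LinearMap.trace ℝ S (gamma g I * gamma g J) = if I = J then 32 * gammaSign I else 0 := by
  have := hg.finite
  split_ifs with h
  · subst h
    rw [hg.gamma_sq, map_smul, LinearMap.trace_one, hg.finrank_eq, smul_eq_mul, mul_comm]; norm_num
  · obtain ⟨r, -, e⟩ := hg.gamma_mul_gamma I J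
    rw [e, map_smul, hg.trace_gamma (even_card_symmDiff hI hJ), smul_zero]
    rwa [Ne, ← Finset.bot_eq_empty, symmDiff_eq_bot]

/-- The products of evenly many gamma matrices span the endomorphisms. -/
theorem IsIrreducibleGamma.eq_sum_gamma (hg : IsIrreducibleGamma g) (M : Module.End ℝ S) :
    M = ∑ I ∈ evenSets,
      (1 / 32 * (gammaSign I * LinearMap.trace ℝ S (gamma g I * M))) • gamma g I := by
  have := hg.finite
  let b := Module.finBasis ℝ S
  have hM : M = ∑ i, (b.coord i).smulRight (M (b i)) := by
    refine b.ext fun j => ?_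
    simp [LinearMap.sum_apply, Finsupp.single_apply]
  conv_lhs => rw [hM]
  simp_rw [hg.smulRight_eq_sum]
  rw [Finset.sum_comm]
  refine Finset.sum_congr rfl fun I _ => ?_
  rw [← Finset.sum_smul]
  congr 1
  rw [← Finset.mul_sum, ← Finset.mul_sum]
  congr 2
  conv_rhs => rw [hM, Finset.mul_sum, map_sum]
  refine Finset.sum_congr rfl fun i _ => ?_
  have : gamma g I * (b.coord i).smulRight (M (b i)) =
      (b.coord i).smulRight (gamma g I (M (b i))) := by
    ext s; simp
  rw [this, LinearMap.trace_smulRight]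

end IrreducibleGamma

/-! ### The symplectic form: symmetric and skew products -/

section SymplecticGamma

variable {S : Type*} [AddCommGroup S] [Module ℝ S]

/-- Skewness of an endomorphism with respect to a bilinear form. -/
def IsSkew (ω : LinearMap.BilinForm ℝ S) (C : Module.End ℝ S) : Prop :=
  ∀ s t, ω (C s) t = -ω s (C t)

/-- Irreducible gamma matrices with a symplectic form for which their products in pairs are
skew. -/
structure IsSymplecticGamma (g : Fin 11 → Module.End ℝ S) (ω : LinearMap.BilinForm ℝ S) : Prop
    extends IsIrreducibleGamma g where
  alt : ω.IsAlt
  nondegenerate : ω.Nondegenerate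
  invariant : ∀ a b, a ≠ b → IsSkew ω (g a * g b)

variable {g : Fin 11 → Module.End ℝ S} {ω : LinearMap.BilinForm ℝ S}

theorem gammaList_eq_filter (l : List (Fin 11)) (I : Finset (Fin 11)) :
    gammaList g l I = ((l.filter (· ∈ I)).map g).prod := by
  induction l with
  | nil => simp [gammaList]
  | cons b l ih =>
    rw [gammaList_cons, ih]
    by_cases hb : b ∈ I <;> simp [hb]

theorem IsGamma.pair_mul_prod (hg : IsGamma g) {a b : Fin 11} (l : List (Fin 11)) (ha : a ∉ l)
    (hb : b ∉ l) : g a * g b * (l.map g).prod = (l.map g).prod * (g a * g b) := by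
  induction l with
  | nil => simp
  | cons c l ih =>
    simp only [List.mem_cons, not_or] at ha hb
    rw [List.map_cons, List.prod_cons, mul_assoc (g c), ← ih ha.2 hb.2, ← mul_assoc, ← mul_assoc]
    congr 1
    rw [mul_assoc, hg.anti b c hb.1, mul_neg, ← mul_assoc, hg.anti a c ha.1, neg_mul, neg_neg,
      mul_assoc]

/-- A product of 2k distinct gammas splits into k pairs. Each pair is skew and commutes with
products of gammas with other indices. -/
theorem IsSymplecticGamma.adjoint_prod (h : IsSymplecticGamma g ω) (k : ℕ) :
    ∀ l : List (Fin 11), l.Nodup → l.length = 2 * k → ∀ s t,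
      ω ((l.map g).prod s) t = (-1) ^ k * ω s ((l.map g).prod t) := by
  induction k with
  | zero =>
    intro l _ hl s t
    obtain rfl := List.length_eq_zero_iff.1 (by simpa using hl)
    simp
  | succ k ih =>
    intro l hn hl s t
    obtain ⟨a, l, rfl⟩ := List.exists_cons_of_length_pos (l := l) (by omega)
    obtain ⟨b, l, rfl⟩ := List.exists_cons_of_length_pos (l := l)
      (by rw [List.length_cons] at hl; omega)
    simp only [List.nodup_cons, List.mem_cons, not_or] at hn
    simp only [List.length_cons] at hl
    have e : ((a :: b :: l).map g).prod = g a * g b * (l.map g).prod := by simp [mul_assoc]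
    have h1 := h.invariant a b hn.1.1 ((l.map g).prod s) t
    have h2 := ih l hn.2.2 (by omega) s ((g a * g b) t)
    rw [e, Module.End.mul_apply, h1, h2, ← Module.End.mul_apply, ← h.pair_mul_prod l hn.1.2 hn.2.1,
      pow_succ]
    ring

theorem IsSymplecticGamma.adjoint_gamma (h : IsSymplecticGamma g ω) {I : Finset (Fin 11)}
    (hI : Even I.card) (s t : S) :
    ω (gamma g I s) t = (-1) ^ (I.card / 2) * ω s (gamma g I t) := by
  rw [gamma, gammaList_eq_filter]
  refine h.adjoint_prod _ _ ((List.nodup_finRange 11).filter _) ?_ s t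
  have : (List.filter (fun x => decide (x ∈ I)) (List.finRange 11)).length = I.card := by
    rw [← List.toFinset_card_of_nodup ((List.nodup_finRange 11).filter _)]
    congr 1
    ext i; simp
  rw [this]
  obtain ⟨k, hk⟩ := hI
  omega

/-- Only pairs are known to be skew, but g_a is up to sign a product of five pairs, and five is odd.
-/
theorem IsSymplecticGamma.skew (h : IsSymplecticGamma g ω) (a : Fin 11) : IsSkew ω (g a) := by
  intro s t
  obtain ⟨r, -, e⟩ := h.eq_smul_gamma_erase a
  rw [e, LinearMap.smul_apply, LinearMap.smul_apply, map_smul, map_smul, LinearMap.smul_apply,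
    h.adjoint_gamma (even_card_erase_univ a), card_erase_univ]
  simp; ring

/-- The index sets of the skew products of evenly many gamma matrices. -/
def skewSets : Finset (Finset (Fin 11)) := Finset.univ.filter fun I => I.card % 4 = 2

theorem mem_skewSets {I : Finset (Fin 11)} : I ∈ skewSets ↔ I.card % 4 = 2 := by simp [skewSets]

theorem even_of_mem_skewSets {I : Finset (Fin 11)} (h : I ∈ skewSets) : Even I.card := by
  rw [mem_skewSets] at h
  rw [Nat.even_iff]; omega

theorem IsSymplecticGamma.skew_gamma (h : IsSymplecticGamma g ω) {I : Finset (Fin 11)}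
    (hI : I ∈ skewSets) : IsSkew ω (gamma g I) := by
  intro s t
  rw [h.adjoint_gamma (even_of_mem_skewSets hI), Odd.neg_one_pow, neg_one_mul]
  rw [mem_skewSets] at hI
  rw [Nat.odd_iff]; omega

theorem IsSymplecticGamma.symm_gamma (h : IsSymplecticGamma g ω) {I : Finset (Fin 11)}
    (hI : I.card % 4 = 0) (s t : S) : ω (gamma g I s) t = ω s (gamma g I t) := by
  rw [h.adjoint_gamma (by rw [Nat.even_iff]; omega), Even.neg_one_pow, one_mul]
  rw [Nat.even_iff]; omega

theorem IsSymplecticGamma.anticomm (h : IsSymplecticGamma g ω) (s t : S) : ω s t = -ω t s :=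
  (h.alt.neg_eq s t).symm ▸ (neg_neg _).symm

theorem IsSymplecticGamma.apply_eq_zero (h : IsSymplecticGamma g ω) {M : Module.End ℝ S}
    (hM : ∀ s t, ω (M s) t = ω s (M t)) (s : S) : ω s (M s) = 0 := by
  have := h.anticomm s (M s)
  rw [hM] at this
  linarith

theorem IsSkew.comm {C : Module.End ℝ S} (hC : IsSkew ω C) (h : ω.IsAlt) (s t : S) :
    ω s (C t) = ω t (C s) := by
  rw [← h.neg_eq, hC, neg_neg]

theorem IsSymplecticGamma.ext_form (h : IsSymplecticGamma g ω) {s t : S}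
    (hst : ∀ u, ω s u = ω t u) : s = t := by
  have := h.finite
  exact (LinearMap.BilinForm.toDual ω h.nondegenerate).injective (LinearMap.ext fun u => by
    simpa [LinearMap.BilinForm.toDual_def] using hst u)

theorem IsSymplecticGamma.exists_form (h : IsSymplecticGamma g ω) (φ : Module.Dual ℝ S) :
    ∃ s, ∀ u, φ u = ω s u := by
  have := h.finite
  exact ⟨(LinearMap.BilinForm.toDual ω h.nondegenerate).symm φ, fun u => by
    rw [LinearMap.BilinForm.apply_toDual_symm_apply]⟩

theorem IsSymplecticGamma.exists_dual_basis (h : IsSymplecticGamma g ω) :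
    ∃ b d : Fin 32 → S, (∀ y, ∑ j, ω (d j) y • b j = y) ∧ ∀ y, ∑ j, ω y (b j) • d j = y := by
  have := h.finite
  let b := Module.finBasisOfFinrankEq ℝ S h.finrank_eq
  choose d hd using fun j => h.exists_form (b.coord j)
  have h1 : ∀ y, ∑ j, ω (d j) y • b j = y := fun y => by
    simp_rw [← hd]; exact b.sum_repr y
  refine ⟨b, d, h1, fun y => h.ext_form fun z => ?_⟩
  conv_rhs => rw [← h1 z]
  simp only [map_sum, LinearMap.sum_apply, map_smul, LinearMap.smul_apply, smul_eq_mul]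
  exact Finset.sum_congr rfl fun j _ => mul_comm _ _

/-- A linear map on endomorphisms that vanishes on all `⟨s, -⟩ s` vanishes on skew
endomorphisms. -/
theorem IsSymplecticGamma.eq_zero_of_skew (h : IsSymplecticGamma g ω) {W : Type*}
    [AddCommGroup W] [Module ℝ W] {L : Module.End ℝ S →ₗ[ℝ] W}
    (hL : ∀ s, L ((ω s).smulRight s) = 0) {C : Module.End ℝ S} (hC : IsSkew ω C) : L C = 0 := by
  obtain ⟨b, d, h1, h2⟩ := h.exists_dual_basis
  have hp : ∀ s t, L ((ω s).smulRight t + (ω t).smulRight s) = 0 := fun s t => by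
    have e : (ω s).smulRight t + (ω t).smulRight s = (ω (s + t)).smulRight (s + t) -
        (ω s).smulRight s - (ω t).smulRight t := by
      ext x
      simp only [LinearMap.add_apply, LinearMap.sub_apply, LinearMap.smulRight_apply, map_add]
      module
    rw [e, map_sub, map_sub, hL, hL, hL]; simp
  -- Both halves equal C: the first expands the argument in the dual bases, the second expands the
  -- value and then uses skewness. Together they are a sum of symmetrised rank one operators, on
  -- which L vanishes by polarisation.
  have e : (2 : ℝ) • C = ∑ j, ((ω (d j)).smulRight (C (b j)) + (ω (C (b j))).smulRight (d j)) := by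
    ext x
    rw [Finset.sum_add_distrib, LinearMap.add_apply, LinearMap.sum_apply, LinearMap.sum_apply]
    have e1 : ∑ j, ((ω (d j)).smulRight (C (b j))) x = C x := by
      conv_rhs => rw [← h1 x, map_sum]
      simp
    have e2 : ∑ j, ((ω (C (b j))).smulRight (d j)) x = C x := by
      conv_rhs => rw [← h2 (C x)]
      refine Finset.sum_congr rfl fun j _ => ?_
      rw [LinearMap.smulRight_apply, hC, h.anticomm (C x)]
    rw [e1, e2, LinearMap.smul_apply, two_smul]
  have := congrArg L e
  rw [map_sum, Finset.sum_congr rfl fun j _ => hp _ _, Finset.sum_const_zero, map_smul] at this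
  exact (smul_eq_zero.1 this).resolve_left (by norm_num)

/-- In the Fierz expansion the coefficient ⟨s, γ_I s⟩ vanishes when γ_I is symmetric. What remains
are 55 + 462 + 11 = 528 = dim Sym² S index sets. -/
theorem IsSymplecticGamma.rankOne_eq_sum (h : IsSymplecticGamma g ω) (s : S) :
    (ω s).smulRight s =
      ∑ I ∈ skewSets, (1 / 32 * (gammaSign I * ω s (gamma g I s))) • gamma g I := by
  rw [h.smulRight_eq_sum]
  refine (Finset.sum_subset (fun I hI => mem_evenSets.2 (even_of_mem_skewSets hI))
    fun I hI hI' => ?_).symm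
  rw [mem_evenSets, Nat.even_iff] at hI
  rw [mem_skewSets] at hI'
  rw [h.apply_eq_zero (h.symm_gamma (by omega))]
  simp

/-- Together with `eq_zero_of_skew`, this makes a quadratic identity in s equivalent to its values
at the finitely many skew γ_K. -/
theorem IsSymplecticGamma.eq_zero_of_gamma (h : IsSymplecticGamma g ω) {W : Type*}
    [AddCommGroup W] [Module ℝ W] {L : Module.End ℝ S →ₗ[ℝ] W}
    (hL : ∀ I ∈ skewSets, L (gamma g I) = 0) (s : S) : L ((ω s).smulRight s) = 0 := by
  rw [h.rankOne_eq_sum, map_sum]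
  exact Finset.sum_eq_zero fun I hI => by rw [map_smul, hL I hI, smul_zero]

/-- Bilinear maps on `S` as linear maps on endomorphisms. -/
theorem IsSymplecticGamma.exists_linear (h : IsSymplecticGamma g ω) {W : Type*}
    [AddCommGroup W] [Module ℝ W] (c : S →ₗ[ℝ] S →ₗ[ℝ] W) :
    ∃ L : Module.End ℝ S →ₗ[ℝ] W, ∀ s t, L ((ω s).smulRight t) = c s t := by
  obtain ⟨b, d, h1, h2⟩ := h.exists_dual_basis
  refine ⟨∑ j, c (d j) ∘ₗ LinearMap.applyₗ (b j), fun s t => ?_⟩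
  simp only [LinearMap.sum_apply, LinearMap.comp_apply, LinearMap.applyₗ_apply_apply,
    LinearMap.smulRight_apply, map_smul]
  conv_rhs => rw [← h2 s]
  simp [map_sum, LinearMap.sum_apply]

end SymplecticGamma

/-! ### Clifford multiplication and the spin representation in terms of gamma matrices -/

section SpinGamma

variable {V : Type u} [AddCommGroup V] [Module ℝ V] (η : LorentzForm V)
variable (S : Type w) [AddCommGroup S] [Module ℝ S] [Module (Cl η) S] [IsScalarTower ℝ (Cl η) S]

/-- Clifford multiplication by the vectors of the orthonormal basis. -/
def gam (a : Fin 11) : Module.End ℝ S := cliff η S (η.basis a)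

/-- The element of `so(V)` given by an `η`-skew endomorphism. -/
def soOfSkew (f : Module.End ℝ V) (hf : ∀ v x, η.form (f v) x = -η.form v (f x)) : So η :=
  ⟨f, fun v x => by
    change η.form (f v) x = (-η.form) v (f x)
    rw [hf]; rfl⟩

theorem vec_soOfSkew (f : Module.End ℝ V) (hf : ∀ v x, η.form (f v) x = -η.form v (f x)) :
    vec η (soOfSkew η f hf) = f := rfl

variable {η} in
theorem So.ext_vec {A B : So η} (h : vec η A = vec η B) : A = B := Subtype.ext h

/-- The element `v ↦ η(x,v) y - η(y,v) x` of `so(V)`. -/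
def rotation (x y : V) : So η :=
  soOfSkew η ((η.form x).smulRight y - (η.form y).smulRight x) fun v z => by
    simp only [LinearMap.sub_apply, LinearMap.smulRight_apply, map_sub, map_smul,
      LinearMap.smul_apply, smul_eq_mul]
    rw [η.symm v x, η.symm v y]; ring

theorem vec_rotation (x y v : V) :
    vec η (rotation η x y) v = η.form x v • y - η.form y v • x := rfl

theorem cliff_eq_sum (v : V) :
    cliff η S v = ∑ c, (sgn c * η.form (η.basis c) v) • gam η S c := by
  conv_lhs => rw [η.expand v]
  simp [map_sum, gam]

theorem spin_eq_sum (A : So η) : spin η S A = (1 / 4 : ℝ) • ∑ i, ∑ c,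
    (sgn i * sgn c * η.form (η.basis c) (vec η A (η.basis i))) • (gam η S i * gam η S c) := by
  change spinLin η S A = _
  simp only [spinLin, LinearMap.coe_mk, AddHom.coe_mk]
  congr 1
  refine Finset.sum_congr rfl fun i _ => ?_
  rw [cliff_eq_sum η S (vec η A (η.basis i)), Finset.mul_sum, Finset.smul_sum]
  refine Finset.sum_congr rfl fun c _ => ?_
  rw [mul_smul_comm, smul_smul, mul_assoc]; rfl

theorem isGamma_gam : IsGamma (gam η S) where
  sq a := by
    have h := cliff_anticomm η S (η.basis a) (η.basis a)
    rw [η.basis_spec, if_pos rfl] at h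
    have h2 : (2 : ℝ) • (gam η S a * gam η S a) = (2 : ℝ) • (-sgn a) • 1 := by
      rw [two_smul]
      change cliff η S (η.basis a) * cliff η S (η.basis a) +
        cliff η S (η.basis a) * cliff η S (η.basis a) = _
      nth_rewrite 1 [h]
      module
    exact smul_right_injective _ (two_ne_zero (α := ℝ)) h2
  anti a b hab := by
    have h := cliff_anticomm η S (η.basis a) (η.basis b)
    rw [η.basis_spec, if_neg hab] at h
    simpa [gam] using h

/-- Only i = a and i = b contribute to ¼ ∑ eⁱ · A(eᵢ), and they contribute equally by
anticommutation. -/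
theorem spin_rotation {a b : Fin 11} (hab : a ≠ b) :
    spin η S (rotation η (η.basis a) (η.basis b)) = (1 / 2 : ℝ) • (gam η S a * gam η S b) := by
  change spinLin η S _ = _
  simp only [spinLin, LinearMap.coe_mk, AddHom.coe_mk]
  have : ∀ i, sgn i • (cliff η S (η.basis i) * cliff η S
      (vec η (rotation η (η.basis a) (η.basis b)) (η.basis i))) =
      (if a = i then gam η S a * gam η S b else 0) -
      (if b = i then gam η S b * gam η S a else 0) := by
    intro i
    rw [vec_rotation, η.basis_spec, η.basis_spec]
    by_cases h1 : a = i
    · subst h1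
      rw [if_pos rfl, if_neg (Ne.symm hab), if_pos rfl, if_neg (Ne.symm hab)]
      simp only [zero_smul, sub_zero, map_smul, mul_smul_comm, (isSign_sgn a).smul_smul]
      rfl
    · by_cases h2 : b = i
      · subst h2
        rw [if_neg h1, if_pos rfl, if_neg h1, if_pos rfl]
        simp only [zero_smul, zero_sub, map_smul, map_neg, mul_neg, smul_neg, mul_smul_comm,
          (isSign_sgn b).smul_smul]
        rfl
      · simp [h1, h2]
  rw [Finset.sum_congr rfl fun i _ => this i, Finset.sum_sub_distrib, Finset.sum_ite_eq,
    Finset.sum_ite_eq, (isGamma_gam η S).anti b a (Ne.symm hab)]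
  simp only [Finset.mem_univ, if_true]
  module

theorem isIrreducibleGamma_gam [IsSimpleModule (Cl η) S] : IsIrreducibleGamma (gam η S) where
  toIsGamma := isGamma_gam η S
  nontrivial := IsSimpleModule.nontrivial (Cl η) S
  irreducible U hU := by
    have h1 : ∀ v, ∀ s ∈ U, CliffordAlgebra.ι η.cliffordForm v • s ∈ U := by
      intro v s hs
      rw [← cliff_apply, cliff_eq_sum, LinearMap.sum_apply]
      exact sum_mem fun c _ => Submodule.smul_mem _ _ (hU c s hs)
    have h2 : ∀ x : Cl η, ∀ s ∈ U, x • s ∈ U := by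
      intro x
      induction x using CliffordAlgebra.induction with
      | algebraMap r => intro s hs; rw [algebraMap_smul]; exact Submodule.smul_mem _ _ hs
      | ι v => exact h1 v
      | mul x y hx hy => intro s hs; rw [mul_smul]; exact hx _ (hy _ hs)
      | add x y hx hy => intro s hs; rw [add_smul]; exact add_mem (hx _ hs) (hy _ hs)
    let U' : Submodule (Cl η) S :=
      { U with smul_mem' := fun x s hs => h2 x s hs }
    rcases eq_bot_or_eq_top U' with h | h
    · left
      refine (Submodule.eq_bot_iff _).2 fun s hs => ?_
      have : s ∈ U' := hs
      rw [h] at this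
      exact (Submodule.mem_bot _).1 this
    · right
      refine Submodule.eq_top_iff'.2 fun s => ?_
      have : s ∈ U' := by rw [h]; trivial
      exact this

variable {η S} (ω : SpinSymplectic η S)

theorem isSymplecticGamma_gam [IsSimpleModule (Cl η) S] :
    IsSymplecticGamma (gam η S) ω.form where
  toIsIrreducibleGamma := isIrreducibleGamma_gam η S
  alt := ω.alt
  nondegenerate := ω.nondegenerate
  invariant a b hab s t := by
    have h := ω.invariant (rotation η (η.basis a) (η.basis b)) s t
    rw [spin_rotation η S hab] at h
    simp only [LinearMap.smul_apply, map_smul, smul_eq_mul] at h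
    linarith

theorem skew_cliff [IsSimpleModule (Cl η) S] (v : V) : IsSkew ω.form (cliff η S v) := by
  intro s t
  rw [cliff_eq_sum]
  simp only [LinearMap.sum_apply, LinearMap.smul_apply, map_sum, map_smul, smul_eq_mul,
    ← Finset.sum_neg_distrib]
  refine Finset.sum_congr rfl fun c _ => ?_
  rw [(isSymplecticGamma_gam ω).skew c s t]; ring

/-- Clifford multiplication is skew, so ⟨s, v · t⟩ is already symmetric in s and t and the two
halves of the polarised current agree. -/
theorem form_dirac [IsSimpleModule (Cl η) S] (s t : S) (v : V) :
    η.form (dirac ω s t) v = ω.form s (cliff η S v t) := by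
  rw [dirac_polar, (skew_cliff ω v).comm ω.alt t s]; ring

theorem form_basis_dirac [IsSimpleModule (Cl η) S] (s t : S) (a : Fin 11) :
    η.form (η.basis a) (dirac ω s t) = ω.form s (gam η S a t) := by
  rw [η.symm, form_dirac]; rfl

theorem dirac_eq_sum [IsSimpleModule (Cl η) S] (s t : S) :
    dirac ω s t = ∑ a, (sgn a * ω.form s (gam η S a t)) • η.basis a := by
  conv_lhs => rw [η.expand (dirac ω s t)]
  simp only [form_basis_dirac]

theorem cliff_eq_zero [IsSimpleModule (Cl η) S] {v : V} (h : cliff η S v = 0) : v = 0 := by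
  refine LorentzForm.ext_form (η := η) fun x => ?_
  have := cliff_anticomm η S v x
  rw [h] at this
  obtain ⟨s, hs⟩ := @exists_ne S (isIrreducibleGamma_gam η S).nontrivial 0
  have h2 := congrArg (fun f : Module.End ℝ S => f s) this
  simp only [zero_mul, mul_zero, neg_zero, zero_sub, LinearMap.zero_apply, LinearMap.neg_apply,
    LinearMap.smul_apply, Module.End.one_apply] at h2
  rw [eq_comm, neg_eq_zero, smul_eq_zero] at h2
  rw [map_zero, LinearMap.zero_apply]
  linarith [h2.resolve_right hs]

/-- If A acts as zero then (A v)· = [A, v·] = 0, and multiplication by a nonzero vector is not zero.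
-/
theorem so_eq_zero_of_spin [IsSimpleModule (Cl η) S] {A : So η} (h : spin η S A = 0) : A = 0 := by
  refine So.ext_vec ?_
  rw [map_zero]
  refine LinearMap.ext fun v => cliff_eq_zero (η := η) (S := S) ?_
  have := spinLin_cliff η S A v
  rw [← this, show spinLin η S A = 0 from h]; simp

/-- The rotations act by ½ g_a g_b, and each g_a is up to sign a product of five such pairs. An
so(V)-invariant subspace is therefore Clifford-invariant. -/
theorem isIrreducibleRep_spin [IsSimpleModule (Cl η) S] : IsIrreducibleRep (spin η S) := by
  have hg := isIrreducibleGamma_gam η S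
  refine ⟨hg.nontrivial, fun U hU => ?_⟩
  have h2 : ∀ a b, a ≠ b → ∀ s ∈ U, (gam η S a * gam η S b) s ∈ U := by
    intro a b hab s hs
    have := Submodule.smul_mem U (2 : ℝ) (hU (rotation η (η.basis a) (η.basis b)) s hs)
    rw [spin_rotation η S hab, LinearMap.smul_apply, smul_smul] at this
    norm_num at this
    exact this
  have h3 : ∀ k : ℕ, ∀ l : List (Fin 11), l.Nodup → l.length = 2 * k → ∀ s ∈ U,
      (l.map (gam η S)).prod s ∈ U := by
    intro k
    induction k with
    | zero =>
      intro l _ hl s hs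
      obtain rfl := List.length_eq_zero_iff.1 (by simpa using hl)
      simpa using hs
    | succ k ih =>
      intro l hn hl s hs
      obtain ⟨a, l, rfl⟩ := List.exists_cons_of_length_pos (l := l) (by omega)
      obtain ⟨b, l, rfl⟩ := List.exists_cons_of_length_pos (l := l)
        (by rw [List.length_cons] at hl; omega)
      simp only [List.nodup_cons, List.mem_cons, not_or] at hn
      simp only [List.length_cons] at hl
      have e : ((a :: b :: l).map (gam η S)).prod =
          gam η S a * gam η S b * (l.map (gam η S)).prod := by simp [mul_assoc]
      rw [e, Module.End.mul_apply]
      exact h2 a b hn.1.1 _ (ih l hn.2.2 (by omega) s hs)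
  refine hg.irreducible U fun a s hs => ?_
  obtain ⟨r, -, e⟩ := hg.eq_smul_gamma_erase a
  rw [e, LinearMap.smul_apply, gamma, gammaList_eq_filter]
  refine Submodule.smul_mem _ _ (h3 5 _ ((List.nodup_finRange 11).filter _) ?_ s hs)
  rw [← List.toFinset_card_of_nodup ((List.nodup_finRange 11).filter _)]
  refine Eq.trans ?_ (card_erase_univ a)
  congr 1
  ext i; simp

end SpinGamma

/-! ### Components of cochains on S ⊕ V -/

section Cochains

variable {V : Type u} [AddCommGroup V] [Module ℝ V] {S : Type w} [AddCommGroup S] [Module ℝ S]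
variable {W : Type*} [AddCommGroup W] [Module ℝ W]

/-- The `2`-cochain on `m = S ⊕ V` with given components. -/
def cochain (a : S →ₗ[ℝ] S →ₗ[ℝ] W) (b : S →ₗ[ℝ] V →ₗ[ℝ] W) (c : V →ₗ[ℝ] V →ₗ[ℝ] W) :
    S × V →ₗ[ℝ] S × V →ₗ[ℝ] W :=
  a.compl₁₂ (LinearMap.fst ℝ S V) (LinearMap.fst ℝ S V) +
    b.compl₁₂ (LinearMap.fst ℝ S V) (LinearMap.snd ℝ S V) -
    b.flip.compl₁₂ (LinearMap.snd ℝ S V) (LinearMap.fst ℝ S V) +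
    c.compl₁₂ (LinearMap.snd ℝ S V) (LinearMap.snd ℝ S V)

theorem cochain_apply (a : S →ₗ[ℝ] S →ₗ[ℝ] W) (b : S →ₗ[ℝ] V →ₗ[ℝ] W)
    (c : V →ₗ[ℝ] V →ₗ[ℝ] W) (x y : S × V) :
    cochain a b c x y = a x.1 y.1 + b x.1 y.2 - b y.1 x.2 + c x.2 y.2 := rfl

theorem eps_ss : eps (-1 * -1) = -1 := by rw [show (-1 * -1 : ℤ) = 1 by norm_num, eps_one]
theorem eps_sv : eps (-1 * -2) = 1 := by rw [show (-1 * -2 : ℤ) = 2 by norm_num, eps_two]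
theorem eps_vs : eps (-2 * -1) = 1 := by rw [show (-2 * -1 : ℤ) = 2 by norm_num, eps_two]
theorem eps_vv : eps (-2 * -2) = 1 := by rw [show (-2 * -2 : ℤ) = 4 by norm_num, eps_four]

theorem C₂_symm {gr : ℤ → Submodule ℝ W} {d : ℤ} {c : S × V →ₗ[ℝ] S × V →ₗ[ℝ] W}
    (hc : c ∈ C₂ gr d) (s t : S) : c (s, 0) (t, 0) = c (t, 0) (s, 0) := by
  have := (hc _ _ _ (mGrade_left s) _ (mGrade_left t)).1
  rw [eps_ss] at this
  simpa using this.symm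

theorem C₂_skew_left {gr : ℤ → Submodule ℝ W} {d : ℤ} {c : S × V →ₗ[ℝ] S × V →ₗ[ℝ] W}
    (hc : c ∈ C₂ gr d) (s : S) (v : V) : c (0, v) (s, 0) = -c (s, 0) (0, v) := by
  have := (hc _ _ _ (mGrade_left s) _ (mGrade_right v)).1
  rw [eps_sv] at this
  simpa using this

theorem C₂_skew {gr : ℤ → Submodule ℝ W} {d : ℤ} {c : S × V →ₗ[ℝ] S × V →ₗ[ℝ] W}
    (hc : c ∈ C₂ gr d) (v x : V) : c (0, v) (0, x) = -c (0, x) (0, v) := by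
  have := (hc _ _ _ (mGrade_right x) _ (mGrade_right v)).1
  rw [eps_vv] at this
  simpa using this

theorem C₂_ext {gr : ℤ → Submodule ℝ W} {d : ℤ} {c c' : S × V →ₗ[ℝ] S × V →ₗ[ℝ] W}
    (hc : c ∈ C₂ gr d) (hc' : c' ∈ C₂ gr d) (h1 : ∀ s t, c (s, 0) (t, 0) = c' (s, 0) (t, 0))
    (h2 : ∀ s v, c (s, 0) (0, v) = c' (s, 0) (0, v))
    (h3 : ∀ v x, c (0, v) (0, x) = c' (0, v) (0, x)) : c = c' :=
  ext_m (fun s => ext_m (h1 s) (h2 s))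
    (fun v => ext_m (fun t => by rw [C₂_skew_left hc, C₂_skew_left hc', h2]) (h3 v))

end Cochains

/-! ### Traces against a single gamma matrix, and injectivity -/

section GammaTraces

variable {S : Type*} [AddCommGroup S] [Module ℝ S]
variable {g : Fin 11 → Module.End ℝ S}

/-- Up to sign g_a is itself an even product, over the complement of a, and distinct even products
are trace-orthogonal. So tr(g_a ·) detects exactly one ten-element set. -/
theorem IsIrreducibleGamma.trace_mul_gamma (hg : IsIrreducibleGamma g) {K : Finset (Fin 11)}
    (hK : Even K.card) {a : Fin 11} (h : K ≠ Finset.univ.erase a) :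
    LinearMap.trace ℝ S (g a * gamma g K) = 0 := by
  obtain ⟨r, -, e⟩ := hg.eq_smul_gamma_erase a
  rw [e, smul_mul_assoc, map_smul, hg.trace_gamma_mul_gamma (even_card_erase_univ a) hK,
    if_neg (Ne.symm h), smul_zero]

theorem IsIrreducibleGamma.trace_mul_gamma_erase (hg : IsIrreducibleGamma g) (a : Fin 11) :
    LinearMap.trace ℝ S (g a * gamma g (Finset.univ.erase a)) ≠ 0 := by
  obtain ⟨r, hr, e⟩ := hg.eq_smul_gamma_erase a
  rw [e, smul_mul_assoc, map_smul, hg.trace_gamma_mul_gamma (even_card_erase_univ a)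
    (even_card_erase_univ a), if_pos rfl, smul_eq_mul]
  exact mul_ne_zero hr.ne_zero (mul_ne_zero (by norm_num) (isSign_gammaSign _).ne_zero)

theorem trace_mul_rankOne [Module.Finite ℝ S] (ω : LinearMap.BilinForm ℝ S) (A : Module.End ℝ S)
    (s : S) : LinearMap.trace ℝ S (A * (ω s).smulRight s) = ω s (A s) := by
  have : A * (ω s).smulRight s = (ω s).smulRight (A s) := by ext; simp
  rw [this, LinearMap.trace_smulRight]

theorem erase_univ_injective {a b : Fin 11} (h : Finset.univ.erase a = Finset.univ.erase b) :
    a = b := by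
  by_contra hab
  have : a ∈ Finset.univ.erase b := by simp [hab]
  rw [← h] at this
  simp at this

theorem IsGamma.pair_sq (hg : IsGamma g) {a b : Fin 11} (hab : a ≠ b) :
    g a * g b * (g a * g b) = (-(sgn a * sgn b)) • 1 := by
  rw [mul_assoc, ← mul_assoc (g b), hg.anti b a (Ne.symm hab), neg_mul, mul_neg, mul_assoc (g a),
    hg.sq, mul_smul_comm, mul_one, mul_smul_comm, hg.sq]
  module

theorem IsGamma.pair_mul_gamma (hg : IsGamma g) {K : Finset (Fin 11)} (hK : Even K.card)
    (a b : Fin 11) :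
    g a * g b * gamma g K = (chi K a * chi K b) • (gamma g K * (g a * g b)) := by
  rw [mul_assoc, hg.mul_gamma_even hK, mul_smul_comm, ← mul_assoc, hg.mul_gamma_even hK,
    smul_mul_assoc, smul_smul, mul_assoc, mul_comm]

theorem IsGamma.gamma_injective (hg : IsGamma g) (I : Finset (Fin 11)) {s t : S}
    (h : gamma g I s = gamma g I t) : s = t := by
  have h2 : ∀ u, gammaSign I • gamma g I (gamma g I u) = u := fun u => by
    rw [← Module.End.mul_apply, hg.gamma_sq, LinearMap.smul_apply, (isSign_gammaSign I).smul_smul]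
    rfl
  rw [← h2 s, h, h2]

theorem IsGamma.injective (hg : IsGamma g) (a : Fin 11) {s t : S} (h : g a s = g a t) : s = t := by
  have h2 : ∀ u, (-sgn a) • g a (g a u) = u := fun u => by
    rw [← Module.End.mul_apply, hg.sq, LinearMap.smul_apply, (isSign_sgn a).neg.smul_smul]
    rfl
  rw [← h2 s, h, h2]

end GammaTraces

/-! ### A symmetric function on pairs with vanishing signed sums -/

section EdgeSums

variable {M : Type*} [AddCommGroup M] [Module ℝ M]

theorem chi_pair {p q : Fin 11} (hpq : p ≠ q) (i : Fin 11) :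
    chi {p, q} i = 1 - 2 * ((if p = i then 1 else 0) + if q = i then 1 else 0) := by
  unfold chi
  by_cases h1 : p = i
  · subst h1; simp [Ne.symm hpq]; norm_num
  · by_cases h2 : q = i
    · subst h2; simp [hpq]; norm_num
    · simp [h1, h2, Ne.symm h1, Ne.symm h2]

/-- A symmetric function on pairs whose signed sums for all two-element sets vanish is zero. -/
theorem eq_zero_of_signed_sums {m : Fin 11 → Fin 11 → M} (hm : ∀ i c, m i c = m c i)
    (h0 : ∀ i, m i i = 0) (h : ∀ p q, p ≠ q →
      ∑ i, ∑ c, (chi {p, q} i * chi {p, q} c) • m i c = 0) (i c : Fin 11) : m i c = 0 := by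
  set D : Fin 11 → M := fun i => ∑ c, m i c with hD
  set T : M := ∑ i, D i with hT
  -- Here χ(i) = 1 − 2(δ_p + δ_q) is substituted in both factors. D is the sum over one index and T
  -- the total sum.
  have e1 : ∀ p q, p ≠ q → T - (4 : ℝ) • D p - (4 : ℝ) • D q + (8 : ℝ) • m p q = 0 := by
    intro p q hpq
    rw [← h p q hpq]
    have r1 : ∀ i, ∑ c, (chi {p, q} i * chi {p, q} c) • m i c =
        chi {p, q} i • (D i - (2 : ℝ) • m i p - (2 : ℝ) • m i q) := by
      intro i
      simp only [mul_smul, ← Finset.smul_sum, chi_pair hpq _]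
      congr 1
      simp only [sub_smul, one_smul, mul_smul, add_smul, ite_smul, zero_smul,
        Finset.sum_sub_distrib, ← Finset.smul_sum, Finset.sum_add_distrib, Finset.sum_ite_eq,
        Finset.mem_univ, if_true, hD]
      module
    rw [Finset.sum_congr rfl fun i _ => r1 i]
    simp only [chi_pair hpq, sub_smul, one_smul, mul_smul, add_smul, ite_smul, zero_smul,
        Finset.sum_sub_distrib, ← Finset.smul_sum, Finset.sum_add_distrib, Finset.sum_ite_eq,
        Finset.mem_univ, if_true, h0]
    have s1 : ∀ p, ∑ i, m i p = D p := fun p => Finset.sum_congr rfl fun i _ => hm i p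
    rw [s1, s1, hm q p, ← hT]
    module
  -- Sum of `e1` over q. The term q = p is not covered by `e1`; it equals T − 8 D p because m
  -- vanishes on the diagonal.
  have e2 : ∀ p, (6 : ℝ) • T = (28 : ℝ) • D p := by
    intro p
    have h1 : ∑ q, (T - (4 : ℝ) • D p - (4 : ℝ) • D q + (8 : ℝ) • m p q) =
        T - (8 : ℝ) • D p := by
      rw [Finset.sum_eq_single p]
      · rw [h0]; module
      · intro q _ hq; exact e1 p q (Ne.symm hq)
      · simp
    rw [Finset.sum_add_distrib, Finset.sum_sub_distrib, Finset.sum_sub_distrib, Finset.sum_const,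
      Finset.sum_const, ← Finset.smul_sum, ← Finset.smul_sum, ← hT, Finset.card_univ,
      Fintype.card_fin] at h1
    have h2 : ∑ c, m p c = D p := rfl
    rw [h2] at h1
    have h3 : (6 : ℝ) • T - (28 : ℝ) • D p = (11 • T - 11 • (4 : ℝ) • D p - (4 : ℝ) • T +
      (8 : ℝ) • D p) - (T - (8 : ℝ) • D p) := by module
    rw [← sub_eq_zero, h3, h1, sub_self]
  -- Summing `e2` over the eleven p gives 66 T = 28 T.
  have e3 : T = 0 := by
    have h1 : ∑ _p : Fin 11, (6 : ℝ) • T = ∑ p, (28 : ℝ) • D p :=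
      Finset.sum_congr rfl fun p _ => e2 p
    rw [Finset.sum_const, ← Finset.smul_sum, ← hT, Finset.card_univ, Fintype.card_fin] at h1
    have h2 : (38 : ℝ) • T = 11 • (6 : ℝ) • T - (28 : ℝ) • T := by module
    rw [h1, sub_self] at h2
    exact (smul_eq_zero.1 h2).resolve_left (by norm_num)
  have e4 : ∀ p, D p = 0 := fun p => by
    have := e2 p
    rw [e3, smul_zero, eq_comm] at this
    exact (smul_eq_zero.1 this).resolve_left (by norm_num)
  by_cases hic : i = c
  · rw [hic, h0]
  · have := e1 i c hic
    rw [e3, e4, e4] at this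
    simpa using this

end EdgeSums

/-! ### Vanishing in degrees at least 3 -/

section HighDegrees

set_option linter.unusedSectionVars false

variable {V : Type u} [AddCommGroup V] [Module ℝ V] {η : LorentzForm V}
variable {S : Type w} [AddCommGroup S] [Module ℝ S] [Module (Cl η) S] [IsScalarTower ℝ (Cl η) S]
variable (ω : SpinSymplectic η S)

theorem eq_zero_of_mem_grade {k : ℤ} (hk : 0 < k) {x : Poincare η S} (hx : x ∈ grade η S k) :
    x = 0 :=
  Prod.ext (hx.1 (by omega)) (Prod.ext (hx.2.1 (by omega)) (hx.2.2 (by omega)))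

/-- Two arguments have total degree at least −4, so all values lie in positive degree. -/
theorem C₂_eq_bot {d : ℤ} (hd : 5 ≤ d) : C₂ (S := S) (V := V) (grade η S) d = ⊥ := by
  refine (Submodule.eq_bot_iff _).2 fun c hc => C₂_ext hc (zero_mem _) (fun s t => ?_)
    (fun s v => ?_) (fun v x => ?_)
  · exact eq_zero_of_mem_grade (by omega) (hc _ _ _ (mGrade_left s) _ (mGrade_left t)).2
  · exact eq_zero_of_mem_grade (by omega) (hc _ _ _ (mGrade_left s) _ (mGrade_right v)).2
  · exact eq_zero_of_mem_grade (by omega) (hc _ _ _ (mGrade_right v) _ (mGrade_right x)).2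

theorem subsingleton_H₂ {d : ℤ} (h : ∀ z ∈ Z₂ ω d, z = 0) : Subsingleton (H₂ ω d) := by
  refine ⟨fun x y => ?_⟩
  obtain ⟨x, rfl⟩ := cls_surjective ω d x
  obtain ⟨y, rfl⟩ := cls_surjective ω d y
  rw [Subtype.ext ((h x x.2).trans (h y y.2).symm)]

theorem subsingleton_H₂_of_le {d : ℤ} (hd : 5 ≤ d) : Subsingleton (H₂ ω d) :=
  subsingleton_H₂ ω fun z hz => by
    have := hz.1
    rw [C₂_eq_bot hd] at this
    exact (Submodule.mem_bot _).1 this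

theorem mem_grade_zero {x : Poincare η S} (hx : x ∈ grade η S 0) : x = (x.1, 0, 0) :=
  Prod.ext rfl (Prod.ext (hx.2.1 (by decide)) (hx.2.2 (by decide)))

theorem mem_grade_neg_one {x : Poincare η S} (hx : x ∈ grade η S (-1)) : x = (0, x.2.1, 0) :=
  Prod.ext (hx.1 (by decide)) (Prod.ext rfl (hx.2.2 (by decide)))

theorem mem_grade_neg_two {x : Poincare η S} (hx : x ∈ grade η S (-2)) : x = (0, 0, x.2.2) :=
  Prod.ext (hx.1 (by decide)) (Prod.ext (hx.2.1 (by decide)) rfl)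

/-- Only the component V × V → so(V) has a nonzero target. The cocycle condition on S × V × V says
that its values annihilate S, and the spin representation is faithful. -/
theorem subsingleton_H₂_four [IsSimpleModule (Cl η) S] : Subsingleton (H₂ ω 4) := by
  refine subsingleton_H₂ ω fun c hc => C₂_ext hc.1 (zero_mem _) (fun s t => ?_)
    (fun s v => ?_) (fun v x => ?_)
  · exact eq_zero_of_mem_grade (by omega) (hc.1 _ _ _ (mGrade_left s) _ (mGrade_left t)).2
  · exact eq_zero_of_mem_grade (by omega) (hc.1 _ _ _ (mGrade_left s) _ (mGrade_right v)).2
  · have h0 : ∀ s v, c (s, 0) (0, v) = 0 := fun s v =>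
      eq_zero_of_mem_grade (by omega) (hc.1 _ _ _ (mGrade_left s) _ (mGrade_right v)).2
    have hg := mem_grade_zero (hc.1 _ _ _ (mGrade_right v) _ (mGrade_right x)).2
    rw [hg]
    have : (c (0, v) (0, x)).1 = 0 := by
      refine so_eq_zero_of_spin (S := S) (LinearMap.ext fun s => ?_)
      have h := d₂_homog (mBracket ω) (adj ω) 4 c (Or.inl rfl) (Or.inr rfl) (Or.inr rfl)
        (mGrade_left s) (mGrade_right v) (mGrade_right x)
      rw [show d₂ (mBracket ω) (adj ω) 4 c = 0 from hc.2, h0, h0, hg] at h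
      have h1 := congrArg (fun p : Poincare η S => p.2.1) h
      have h4 : c (0, 0) = 0 := map_zero c
      have h5 : ∀ x, c x (0, 0) = 0 := fun x => map_zero (c x)
      rcases eps_cases (-1 * 4) with h2 | h2 <;> rw [h2] at h1 <;>
        simpa [adj_apply, mBracket_apply, h4, h5] using h1.symm
    rw [this]; rfl

/-- The first component of the Spencer differential on `1`-cochains of degree `1` is injective. -/
theorem eq_zero_of_spin_eq_dirac [IsSimpleModule (Cl η) S] (μ : S →ₗ[ℝ] So η) (l : V →ₗ[ℝ] S)
    (h : ∀ s, (2 : ℝ) • spin η S (μ s) s = l (dirac ω s s)) : μ = 0 ∧ l = 0 := by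
  have hg := isSymplecticGamma_gam ω
  have := hg.finite
  set g := gam η S
  -- The matrix coefficients of μ(s) are linear in s, hence represented by spinors.
  have hψ : ∀ i c, ∃ ψ : S, ∀ s, η.form (η.basis c) (vec η (μ s) (η.basis i)) = ω.form ψ s := by
    intro i c
    exact hg.exists_form (η.form (η.basis c) ∘ₗ LinearMap.applyₗ (η.basis i) ∘ₗ
      (vec η : So η →ₗ[ℝ] Module.End ℝ V) ∘ₗ μ)
  choose ψ hψ using hψ
  have hanti : ∀ i c, ψ i c = -ψ c i := fun i c => hg.ext_form fun s => by
    rw [map_neg, LinearMap.neg_apply, ← hψ, ← hψ, η.symm, So.skew]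
  -- The equation at s is L(⟨s,-⟩s) = 0, so it may be tested on the skew γ_K.
  let L : Module.End ℝ S →ₗ[ℝ] S := ∑ i, ∑ c, (sgn i * sgn c) • ((g i * g c) ∘ₗ
    LinearMap.applyₗ (ψ i c)) + ∑ a, (2 * sgn a) •
      (LinearMap.trace ℝ S ∘ₗ LinearMap.mulLeft ℝ (g a)).smulRight (l (η.basis a))
  have hL : ∀ C, L C = ∑ i, ∑ c, (sgn i * sgn c) • (g i * g c) (C (ψ i c)) +
      ∑ a, (2 * sgn a) • LinearMap.trace ℝ S (g a * C) • l (η.basis a) := fun C => by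
    simp [L, LinearMap.sum_apply]
  have hL0 : ∀ s, L ((ω.form s).smulRight s) = 0 := by
    intro s
    rw [hL]
    simp only [trace_mul_rankOne, LinearMap.smulRight_apply]
    have h1 := h s
    rw [spin_eq_sum, dirac_eq_sum] at h1
    simp only [LinearMap.smul_apply, LinearMap.sum_apply, map_sum, map_smul, hψ] at h1 ⊢
    have e1 : ∀ i c, (sgn i * sgn c) • ω.form s (ψ i c) • (g i * g c) s =
        -((sgn i * sgn c * ω.form (ψ i c) s) • (g i * g c) s) := fun i c => by
      rw [hg.anticomm s, smul_smul, ← neg_smul]; congr 1; ring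
    have e2 : ∀ a, (2 * sgn a) • ω.form s (g a s) • l (η.basis a) =
        (2 : ℝ) • (sgn a * ω.form s (g a s)) • l (η.basis a) := fun a => by
      rw [smul_smul, smul_smul, mul_assoc]
    simp only [e1, e2, Finset.sum_neg_distrib, ← Finset.smul_sum]
    change (2 : ℝ) • (1 / 4 : ℝ) • ∑ i, ∑ c, _ = ∑ a, (sgn a * ω.form s (g a s)) • _ at h1
    rw [← h1]
    module
  have hL1 : ∀ K ∈ skewSets, L (gamma g K) = 0 := fun K hK =>
    hg.eq_zero_of_skew hL0 (hg.skew_gamma hK)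
  have hdiag : ∀ i, ψ i i = 0 := fun i => by
    have := hanti i i
    rw [eq_neg_iff_add_eq_zero, ← two_smul ℝ] at this
    exact (smul_eq_zero.1 this).resolve_left (by norm_num)
  have hψ0 : ∀ i c, ψ i c = 0 := by
    intro i c
    by_cases hic : i = c
    · rw [hic, hdiag]
    -- For K = {p, q} the trace term vanishes, since only ten-element sets pair with a single g_a.
    -- Cancelling γ_K leaves the signed sums of ±g_i g_c ψ_ic, which is symmetric in i and c because
    -- both factors change sign.
    have key : ∀ i c, (sgn i * sgn c) • (g i * g c) (ψ i c) = 0 := by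
      refine eq_zero_of_signed_sums (m := fun i c => (sgn i * sgn c) • (g i * g c) (ψ i c))
        (fun i c => ?_) (fun i => by rw [hdiag, map_zero, smul_zero]) fun p q hpq => ?_
      · by_cases hic : i = c
        · rw [hic]
        · rw [hg.anti i c hic, hanti i c, mul_comm (sgn i)]
          simp
      · have hc : ({p, q} : Finset (Fin 11)).card = 2 := Finset.card_pair hpq
        have hK : ({p, q} : Finset (Fin 11)) ∈ skewSets := by rw [mem_skewSets, hc]
        have h1 := hL1 _ hK
        rw [hL, Finset.sum_eq_zero (s := Finset.univ) (f := fun a => (2 * sgn a) •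
          LinearMap.trace ℝ S (g a * gamma g {p, q}) • l (η.basis a)) fun a _ => ?_, add_zero] at h1
        · refine hg.gamma_injective {p, q} ?_
          rw [map_zero]
          rw [← h1, map_sum]
          refine Finset.sum_congr rfl fun i _ => ?_
          rw [map_sum]
          refine Finset.sum_congr rfl fun c _ => ?_
          rw [← Module.End.mul_apply _ (gamma g _), hg.pair_mul_gamma (even_of_mem_skewSets hK),
            map_smul, map_smul, LinearMap.smul_apply, smul_comm]
          rfl
        · rw [hg.trace_mul_gamma (even_of_mem_skewSets hK), zero_smul, smul_zero]
          intro h'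
          have := congrArg Finset.card h'
          rw [hc, card_erase_univ] at this
          omega
    have h1 := key i c
    have h1 := (smul_eq_zero.1 h1).resolve_left
      (mul_ne_zero (isSign_sgn i).ne_zero (isSign_sgn c).ne_zero)
    exact hg.injective c (hg.injective i (by rw [map_zero, map_zero]; exact h1))
  have hl : l = 0 := by
    refine η.basis.ext fun b => ?_
    -- With ψ = 0 only the trace term is left, and this ten-element set isolates l(e_b).
    have h1 := hL1 (Finset.univ.erase b) (by rw [mem_skewSets, card_erase_univ])
    rw [hL, Finset.sum_eq_zero fun i _ => Finset.sum_eq_zero fun c _ => by rw [hψ0]; simp,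
      zero_add, Finset.sum_eq_single b] at h1
    · rw [smul_smul] at h1
      exact (smul_eq_zero.1 h1).resolve_left (mul_ne_zero (mul_ne_zero two_ne_zero
        (isSign_sgn b).ne_zero) (hg.trace_mul_gamma_erase b))
    · intro a _ hab
      rw [hg.trace_mul_gamma (even_card_erase_univ b) fun h' => hab (erase_univ_injective h').symm,
        zero_smul, smul_zero]
    · simp
  refine ⟨LinearMap.ext fun s => So.ext_vec (η.basis.ext fun i => ?_), hl⟩
  rw [η.expand (vec η (μ s) (η.basis i))]
  simp [hψ, hψ0]

/-- The remaining components are S × V → so(V) and V × V → S. For each fixed x the condition on (s,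
s, x) is the equation of `eq_zero_of_spin_eq_dirac`. -/
theorem subsingleton_H₂_three [IsSimpleModule (Cl η) S] : Subsingleton (H₂ ω 3) := by
  refine subsingleton_H₂ ω fun c hc => ?_
  have hss : ∀ s t, c (s, 0) (t, 0) = 0 := fun s t =>
    eq_zero_of_mem_grade (by omega) (hc.1 _ _ _ (mGrade_left s) _ (mGrade_left t)).2
  have hsv : ∀ s v, c (s, 0) (0, v) = ((c (s, 0) (0, v)).1, 0, 0) := fun s v =>
    mem_grade_zero (hc.1 _ _ _ (mGrade_left s) _ (mGrade_right v)).2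
  have hvv : ∀ v x, c (0, v) (0, x) = (0, (c (0, v) (0, x)).2.1, 0) := fun v x =>
    mem_grade_neg_one (hc.1 _ _ _ (mGrade_right v) _ (mGrade_right x)).2
  have key : ∀ x, (LinearMap.fst ℝ (So η) (S × V) ∘ₗ c.flip (0, x) ∘ₗ LinearMap.inl ℝ S V) = 0 ∧
      (LinearMap.fst ℝ S V ∘ₗ LinearMap.snd ℝ (So η) (S × V) ∘ₗ c.flip (0, x) ∘ₗ
        LinearMap.inr ℝ S V) = 0 := by
    intro x
    refine eq_zero_of_spin_eq_dirac ω _ _ fun s => ?_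
    have h := d₂_homog (mBracket ω) (adj ω) 3 c (Or.inl rfl) (Or.inl rfl) (Or.inr rfl)
        (mGrade_left s) (mGrade_left s) (mGrade_right x)
    rw [show d₂ (mBracket ω) (adj ω) 3 c = 0 from hc.2, hsv, hss] at h
    have h1 := congrArg (fun p : Poincare η S => p.2.1) h
    have h2 : eps (-1 * 3) = -1 := by
      rw [show (-1 * 3 : ℤ) = -(1 + 2) by norm_num, eps_neg, eps_add, eps_one, eps_two]; norm_num
    have h3 : eps (-1 * (3 + -1)) = 1 := by
      rw [show (-1 * (3 + -1) : ℤ) = -2 by norm_num, eps_neg, eps_two]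
    have h4 : c (0, 0) = 0 := map_zero c
    simp only [h2, h3, adj_apply, mBracket_apply, map_zero, h4] at h1
    simp at h1
    have h5 : (c (s, 0) (0, 0)).2.1 = 0 := by
      rw [show ((0, 0) : S × V) = 0 from rfl, map_zero]; rfl
    rw [h5, add_zero, eq_comm, sub_eq_zero, ← two_smul ℝ] at h1
    simpa using h1
  refine C₂_ext hc.1 (zero_mem _) hss (fun s v => ?_) (fun v x => ?_)
  · rw [hsv, show (c (s, 0) (0, v)).1 = 0 from LinearMap.congr_fun (key v).1 s]; rfl
  · rw [hvv, show (c (0, v) (0, x)).2.1 = 0 from LinearMap.congr_fun (key x).2 v]; rfl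

end HighDegrees

/-! ### Polarisation of cubic equations -/

section CubicEquations

variable {S : Type*} [AddCommGroup S] [Module ℝ S]

/-- The derivative of a cubic form that vanishes identically. -/
theorem polarize_cubic {W : Type*} [AddCommGroup W] [Module ℝ W]
    (T : S →ₗ[ℝ] S →ₗ[ℝ] S →ₗ[ℝ] W) (hT : ∀ s t u, T s t u = T t s u)
    (h : ∀ s, T s s s = 0) (s u : S) : T s s u + (2 : ℝ) • T s u s = 0 := by
  have h1 := h (s + u)
  have h2 := h (s - u)
  have h3 := h u
  simp only [map_add, map_sub, LinearMap.add_apply, LinearMap.sub_apply] at h1 h2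
  -- The part of the cubic form at s + u that is odd in u, without its term cubic in u.
  have h4 : (2 : ℝ) • (T s s u + (2 : ℝ) • T s u s) = (T s s s + T u s s + (T s u s + T u u s) +
    (T s s u + T u s u + (T s u u + T u u u))) - (T s s s - T u s s - (T s u s - T u u s) -
    (T s s u - T u s u - (T s u u - T u u u))) - (2 : ℝ) • T u u u := by
    rw [hT u s s]; module
  rw [h1, h2, h3, smul_zero, sub_zero, sub_zero] at h4
  exact (smul_eq_zero.1 h4).resolve_left (by norm_num)

theorem polarize_quadratic {W : Type*} [AddCommGroup W] [Module ℝ W]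
    (T : S →ₗ[ℝ] S →ₗ[ℝ] W) (hT : ∀ s t, T s t = T t s) (h : ∀ s, T s s = 0) (s t : S) :
    T s t = 0 := by
  have h1 := h (s + t)
  simp only [map_add, LinearMap.add_apply, h, hT t s] at h1
  have : (2 : ℝ) • T s t = 0 := by rw [← h1]; module
  exact (smul_eq_zero.1 this).resolve_left (by norm_num)

variable {g : Fin 11 → Module.End ℝ S} {ω : LinearMap.BilinForm ℝ S}

/-- The polarised Fierz expansion: both sides are symmetric bilinear and agree on the diagonal. -/
theorem IsSymplecticGamma.bilinear_eq_sum (hg : IsSymplecticGamma g ω) {W : Type*}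
    [AddCommGroup W] [Module ℝ W] {σ : S →ₗ[ℝ] S →ₗ[ℝ] W} (hσ : ∀ s t, σ s t = σ t s)
    {L : Module.End ℝ S →ₗ[ℝ] W} (hL : ∀ s, L ((ω s).smulRight s) = σ s s) (s t : S) :
    σ s t = ∑ K ∈ skewSets, (1 / 32 * (gammaSign K * ω s (gamma g K t))) • L (gamma g K) := by
  let T : S →ₗ[ℝ] S →ₗ[ℝ] W := σ - ∑ K ∈ skewSets, (1 / 32 * gammaSign K) •
    (ω.compl₂ (gamma g K)).compr₂ (LinearMap.toSpanSingleton ℝ W (L (gamma g K)))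
  have hT : ∀ s t, T s t = σ s t -
      ∑ K ∈ skewSets, (1 / 32 * (gammaSign K * ω s (gamma g K t))) • L (gamma g K) := by
    intro s t
    simp [T, LinearMap.sum_apply, smul_smul, mul_assoc]
  rw [← sub_eq_zero, ← hT]
  refine polarize_quadratic T (fun s t => ?_) (fun s => ?_) s t
  · rw [hT, hT, hσ]
    congr 1
    refine Finset.sum_congr rfl fun K hK => ?_
    rw [(hg.skew_gamma hK).comm hg.alt]
  · rw [hT, ← hL, hg.rankOne_eq_sum, map_sum, sub_eq_zero]
    exact Finset.sum_congr rfl fun K _ => map_smul _ _ _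

/-- The components of the cubic equation `⟨σ(s,s), g_a s⟩ = ∑_b ± ⟨s, g_b s⟩ ⟨ψ_b, s⟩`. -/
theorem IsSymplecticGamma.cubic_component (hg : IsSymplecticGamma g ω) {σ : S →ₗ[ℝ] S →ₗ[ℝ] S}
    (hσ : ∀ s t, σ s t = σ t s) {L : Module.End ℝ S →ₗ[ℝ] S}
    (hL : ∀ s, L ((ω s).smulRight s) = σ s s) (ψ : Fin 11 → S) (a : Fin 11)
    (h : ∀ s, ω (σ s s) (g a s) = ∑ b, sgn b * (ω s (g b s) * ω (ψ b) s)) {C : Module.End ℝ S}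
    (hC : IsSkew ω C) :
    g a (L C) + (1 / 16 : ℝ) • ∑ K ∈ skewSets, gammaSign K • gamma g K (C (g a (L (gamma g K)))) +
      ∑ b, sgn b • ((2 : ℝ) • g b (C (ψ b)) + LinearMap.trace ℝ S (g b * C) • ψ b) = 0 := by
  have := hg.finite
  let P : Module.End ℝ S →ₗ[ℝ] S := g a ∘ₗ L + (1 / 16 : ℝ) • ∑ K ∈ skewSets,
    gammaSign K • gamma g K ∘ₗ LinearMap.applyₗ (g a (L (gamma g K))) +
    ∑ b, sgn b • ((2 : ℝ) • g b ∘ₗ LinearMap.applyₗ (ψ b) +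
      (LinearMap.trace ℝ S ∘ₗ LinearMap.mulLeft ℝ (g b)).smulRight (ψ b))
  have hP : ∀ C, P C = g a (L C) + (1 / 16 : ℝ) • ∑ K ∈ skewSets, gammaSign K •
      gamma g K (C (g a (L (gamma g K)))) +
      ∑ b, sgn b • ((2 : ℝ) • g b (C (ψ b)) + LinearMap.trace ℝ S (g b * C) • ψ b) := fun C => by
    simp [P, LinearMap.sum_apply]
  rw [← hP]
  refine hg.eq_zero_of_skew (fun s => hg.ext_form fun u => ?_) hC
  let T : S →ₗ[ℝ] S →ₗ[ℝ] S →ₗ[ℝ] ℝ := σ.compr₂ (ω.compl₂ (g a)) -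
    ∑ b, sgn b • (ω.compl₂ (g b)).compr₂ (LinearMap.toSpanSingleton ℝ _ (ω (ψ b)))
  have hT : ∀ s t u, T s t u = ω (σ s t) (g a u) -
      ∑ b, sgn b * (ω s (g b t) * ω (ψ b) u) := fun s t u => by
    simp [T, LinearMap.sum_apply]
  have h0 := polarize_cubic T (fun s t u => by
    rw [hT, hT, hσ]
    congr 1
    exact Finset.sum_congr rfl fun b _ => by rw [(hg.skew b).comm hg.alt]) (fun s => by
      rw [hT, h, sub_self]) s u
  -- The Fierz expansion of σ(s,u) makes this term linear in the operator ⟨s,-⟩s. It enters the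
  -- polarised equation twice, whence 2 · 1/32 = 1/16.
  have e1 : ω (σ s u) (g a s) = -(1 / 32 * ω (∑ K ∈ skewSets, gammaSign K • gamma g K
      ((ω s).smulRight s (g a (L (gamma g K))))) u) := by
    rw [hg.bilinear_eq_sum hσ hL]
    simp only [map_sum, LinearMap.sum_apply, map_smul, LinearMap.smul_apply, smul_eq_mul,
      LinearMap.smulRight_apply, Finset.mul_sum, ← Finset.sum_neg_distrib]
    refine Finset.sum_congr rfl fun K hK => ?_
    rw [(hg.skew a).comm hg.alt (L (gamma g K)) s, hg.skew_gamma hK]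
    ring
  rw [hT, hT, e1] at h0
  rw [map_zero, LinearMap.zero_apply, hP, hL]
  simp only [map_add, map_sum, map_smul, LinearMap.add_apply, LinearMap.sum_apply,
    LinearMap.smul_apply, smul_eq_mul, trace_mul_rankOne, LinearMap.smulRight_apply] at h0 ⊢
  rw [hg.skew a, ← neg_eq_zero, ← h0]
  have e2 : ∑ b, sgn b * (2 * (ω s (ψ b) * ω (g b s) u) + ω s (g b s) * ω (ψ b) u) =
      2 * ∑ b, sgn b * (ω s (g b u) * ω (ψ b) s) + ∑ b, sgn b * (ω s (g b s) * ω (ψ b) u) := by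
    rw [Finset.mul_sum, ← Finset.sum_add_distrib]
    refine Finset.sum_congr rfl fun b _ => ?_
    rw [hg.skew b, hg.anticomm (ψ b) s]; ring
  rw [e2]
  ring

end CubicEquations

/-! ### Reduction to equations with scalar coefficients -/

section ScalarEquations

variable {S : Type*} [AddCommGroup S] [Module ℝ S]
variable {g : Fin 11 → Module.End ℝ S} {ω : LinearMap.BilinForm ℝ S}

/-- The coefficients `d_K` with `L (gamma g K) = gamma g K d_K`. -/
def gammaCoeff (g : Fin 11 → Module.End ℝ S) (L : Module.End ℝ S →ₗ[ℝ] S)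
    (K : Finset (Fin 11)) : S := gammaSign K • gamma g K (L (gamma g K))

theorem IsGamma.gamma_gammaCoeff (hg : IsGamma g) (L : Module.End ℝ S →ₗ[ℝ] S)
    (K : Finset (Fin 11)) : gamma g K (gammaCoeff g L K) = L (gamma g K) := by
  rw [gammaCoeff, map_smul, ← Module.End.mul_apply, hg.gamma_sq, LinearMap.smul_apply,
    (isSign_gammaSign K).smul_smul]
  rfl

/-- With ψ_b = g_b g_a f_b and L(γ_K) = γ_K d_K, moving γ_I g_a to the left in each term of
`cubic_component` costs only signs. Cancelling it and multiplying by 16 leaves scalar coefficients.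
The 16 on the right is half the trace of the identity; it appears when g_b γ_I is a scalar. -/
theorem IsSymplecticGamma.scalar_component (hg : IsSymplecticGamma g ω)
    {σ : S →ₗ[ℝ] S →ₗ[ℝ] S}
    (hσ : ∀ s t, σ s t = σ t s) {L : Module.End ℝ S →ₗ[ℝ] S}
    (hL : ∀ s, L ((ω s).smulRight s) = σ s s) (f : Fin 11 → S) (a : Fin 11)
    (h : ∀ s, ω (σ s s) (g a s) = ∑ b, sgn b * (ω s (g b s) * ω (g b (g a (f b))) s))
    {I : Finset (Fin 11)} (hI : I ∈ skewSets) :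
    (16 * chi I a) • gammaCoeff g L I +
      ∑ K ∈ skewSets, (pairSign K I * chi K a) • gammaCoeff g L K =
      (32 : ℝ) • ∑ b, (chi I b + if I = Finset.univ.erase b then 16 else 0) • f b := by
  have h1 := hg.cubic_component hσ hL _ a h (hg.skew_gamma hI)
  have hIe := even_of_mem_skewSets hI
  have r1 : g a (L (gamma g I)) = gamma g I (g a (chi I a • gammaCoeff g L I)) := by
    rw [← hg.gamma_gammaCoeff L I, ← Module.End.mul_apply, hg.mul_gamma_even hIe, map_smul,
      map_smul]
    rfl
  have r2 : ∀ K ∈ skewSets, gammaSign K • gamma g K (gamma g I (g a (L (gamma g K)))) =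
      gamma g I (g a ((pairSign K I * chi K a) • gammaCoeff g L K)) := by
    intro K hK
    have hKe := even_of_mem_skewSets hK
    rw [← hg.gamma_gammaCoeff L K, ← Module.End.mul_apply (gamma g K), hg.gamma_mul_gamma_comm hKe,
      LinearMap.smul_apply, Module.End.mul_apply, ← Module.End.mul_apply (g a),
      hg.mul_gamma_even hKe, LinearMap.smul_apply, Module.End.mul_apply, map_smul (gamma g K),
      ← Module.End.mul_apply (gamma g K) (gamma g K), hg.gamma_sq, LinearMap.smul_apply,
      Module.End.one_apply]
    simp only [map_smul]
    rw [smul_comm (chi K a) (gammaSign K), smul_comm (pairSign K I) (gammaSign K),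
      (isSign_gammaSign K).smul_smul, smul_smul]
  have r3 : ∀ b, sgn b • ((2 : ℝ) • g b (gamma g I (g b (g a (f b)))) +
      LinearMap.trace ℝ S (g b * gamma g I) • g b (g a (f b))) =
      -gamma g I (g a (((2 : ℝ) *
        (chi I b + if I = Finset.univ.erase b then 16 else 0)) • f b)) := by
    intro b
    have q1 : g b (gamma g I (g b (g a (f b)))) = (-sgn b * chi I b) • gamma g I (g a (f b)) := by
      rw [← Module.End.mul_apply (g b), hg.mul_gamma_even hIe, LinearMap.smul_apply,
        Module.End.mul_apply, ← Module.End.mul_apply (g b) (g b), hg.sq, LinearMap.smul_apply,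
        Module.End.one_apply, map_smul, smul_smul, mul_comm]
    have q2 : LinearMap.trace ℝ S (g b * gamma g I) • g b (g a (f b)) =
        (if I = Finset.univ.erase b then (-sgn b * 32 : ℝ) else 0) • gamma g I (g a (f b)) := by
      split_ifs with hb
      -- For I the complement of b the operator g_b γ_I is central, so its trace is 32 times the
      -- scalar it represents.
      · have hc : ∀ c, g c * (g b * gamma g I) = g b * gamma g I * g c := by
          intro c
          by_cases hcb : c = b
          · subst hcb
            rw [mul_assoc, hg.gamma_mul_even hIe, chi, if_neg (by rw [hb]; simp), one_smul]
          · rw [← mul_assoc, hg.anti c b hcb, neg_mul, mul_assoc, hg.mul_gamma_even hIe, chi,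
              if_pos (by rw [hb]; simp [hcb]), neg_one_smul, mul_neg, neg_neg, mul_assoc]
        have := congrArg (fun N : Module.End ℝ S => N (g b (g a (f b)))) (hg.trace_smul_one hc)
        simp only [LinearMap.smul_apply, Module.End.one_apply, Module.End.mul_apply] at this
        rw [this, q1, chi, if_neg (by rw [hb]; simp), smul_smul]
        congr 1; ring
      · rw [hg.trace_mul_gamma hIe hb, zero_smul, zero_smul]
    rw [q1, q2, map_smul, map_smul, smul_smul, ← add_smul, smul_smul, ← neg_smul]
    congr 1
    have := (isSign_sgn b).mul_self
    split_ifs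
    · linear_combination (-2 * chi I b - 32) * this
    · linear_combination (-2 * chi I b) * this
  rw [r1, Finset.sum_congr rfl r2, Finset.sum_congr rfl fun b _ => r3 b] at h1
  simp only [← map_sum, ← map_smul, ← map_add, ← map_neg] at h1
  have h2 := hg.injective a (hg.gamma_injective I (h1.trans (by rw [map_zero, map_zero]) :
    _ = gamma g I (g a 0)))
  have h3 := congrArg (fun x => (16 : ℝ) • x) (eq_neg_of_add_eq_zero_left h2)
  simp only [smul_add, smul_smul] at h3
  norm_num at h3
  rw [h3, Finset.smul_sum, Finset.smul_sum]
  refine Finset.sum_congr rfl fun b _ => ?_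
  rw [smul_smul, smul_smul]
  congr 1; ring

end ScalarEquations

/-! ### Counting index sets -/

section SkewSetSums

theorem pairSign_erase_univ {K : Finset (Fin 11)} (hK : Even K.card) (z : Fin 11) :
    pairSign K (Finset.univ.erase z) = chi K z := by
  have h : chi K z * pairSign K (Finset.univ.erase z) = pairSign K Finset.univ :=
    Finset.mul_prod_erase Finset.univ (chi K) (Finset.mem_univ z)
  rw [pairSign_eq K Finset.univ, Finset.inter_univ, hK.neg_one_pow] at h
  calc pairSign K (Finset.univ.erase z)
      = chi K z * (chi K z * pairSign K (Finset.univ.erase z)) := by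
        rw [← mul_assoc, (isSign_chi K z).mul_self, one_mul]
    _ = chi K z := by rw [h, mul_one]

theorem chi_erase_univ (z b : Fin 11) :
    chi (Finset.univ.erase z) b = -1 + if z = b then 2 else 0 := by
  unfold chi
  by_cases h : z = b
  · subst h; norm_num
  · simp [h, Ne.symm h]

theorem erase_univ_mem_skewSets (z : Fin 11) : Finset.univ.erase z ∈ skewSets := by
  rw [mem_skewSets, card_erase_univ]

/-- A function on the sets of a given size that is invariant under swaps is constant. -/
theorem eq_of_swap {M : Type*} {k : ℕ} {D : Finset (Fin 11) → M}
    (h : ∀ X : Finset (Fin 11), X.card = k + 1 → ∀ a ∈ X, ∀ b ∈ X, D (X.erase a) = D (X.erase b))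
    {I J : Finset (Fin 11)} (hI : I.card = k) (hJ : J.card = k) : D I = D J := by
  induction hn : (I \ J).card generalizing I with
  | zero =>
    rw [Finset.card_eq_zero, Finset.sdiff_eq_empty_iff_subset] at hn
    rw [Finset.eq_of_subset_of_card_le hn (by omega)]
  | succ n ih =>
    obtain ⟨a, ha⟩ := Finset.card_pos.1 (show 0 < (I \ J).card by omega)
    have h1 := Finset.card_sdiff_add_card_inter I J
    have h2 := Finset.card_sdiff_add_card_inter J I
    rw [Finset.inter_comm J I] at h2
    obtain ⟨b, hb⟩ := Finset.card_pos.1 (show 0 < (J \ I).card by omega)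
    rw [Finset.mem_sdiff] at ha hb
    have hX : (insert b I).card = k + 1 := by rw [Finset.card_insert_of_notMem hb.2, hI]
    have h3 := h _ hX b (Finset.mem_insert_self b I) a (Finset.mem_insert_of_mem ha.1)
    rw [Finset.erase_insert hb.2] at h3
    rw [h3]
    refine ih ?_ ?_
    · rw [Finset.card_erase_of_mem (Finset.mem_insert_of_mem ha.1), hX]; rfl
    · have : (insert b I).erase a \ J = (I \ J).erase a := by
        ext x
        simp only [Finset.mem_sdiff, Finset.mem_erase, Finset.mem_insert]
        constructor
        · rintro ⟨⟨h, rfl | h'⟩, h''⟩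
          · exact absurd hb.1 h''
          · exact ⟨h, h', h''⟩
        · rintro ⟨h, h', h''⟩
          exact ⟨⟨h, Or.inr h'⟩, h''⟩
      rw [this, Finset.card_erase_of_mem (Finset.mem_sdiff.2 ha), hn]; rfl

theorem sum_skewSets {M : Type*} [AddCommGroup M] [Module ℝ M] (D : Finset (Fin 11) → M)
    (d : ℕ → M) (hD : ∀ K ∈ skewSets, D K = d K.card) :
    ∑ K ∈ skewSets, D K = (55 : ℝ) • d 2 + (462 : ℝ) • d 6 + (11 : ℝ) • d 10 := by
  have h : skewSets = (Finset.univ.powersetCard 2 ∪ Finset.univ.powersetCard 6) ∪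
      Finset.univ.powersetCard 10 := by
    ext K
    have := Finset.card_le_univ K
    rw [Fintype.card_fin] at this
    simp only [mem_skewSets, Finset.mem_union, Finset.mem_powersetCard, Finset.subset_univ,
      true_and]
    omega
  have h1 : Disjoint (Finset.univ.powersetCard 2 : Finset (Finset (Fin 11)))
      (Finset.univ.powersetCard 6) := Finset.pairwise_disjoint_powersetCard _ (by decide)
  have h2 : Disjoint (Finset.univ.powersetCard 2 ∪ Finset.univ.powersetCard 6 :
      Finset (Finset (Fin 11))) (Finset.univ.powersetCard 10) :=
    Finset.disjoint_union_left.2 ⟨Finset.pairwise_disjoint_powersetCard _ (by decide),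
      Finset.pairwise_disjoint_powersetCard _ (by decide)⟩
  have h3 : ∀ k, k % 4 = 2 → ∑ K ∈ Finset.univ.powersetCard k, D K = Nat.choose 11 k • d k := by
    intro k hk
    rw [Finset.sum_congr rfl (g := fun _ => d k), Finset.sum_const, Finset.card_powersetCard,
      Finset.card_univ, Fintype.card_fin]
    intro K hK
    have := (Finset.mem_powersetCard.1 hK).2
    rw [hD K (by rw [mem_skewSets]; omega), this]
  rw [h, Finset.sum_union h2, Finset.sum_union h1, h3 2 rfl, h3 6 rfl, h3 10 rfl,
    show Nat.choose 11 2 = 55 from rfl, show Nat.choose 11 6 = 462 from rfl,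
    show Nat.choose 11 10 = 11 from rfl]
  module

theorem sum_chi (K : Finset (Fin 11)) : ∑ a, chi K a = 11 - 2 * K.card := by
  have : ∀ a, chi K a = 1 - 2 * if a ∈ K then 1 else 0 := fun a => by
    unfold chi; split_ifs <;> norm_num
  simp only [this, Finset.sum_sub_distrib, ← Finset.mul_sum]
  simp

end SkewSetSums

/-! ### The cubic equations of degree 1 -/

section DegreeOne

variable {S : Type*} [AddCommGroup S] [Module ℝ S]
variable {g : Fin 11 → Module.End ℝ S} {ω : LinearMap.BilinForm ℝ S}

/-- With ψ_ab = g_b g_a f_ab the claim becomes f_ab − f_ba = f_aa − f_bb, and l_a = g_a f_aa. It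
supplies the map V → S that makes the S × V component of a degree 1 cocycle η-skew. -/
theorem IsSymplecticGamma.exists_symmetric_part (hg : IsSymplecticGamma g ω)
    {σ : S →ₗ[ℝ] S →ₗ[ℝ] S} (hσ : ∀ s t, σ s t = σ t s) (ψ : Fin 11 → Fin 11 → S)
    (h : ∀ a s, ω (σ s s) (g a s) = ∑ b, sgn b * (ω s (g b s) * ω (ψ a b) s)) :
    ∃ l : Fin 11 → S, ∀ a b, ψ a b + ψ b a = g a (l b) + g b (l a) := by
  obtain ⟨L, hL⟩ := hg.exists_linear σ
  have hsq : ∀ a s, g a (g a s) = (-sgn a) • s := fun a s => by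
    rw [← Module.End.mul_apply, hg.sq]; rfl
  have hf : ∀ a b, ∃ f, g b (g a f) = ψ a b := fun a b =>
    ⟨(sgn a * sgn b) • g a (g b (ψ a b)), by
      rw [map_smul, map_smul, hsq, map_smul, hsq, smul_smul, smul_smul]
      have h1 := (isSign_sgn a).mul_self
      have h2 := (isSign_sgn b).mul_self
      rw [show sgn a * sgn b * -sgn a * -sgn b = (sgn a * sgn a) * (sgn b * sgn b) by ring, h1, h2]
      simp⟩
  choose f hf using hf
  have key := fun a I hI => hg.scalar_component hσ (fun s => hL s s) (f a) a
    (fun s => by rw [h]; simp only [hf]) (I := I) hI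
  -- The coefficient is −1 for b ≠ z and 1 + 16 = 18 − 1 for b = z.
  have hsum : ∀ a z, ∑ b, (chi (Finset.univ.erase z) b +
      if Finset.univ.erase z = Finset.univ.erase b then 16 else 0) • f a b =
      (18 : ℝ) • f a z - ∑ b, f a b := by
    intro a z
    have : ∀ b, (chi (Finset.univ.erase z) b +
      if Finset.univ.erase z = Finset.univ.erase b then 16 else 0) • f a b =
      (if z = b then (18 : ℝ) • f a b else 0) - f a b := by
      intro b
      rw [chi_erase_univ]
      by_cases hzb : z = b
      · subst hzb; simp only [if_true]; module
      · rw [if_neg hzb, if_neg fun h' => hzb (erase_univ_injective h'), if_neg hzb]; module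
    rw [Finset.sum_congr rfl fun b _ => this b, Finset.sum_sub_distrib, Finset.sum_ite_eq,
      if_pos (Finset.mem_univ _)]
  have key2 : ∀ a z, (16 * chi (Finset.univ.erase z) a) • gammaCoeff g L (Finset.univ.erase z) +
      ∑ K ∈ skewSets, (chi K z * chi K a) • gammaCoeff g L K =
      (32 : ℝ) • ((18 : ℝ) • f a z - ∑ b, f a b) := by
    intro a z
    rw [← hsum, ← key a _ (erase_univ_mem_skewSets z)]
    congr 1
    exact Finset.sum_congr rfl fun K hK => by rw [pairSign_erase_univ (even_of_mem_skewSets hK)]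
  have main : ∀ y z, y ≠ z → f y z - f z y = f y y - f z z := by
    intro y z hyz
    have e1 := key2 y z
    have e2 := key2 z y
    have e3 := key2 y y
    have e4 := key2 z z
    simp only [(isSign_chi _ _).mul_self] at e3 e4
    rw [Finset.sum_congr rfl fun K _ => by rw [mul_comm (chi K y)]] at e2
    simp only [chi_erase_univ, hyz, Ne.symm hyz, if_true, if_false] at e1 e2 e3 e4
    -- In this combination of the equations for (y,z), (z,y), (y,y) and (z,z) all coefficients of L
    -- cancel, as do the sums over b. The factor is 576 = 32 · 18.
    have e5 := congrArg₂ (· - ·) (congrArg₂ (· - ·) e1 e2) (congrArg₂ (· - ·) e3 e4)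
    have e6 : (576 : ℝ) • ((f y z - f z y) - (f y y - f z z)) = 0 := by
      refine Eq.trans ?_ (Eq.trans e5.symm ?_) <;> module
    exact sub_eq_zero.1 ((smul_eq_zero.1 e6).resolve_left (by norm_num))
  refine ⟨fun a => g a (f a a), fun a b => ?_⟩
  by_cases hab : a = b
  · subst hab; rw [← hf]
  · have h1 : ∀ u, g a (g b u) = -g b (g a u) := fun u => by
      rw [← Module.End.mul_apply, hg.anti a b hab]; rfl
    rw [← hf a b, ← hf b a, h1, h1, neg_add_eq_sub, ← sub_eq_add_neg, ← map_sub, ← map_sub,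
      ← map_sub,
      ← map_sub, main a b hab]

/-- The coefficients of L turn out to depend only on |K| ∈ {2, 6, 10}, and there are two independent
relations among these three spinors apart from the one at size 6. So σ is governed by a single
spinor, which the condition at J sets to zero. -/
theorem IsSymplecticGamma.cubic_eq_zero (hg : IsSymplecticGamma g ω)
    {σ : S →ₗ[ℝ] S →ₗ[ℝ] S} (hσ : ∀ s t, σ s t = σ t s) {L : Module.End ℝ S →ₗ[ℝ] S}
    (hL : ∀ s, L ((ω s).smulRight s) = σ s s) (h : ∀ a s, ω (σ s s) (g a s) = 0)
    {J : Finset (Fin 11)} (hJ : J.card = 6) (h0 : L (gamma g J) = 0) (s t : S) : σ s t = 0 := by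
  set D := gammaCoeff g L with hD
  let F : Finset (Fin 11) → S := fun X => ∑ K ∈ skewSets, pairSign K X • D K
  have key : ∀ a, ∀ I ∈ skewSets, (16 * chi I a) • D I +
      ∑ K ∈ skewSets, (pairSign K I * chi K a) • D K = 0 := by
    intro a I hI
    have := hg.scalar_component hσ hL (fun _ => 0) a (fun s => by simp [h]) hI
    simpa using this
  -- For |X| = 3, 7 or 11 and I = X ∖ {a}, the signs of I and of a combine to that of X, which does
  -- not depend on a. Hence D is invariant under swaps.
  have keyF : ∀ X : Finset (Fin 11), X.card % 4 = 3 → ∀ a ∈ X, (16 : ℝ) • D (X.erase a) = -F X := by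
    intro X hX a ha
    have h1 := key a (X.erase a) (by rw [mem_skewSets, Finset.card_erase_of_mem ha]; omega)
    rw [chi, if_neg (Finset.notMem_erase a X), mul_one] at h1
    rw [eq_neg_iff_add_eq_zero, ← h1]
    congr 1
    refine Finset.sum_congr rfl fun K _ => ?_
    rw [pairSign, pairSign, mul_comm, Finset.mul_prod_erase X (chi K) ha]
  have swap : ∀ X : Finset (Fin 11), X.card % 4 = 3 → ∀ a ∈ X, ∀ b ∈ X,
      D (X.erase a) = D (X.erase b) := by
    intro X hX a ha b hb
    exact smul_right_injective _ (show (16 : ℝ) ≠ 0 by norm_num)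
      ((keyF X hX a ha).trans (keyF X hX b hb).symm)
  -- Values at representatives of the sizes 2, 6 and 10; the last branch matters only at 10.
  let d : ℕ → S := fun n =>
    if n = 2 then D {0, 1} else if n = 6 then D J else D (Finset.univ.erase 0)
  have hd : ∀ K ∈ skewSets, D K = d K.card := by
    intro K hK
    rw [mem_skewSets] at hK
    have h3 := Finset.card_le_univ K
    rw [Fintype.card_fin] at h3
    obtain hc | hc | hc : K.card = 2 ∨ K.card = 6 ∨ K.card = 10 := by omega
    · rw [hc]
      exact eq_of_swap (k := 2) (fun X hX => swap X (by omega)) hc rfl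
    · rw [hc]
      exact eq_of_swap (k := 6) (fun X hX => swap X (by omega)) hc hJ
    · rw [hc]
      exact eq_of_swap (k := 10) (fun X hX => swap X (by omega)) hc (card_erase_univ 0)
  have hd6 : d 6 = 0 := by
    change D J = 0
    rw [hD, gammaCoeff, h0, map_zero, smul_zero]
  -- X is the full index set, where all signs are 1: 16 d₁₀ + 55 d₂ + 11 d₁₀ = 0.
  have E1 : (55 : ℝ) • d 2 + (27 : ℝ) • d 10 = 0 := by
    have h1 := keyF Finset.univ rfl 0 (Finset.mem_univ 0)
    have h2 : F Finset.univ = ∑ K ∈ skewSets, D K := Finset.sum_congr rfl fun K hK => by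
      rw [pairSign_eq, Finset.inter_univ, (even_of_mem_skewSets hK).neg_one_pow, one_smul]
    rw [h2, sum_skewSets D d hd, hd _ (erase_univ_mem_skewSets 0), card_erase_univ, hd6,
      eq_neg_iff_add_eq_zero] at h1
    rw [← h1]; module
  -- I = {x, a} gives ∑ χ_K(x) D_K = 16 d₂. Summed over x, with ∑ χ_K = 11 − 2|K|, this reads 385 d₂
  -- − 99 d₁₀ = 176 d₂.
  have E2 : (209 : ℝ) • d 2 - (99 : ℝ) • d 10 = 0 := by
    have h1 : ∀ x : Fin 11, ∑ K ∈ skewSets, chi K x • D K = (16 : ℝ) • d 2 := by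
      intro x
      obtain ⟨a, ha⟩ := exists_ne x
      have hc : ({x, a} : Finset (Fin 11)).card = 2 := Finset.card_pair (Ne.symm ha)
      have hm : ({x, a} : Finset (Fin 11)) ∈ skewSets := by rw [mem_skewSets, hc]
      have h2 := key a {x, a} hm
      rw [hd _ hm, hc, chi, if_pos (by simp)] at h2
      have h3 : ∀ K, pairSign K {x, a} * chi K a = chi K x := fun K => by
        rw [pairSign, Finset.prod_pair (Ne.symm ha), mul_assoc, (isSign_chi K a).mul_self, mul_one]
      simp only [h3] at h2
      rw [eq_neg_of_add_eq_zero_right h2]; module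
    have h2 : ∑ x : Fin 11, ∑ K ∈ skewSets, chi K x • D K = (176 : ℝ) • d 2 := by
      rw [Finset.sum_congr rfl fun x _ => h1 x, Finset.sum_const, Finset.card_univ,
        Fintype.card_fin]
      module
    rw [Finset.sum_comm] at h2
    simp only [← Finset.sum_smul, sum_chi] at h2
    rw [sum_skewSets _ (fun n => (11 - 2 * (n : ℝ)) • d n) fun K hK => by rw [hd K hK], hd6] at h2
    rw [← sub_eq_zero] at h2
    rw [← h2]; push_cast; module
  have hd2 : d 2 = 0 := by
    have : (112 : ℝ) • d 2 = ((55 : ℝ) • d 2 + (27 : ℝ) • d 10) +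
      (3 / 11 : ℝ) • ((209 : ℝ) • d 2 - (99 : ℝ) • d 10) := by module
    rw [E1, E2, smul_zero, add_zero] at this
    exact (smul_eq_zero.1 this).resolve_left (by norm_num)
  have hd10 : d 10 = 0 := by
    rw [hd2, smul_zero, zero_add] at E1
    exact (smul_eq_zero.1 E1).resolve_left (by norm_num)
  rw [hg.bilinear_eq_sum hσ hL]
  refine Finset.sum_eq_zero fun K hK => ?_
  rw [← hg.gamma_gammaCoeff, ← hD, hd K hK]
  have : d K.card = 0 := by
    rw [mem_skewSets] at hK
    have h3 := Finset.card_le_univ K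
    rw [Fintype.card_fin] at h3
    obtain hc | hc | hc : K.card = 2 ∨ K.card = 6 ∨ K.card = 10 := by omega
    all_goals rw [hc]; assumption
  rw [this, map_zero, smul_zero]

end DegreeOne

/-! ### Auxiliary facts on cochains, representations and so(V)-valued maps -/

section Tools

variable {V : Type u} [AddCommGroup V] [Module ℝ V] {S : Type w} [AddCommGroup S] [Module ℝ S]
variable {W W' : Type*} [AddCommGroup W] [Module ℝ W] [AddCommGroup W'] [Module ℝ W']

theorem d₂_compr (br : S × V →ₗ[ℝ] S × V →ₗ[ℝ] S × V) {act : S × V →ₗ[ℝ] W →ₗ[ℝ] W}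
    {act' : S × V →ₗ[ℝ] W' →ₗ[ℝ] W'} (f : W →ₗ[ℝ] W') (h : ∀ x p, act' x (f p) = f (act x p))
    (d : ℤ) (c : S × V →ₗ[ℝ] S × V →ₗ[ℝ] W) (x y z : S × V) :
    d₂ br act' d (c.compr₂ f) x y z = f (d₂ br act d c x y z) := by
  simp only [d₂, d₂Hom, LinearMap.coe_mk, AddHom.coe_mk, LinearMap.coe_sum, Finset.sum_apply,
    LinearMap.mk₂_apply, LinearMap.compr₂_apply, h, map_sum, map_add, map_sub, map_smul]

theorem mem_C₂ {gr : ℤ → Submodule ℝ W} {d : ℤ} {c : S × V →ₗ[ℝ] S × V →ₗ[ℝ] W}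
    (h1 : ∀ s t, c (s, 0) (t, 0) = c (t, 0) (s, 0))
    (h2 : ∀ s v, c (0, v) (s, 0) = -c (s, 0) (0, v))
    (h3 : ∀ v x, c (0, v) (0, x) = -c (0, x) (0, v))
    (g1 : ∀ s t, c (s, 0) (t, 0) ∈ gr (-1 + -1 + d))
    (g2 : ∀ s v, c (s, 0) (0, v) ∈ gr (-1 + -2 + d))
    (g3 : ∀ v x, c (0, v) (0, x) ∈ gr (-2 + -2 + d)) : c ∈ C₂ gr d := by
  intro i j x hx y hy
  rcases mGrade_cases hx with ⟨rfl, s, rfl⟩ | ⟨rfl, v, rfl⟩ | rfl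
  · rcases mGrade_cases hy with ⟨rfl, t, rfl⟩ | ⟨rfl, v, rfl⟩ | rfl
    · rw [eps_ss, h1 t s]
      simpa using g1 s t
    · rw [eps_sv, h2]
      simpa using g2 s v
    · simp
  · rcases mGrade_cases hy with ⟨rfl, t, rfl⟩ | ⟨rfl, x, rfl⟩ | rfl
    · rw [eps_vs, h2]
      refine ⟨by simp, ?_⟩
      rw [add_comm (-2 : ℤ)]
      exact neg_mem (g2 t v)
    · rw [eps_vv, h3 x v]
      simpa using g3 v x
    · simp
  · simp

/-- Irreducibility is transported by isomorphisms of representations. -/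
theorem IsIrreducibleRep.of_intertwines {L : Type*} [LieRing L] [LieAlgebra ℝ L] {M N : Type*}
    [AddCommGroup M] [Module ℝ M] [AddCommGroup N] [Module ℝ N] {ρ : L →ₗ⁅ℝ⁆ Module.End ℝ M}
    {τ : L →ₗ⁅ℝ⁆ Module.End ℝ N} (hτ : IsIrreducibleRep τ) (e : M ≃ₗ[ℝ] N)
    (he : Intertwines ρ τ e) : IsIrreducibleRep ρ := by
  have := hτ.1
  refine ⟨e.toEquiv.nontrivial, fun U hU => ?_⟩
  rcases hτ.2 (U.map (e : M →ₗ[ℝ] N)) (by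
    rintro A _ ⟨m, hm, rfl⟩
    exact ⟨ρ A m, hU A m hm, he A m⟩) with h | h
  · left
    refine (Submodule.eq_bot_iff _).2 fun m hm => ?_
    have h1 : e m ∈ U.map (e : M →ₗ[ℝ] N) := ⟨m, hm, rfl⟩
    rw [h, Submodule.mem_bot] at h1
    exact e.injective (h1.trans (map_zero e).symm)
  · right
    refine Submodule.eq_top_iff'.2 fun m => ?_
    have h1 : e m ∈ U.map (e : M →ₗ[ℝ] N) := by rw [h]; trivial
    obtain ⟨m', hm', h2⟩ := h1
    rwa [← e.injective h2]

theorem Intertwines.symm {L : Type*} [LieRing L] [LieAlgebra ℝ L] {M N : Type*}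
    [AddCommGroup M] [Module ℝ M] [AddCommGroup N] [Module ℝ N] {ρ : L →ₗ⁅ℝ⁆ Module.End ℝ M}
    {τ : L →ₗ⁅ℝ⁆ Module.End ℝ N} {e : M ≃ₗ[ℝ] N} (he : Intertwines ρ τ e) :
    Intertwines τ ρ e.symm := fun A n => by
  rw [LinearEquiv.symm_apply_eq, he, LinearEquiv.apply_symm_apply]

theorem Intertwines.trans {L : Type*} [LieRing L] [LieAlgebra ℝ L] {M N P : Type*}
    [AddCommGroup M] [Module ℝ M] [AddCommGroup N] [Module ℝ N] [AddCommGroup P] [Module ℝ P]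
    {ρ : L →ₗ⁅ℝ⁆ Module.End ℝ M} {τ : L →ₗ⁅ℝ⁆ Module.End ℝ N} {υ : L →ₗ⁅ℝ⁆ Module.End ℝ P}
    {e : M ≃ₗ[ℝ] N} {f : N ≃ₗ[ℝ] P} (he : Intertwines ρ τ e) (hf : Intertwines τ υ f) :
    Intertwines ρ υ (e.trans f) := fun A m => by
  rw [LinearEquiv.trans_apply, LinearEquiv.trans_apply, he, hf]

/-- A linear family of `η`-skew endomorphisms, as a linear map to `so(V)`. -/
def soOfSkewLinear (η : LorentzForm V) {M : Type*} [AddCommGroup M] [Module ℝ M]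
    (B : M →ₗ[ℝ] Module.End ℝ V) (hB : ∀ m v x, η.form (B m v) x = -η.form v (B m x)) :
    M →ₗ[ℝ] So η where
  toFun m := soOfSkew η (B m) (hB m)
  map_add' m n := So.ext_vec (map_add B m n)
  map_smul' r m := So.ext_vec (map_smul B r m)

theorem vec_soOfSkewLinear (η : LorentzForm V) {M : Type*} [AddCommGroup M] [Module ℝ M]
    (B : M →ₗ[ℝ] Module.End ℝ V) (hB : ∀ m v x, η.form (B m v) x = -η.form v (B m x)) (m : M) :
    vec η (soOfSkewLinear η B hB m) = B m := rfl

end Tools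

/-! ### Cochains of degree 1 and the cocycles ∂(Z ⊗ φ) -/

section DegreeOneCochains

set_option linter.unusedSectionVars false

variable {V : Type u} [AddCommGroup V] [Module ℝ V] {η : LorentzForm V}
variable {S : Type w} [AddCommGroup S] [Module ℝ S] [Module (Cl η) S] [IsScalarTower ℝ (Cl η) S]
variable (ω : SpinSymplectic η S)

theorem extAdj_apply (x : S × V) (p : ℝ × Poincare η S) :
    extAdj ω x p = (0, adj ω x p.2 + p.1 • (0, x.1, (2 : ℝ) • x.2)) := by
  simp only [extAdj, extBracket, incl, adj, gradingDer, LinearMap.comp_apply, LinearMap.mk₂_apply,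
    LinearMap.inr_apply]
  refine Prod.ext rfl ?_
  simp [sub_eq_add_neg]

theorem gradingCocycle_apply (φ : Module.Dual ℝ S) (x y : S × V) :
    gradingCocycle ω φ x y = (0, (0, -(φ y.1 • x.1 + φ x.1 • y.1),
      (2 * φ y.1) • x.2 - (2 * φ x.1) • y.2)) := by
  obtain ⟨s, v⟩ := x
  obtain ⟨t, x⟩ := y
  rw [gradingCocycle, d₁_apply _ _ (mBracket_apply ω)]
  simp only [gradingCochain_apply, extAdj_apply, eps_one, map_zero]
  refine Prod.ext (by simp) (Prod.ext (by simp) (Prod.ext ?_ ?_))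
  · simp; abel
  · simp [smul_smul, mul_comm]; abel

/-- The cocycle `∂(Z ⊗ φ)` with values in `p`. -/
def gradingComponent (φ : Module.Dual ℝ S) : S × V →ₗ[ℝ] S × V →ₗ[ℝ] Poincare η S :=
  (gradingCocycle ω φ).compr₂ (LinearMap.snd ℝ ℝ (Poincare η S))

theorem gradingComponent_apply (φ : Module.Dual ℝ S) (x y : S × V) :
    gradingComponent ω φ x y = (0, -(φ y.1 • x.1 + φ x.1 • y.1),
      (2 * φ y.1) • x.2 - (2 * φ x.1) • y.2) := by
  rw [gradingComponent, LinearMap.compr₂_apply, gradingCocycle_apply]; rfl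

/-- ∂∂ = 0 also holds with coefficients in ℝZ ⊕ p, and p is an m-submodule there. The differential
of the p-valued cochain can thus be computed in the extension. -/
theorem gradingComponent_mem (φ : Module.Dual ℝ S) : gradingComponent ω φ ∈ Z₂ ω 1 := by
  constructor
  · refine mem_C₂ (fun s t => ?_) (fun s v => ?_) (fun v x => ?_) (fun s t => ?_) (fun s v => ?_)
      (fun v x => ?_) <;> simp only [gradingComponent_apply]
    · simp [add_comm]
    · simp
    · simp
    · exact ⟨fun _ => rfl, fun h => absurd rfl h, fun _ => by simp⟩
    · exact ⟨fun _ => rfl, fun _ => by simp, fun h => absurd rfl h⟩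
    · exact ⟨fun _ => rfl, fun _ => by simp, fun _ => by simp⟩
  · refine LinearMap.ext fun x => LinearMap.ext₂ fun y z => ?_
    have h1 : gradingCocycle ω φ = (gradingComponent ω φ).compr₂ (LinearMap.inr ℝ ℝ _) :=
      LinearMap.ext₂ fun x y => by
        rw [LinearMap.compr₂_apply, gradingCocycle_apply, gradingComponent_apply]; rfl
    have h2 : d₂ (mBracket ω) (extAdj ω) 1 (gradingCocycle ω φ) = 0 := by
      refine d₂_d₁ _ _ (mBracket_apply ω) ?_ ?_ ?_ ?_ 1 _
      · intro s t p
        simp only [extAdj_apply, adj_SS]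
        refine Prod.ext (by simp) ?_
        simp [adj_apply, dirac_symm ω t s, two_smul]
        abel
      · intro s v p
        simp only [extAdj_apply]
        simp [adj_apply]
      · intro s v p
        simp only [extAdj_apply]
        simp [adj_apply]
      · intro v x p
        simp only [extAdj_apply]
        simp [adj_apply]
    have h3 := d₂_compr (mBracket ω) (act := adj ω) (act' := extAdj ω)
      (LinearMap.inr ℝ ℝ (Poincare η S)) (fun x p => by rw [extAdj_apply]; simp) 1
      (gradingComponent ω φ) x y z
    rw [← h1, h2] at h3
    exact (congrArg Prod.snd h3).symm

theorem gradingComponent_equivariant (A : So η) (φ : Module.Dual ℝ S) :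
    soC₂ ω A (gradingComponent ω φ) = gradingComponent ω (dualRep (spin η S) A φ) := by
  refine LinearMap.ext₂ fun x y => ?_
  rw [soC₂_apply]
  simp only [gradingComponent_apply, soP_apply, soM_apply, dualRep_apply]
  refine Prod.ext (by simp) (Prod.ext ?_ ?_)
  · simp
  · simp; abel

/-- `φ ↦ ∂(Z ⊗ φ)` as a linear map to the cocycles. -/
def gradingMap : Module.Dual ℝ S →ₗ[ℝ] Z₂ ω 1 where
  toFun φ := ⟨gradingComponent ω φ, gradingComponent_mem ω φ⟩
  map_add' φ φ' := Subtype.ext (LinearMap.ext₂ fun x y => by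
    simp only [Submodule.coe_add, LinearMap.add_apply, gradingComponent_apply]
    refine Prod.ext (by simp) (Prod.ext ?_ ?_)
    · simp [add_smul]; abel
    · simp [add_smul, mul_add]; abel)
  map_smul' r φ := Subtype.ext (LinearMap.ext₂ fun x y => by
    simp only [Submodule.coe_smul, LinearMap.smul_apply, gradingComponent_apply]
    refine Prod.ext (by simp) (Prod.ext ?_ ?_)
    · simp; module
    · simp; module)

/-- The `1`-cochain of degree `1` with components `μ : S → so(V)` and `l : V → S`. -/
def cochainOne (μ : S →ₗ[ℝ] So η) (l : V →ₗ[ℝ] S) : S × V →ₗ[ℝ] Poincare η S :=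
  (μ ∘ₗ LinearMap.fst ℝ S V).prod ((l ∘ₗ LinearMap.snd ℝ S V).prod 0)

theorem cochainOne_apply (μ : S →ₗ[ℝ] So η) (l : V →ₗ[ℝ] S) (x : S × V) :
    cochainOne μ l x = (μ x.1, l x.2, 0) := rfl

theorem cochainOne_mem (μ : S →ₗ[ℝ] So η) (l : V →ₗ[ℝ] S) :
    cochainOne μ l ∈ C₁ (grade η S) 1 := by
  intro i x hx
  rw [cochainOne_apply]
  exact ⟨fun h => by simp [hx.1 (by omega)], fun h => by simp [hx.2 (by omega)], fun _ => rfl⟩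

theorem exists_cochainOne {b : S × V →ₗ[ℝ] Poincare η S} (hb : b ∈ C₁ (grade η S) 1) :
    ∃ μ l, b = cochainOne μ l := by
  refine ⟨LinearMap.fst ℝ (So η) (S × V) ∘ₗ b ∘ₗ LinearMap.inl ℝ S V,
    LinearMap.fst ℝ S V ∘ₗ LinearMap.snd ℝ (So η) (S × V) ∘ₗ b ∘ₗ LinearMap.inr ℝ S V,
    ext_m (fun s => ?_) fun v => ?_⟩
  · rw [cochainOne_apply, map_zero]
    exact mem_grade_zero (hb _ _ (mGrade_left s))
  · rw [cochainOne_apply, map_zero]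
    exact mem_grade_neg_one (hb _ _ (mGrade_right v))

/-- The differential of `cochainOne μ l`. -/
theorem d₁_cochainOne (μ : S →ₗ[ℝ] So η) (l : V →ₗ[ℝ] S) (x y : S × V) :
    d₁ (mBracket ω) (adj ω) 1 (cochainOne μ l) x y =
      (0, spin η S (μ y.1) x.1 + spin η S (μ x.1) y.1 - l (dirac ω x.1 y.1),
        vec η (μ x.1) y.2 - vec η (μ y.1) x.2 - dirac ω x.1 (l y.2) + dirac ω y.1 (l x.2)) := by
  obtain ⟨s, v⟩ := x
  obtain ⟨t, x⟩ := y
  rw [d₁_apply _ _ (mBracket_apply ω)]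
  simp only [cochainOne_apply, adj_apply, eps_one, map_zero]
  refine Prod.ext (by simp) (Prod.ext ?_ ?_)
  · simp
  · simp; abel

/-- The component on `S × S × S` of the cocycle condition in degree `1`. -/
theorem cocycle_one {z : S × V →ₗ[ℝ] S × V →ₗ[ℝ] Poincare η S} (hz : z ∈ Z₂ ω 1) (s : S) :
    dirac ω s (z (s, 0) (s, 0)).2.1 = (z (s, 0) (0, dirac ω s s)).2.2 := by
  have h := d₂_homog (mBracket ω) (adj ω) 1 z (Or.inl rfl) (Or.inl rfl) (Or.inl rfl)
    (mGrade_left s) (mGrade_left s) (mGrade_left s)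
  rw [show d₂ (mBracket ω) (adj ω) 1 z = 0 from hz.2] at h
  have e1 : eps (-1 * 1) = -1 := by rw [show (-1 * 1 : ℤ) = -1 by norm_num, eps_neg, eps_one]
  have e2 : eps (-1 * (1 + -1)) = 1 := by rw [show (-1 * (1 + -1) : ℤ) = 0 by norm_num, eps_zero]
  have e3 : eps (-1 * (1 + -1 + -1)) = -1 := by
    rw [show (-1 * (1 + -1 + -1) : ℤ) = 1 by norm_num, eps_one]
  rw [e1, e2, e3, eps_ss, mBracket_apply] at h
  dsimp only at h
  rw [C₂_skew_left hz.1] at h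
  have h1 := congrArg (fun p : Poincare η S => p.2.2) h
  simp [adj_apply] at h1
  -- On three equal odd arguments the three terms of each kind coincide.
  have h2 : (3 : ℝ) • (dirac ω s (z (s, 0) (s, 0)).2.1 - (z (s, 0) (0, dirac ω s s)).2.2) = 0 := by
    rw [← neg_eq_zero]
    refine Eq.trans ?_ h1.symm
    module
  exact sub_eq_zero.1 ((smul_eq_zero.1 h2).resolve_left (by norm_num))

end DegreeOneCochains

/-! ### The six-fold component of ∂(Z ⊗ φ) -/

section NormalForm

variable {S : Type*} [AddCommGroup S] [Module ℝ S]

/-- The map `C ↦ 13 C ψ - ∑ ± g_i g_c C g_c g_i ψ + 2 ∑ ± tr(g_a C) g_a ψ`, which describes the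
cocycle `∂(Z ⊗ ⟨ψ,-⟩)` modulo a coboundary. -/
def gradingFierz (g : Fin 11 → Module.End ℝ S) (ψ : S) : Module.End ℝ S →ₗ[ℝ] S :=
  (13 : ℝ) • LinearMap.applyₗ ψ -
    ∑ i, ∑ c, (sgn i * sgn c) • (g i * g c) ∘ₗ LinearMap.applyₗ (g c (g i ψ)) +
    ∑ a, (2 * sgn a) • (LinearMap.trace ℝ S ∘ₗ LinearMap.mulLeft ℝ (g a)).smulRight (g a ψ)

variable {g : Fin 11 → Module.End ℝ S}

theorem gradingFierz_apply (ψ : S) (C : Module.End ℝ S) : gradingFierz g ψ C =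
    (13 : ℝ) • C ψ - ∑ i, ∑ c, (sgn i * sgn c) • g i (g c (C (g c (g i ψ)))) +
      ∑ a, (2 * sgn a) • LinearMap.trace ℝ S (g a * C) • g a ψ := by
  simp [gradingFierz, LinearMap.sum_apply]

/-- Since sgn i · g_i γ_K g_i = −χ_K(i) γ_K, the double sum has coefficient (11 − 2 · 6)² = 1, and
the traces vanish for |K| = 6. Hence 13 − 1 = 12; that it is not zero makes the classes of ∂(Z ⊗ φ)
nontrivial. -/
theorem IsIrreducibleGamma.gradingFierz_gamma (hg : IsIrreducibleGamma g) (ψ : S)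
    {K : Finset (Fin 11)} (hK : K.card = 6) :
    gradingFierz g ψ (gamma g K) = (12 : ℝ) • gamma g K ψ := by
  have hKe : Even K.card := by rw [hK]; decide
  have h1 : ∀ i u, sgn i • g i (gamma g K (g i u)) = -chi K i • gamma g K u := by
    intro i u
    rw [← Module.End.mul_apply (g i), hg.mul_gamma_even hKe, LinearMap.smul_apply,
      Module.End.mul_apply, ← Module.End.mul_apply (g i), hg.sq, LinearMap.smul_apply,
      Module.End.one_apply, map_smul, smul_smul, smul_smul]
    congr 1
    linear_combination (-chi K i) * (isSign_sgn i).mul_self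
  have h2 : ∑ i, ∑ c, (sgn i * sgn c) • g i (g c (gamma g K (g c (g i ψ)))) = gamma g K ψ := by
    have : ∀ i c, (sgn i * sgn c) • g i (g c (gamma g K (g c (g i ψ)))) =
        (chi K i * chi K c) • gamma g K ψ := by
      intro i c
      rw [mul_smul, ← map_smul, h1, map_smul, smul_comm, h1, smul_smul]
      congr 1; ring
    simp only [this, ← Finset.sum_smul]
    rw [← Finset.sum_mul_sum, sum_chi, hK]
    norm_num
  rw [gradingFierz_apply, h2, Finset.sum_eq_zero fun a _ => ?_]
  · module
  · rw [hg.trace_mul_gamma hKe, zero_smul, smul_zero]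
    intro h
    have := congrArg Finset.card h
    rw [hK, card_erase_univ] at this
    omega

end NormalForm

/-! ### Computation of the cohomology in degree 1 -/

section FirstCohomology

set_option linter.unusedSectionVars false

variable {V : Type u} [AddCommGroup V] [Module ℝ V] {η : LorentzForm V}
variable {S : Type w} [AddCommGroup S] [Module ℝ S] [Module (Cl η) S] [IsScalarTower ℝ (Cl η) S]
variable [IsSimpleModule (Cl η) S] (ω : SpinSymplectic η S)

/-- The S × V component of ∂(Z ⊗ φ) is (s,x) ↦ −2φ(s)x. It is removed with l(x) = 2 x·ψ and μ(s)x =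
−2⟨ψ,s⟩x + 2κ(s, x·ψ). The coefficient 2 is what makes μ(s) skew by the Clifford relation. -/
theorem exists_normal_form (ψ : S) : ∃ (μ : S →ₗ[ℝ] So η) (l : V →ₗ[ℝ] S), ∀ s,
    (∀ x, (gradingComponent ω (ω.form ψ) - d₁ (mBracket ω) (adj ω) 1 (cochainOne μ l))
      (s, 0) (0, x) = 0) ∧
    (gradingComponent ω (ω.form ψ) - d₁ (mBracket ω) (adj ω) 1 (cochainOne μ l)) (s, 0) (s, 0) =
      (0, gradingFierz (gam η S) ψ ((ω.form s).smulRight s), 0) := by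
  have hg := isSymplecticGamma_gam ω
  have := hg.finite
  let B : S →ₗ[ℝ] Module.End ℝ V := (-2 : ℝ) • (ω.form ψ).smulRight (1 : Module.End ℝ V) +
    (2 : ℝ) • (dirac ω).compl₂ ((cliff η S).flip ψ)
  have hB : ∀ s x, B s x = (-2 * ω.form ψ s) • x + (2 : ℝ) • dirac ω s (cliff η S x ψ) := by
    intro s x
    simp [B, smul_smul]
  have hskew : ∀ s v x, η.form (B s v) x = -η.form v (B s x) := by
    intro s v x
    have h1 := congrArg (fun M : Module.End ℝ S => ω.form s (M ψ)) (cliff_anticomm η S v x)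
    simp only [LinearMap.sub_apply, LinearMap.neg_apply, LinearMap.smul_apply, Module.End.mul_apply,
      Module.End.one_apply, map_sub, map_neg, map_smul, smul_eq_mul] at h1
    rw [hB, hB, map_add, map_add, map_smul, map_smul, map_smul, LinearMap.add_apply,
      LinearMap.smul_apply, LinearMap.smul_apply, form_dirac, map_smul, η.symm v (dirac _ _ _),
      form_dirac, hg.anticomm ψ s]
    simp only [smul_eq_mul]
    linarith
  refine ⟨soOfSkewLinear η B hskew, (2 : ℝ) • (cliff η S).flip ψ, fun s => ⟨fun x => ?_, ?_⟩⟩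
  · rw [LinearMap.sub_apply, LinearMap.sub_apply, d₁_cochainOne, gradingComponent_apply]
    simp only [vec_soOfSkewLinear, hB]
    refine Prod.ext (by simp) (Prod.ext (by simp) ?_)
    simp
  · rw [LinearMap.sub_apply, LinearMap.sub_apply, d₁_cochainOne, gradingComponent_apply]
    -- The multiple of the identity in B contributes through the terms c = i, once for each of the
    -- eleven i: 22 = 2 · 11.
    have e1 : spin η S (soOfSkewLinear η B hskew s) s = (1 / 4 : ℝ) • ((22 * ω.form ψ s) • s +
        (2 : ℝ) • ∑ i, ∑ c, (sgn i * sgn c) • ω.form s (gam η S c (gam η S i ψ)) •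
          gam η S i (gam η S c s)) := by
      rw [spin_eq_sum]
      simp only [vec_soOfSkewLinear, hB, map_add, map_smul, form_basis_dirac, η.basis_spec]
      rw [LinearMap.smul_apply, LinearMap.sum_apply]
      congr 1
      have : ∀ i, (∑ c, (sgn i * sgn c * ((-2 * ω.form ψ s) • (if c = i then sgn c else 0) +
          (2 : ℝ) • ω.form s (gam η S c (cliff η S (η.basis i) ψ)))) •
            (gam η S i * gam η S c)) s = (2 * ω.form ψ s) • s +
          (2 : ℝ) • ∑ c, (sgn i * sgn c) • ω.form s (gam η S c (gam η S i ψ)) •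
          gam η S i (gam η S c s) := by
        intro i
        have h2 : ∀ c, (sgn i * sgn c * ((-2 * ω.form ψ s) • (if c = i then sgn c else 0) +
          (2 : ℝ) • ω.form s (gam η S c (cliff η S (η.basis i) ψ)))) •
            (gam η S i * gam η S c) = (if c = i then (2 * ω.form ψ s) • 1 else 0) +
            (2 : ℝ) • (sgn i * sgn c) • ω.form s (gam η S c (gam η S i ψ)) •
              (gam η S i * gam η S c) := by
          intro c
          by_cases hc : c = i
          · subst hc
            rw [if_pos rfl, if_pos rfl, hg.sq]
            change (sgn c * sgn c * ((-2 * ω.form ψ s) * sgn c +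
              2 * ω.form s (gam η S c (gam η S c ψ)))) • (-sgn c) • 1 = _
            rw [(isSign_sgn c).mul_self, smul_smul, smul_smul, smul_smul, smul_smul, ← add_smul]
            congr 1
            linear_combination (2 * ω.form ψ s) * (isSign_sgn c).mul_self
          · rw [if_neg hc, if_neg hc, smul_zero, zero_add, zero_add, smul_smul, smul_smul]
            congr 1
            change _ * (2 * ω.form s (gam η S c (gam η S i ψ))) = _
            ring
        rw [Finset.sum_congr rfl fun c _ => h2 c, Finset.sum_add_distrib, Finset.sum_ite_eq',
          if_pos (Finset.mem_univ i), ← Finset.smul_sum]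
        simp [LinearMap.sum_apply]
      rw [Finset.sum_congr rfl fun i _ => this i, Finset.sum_add_distrib, Finset.sum_const,
        ← Finset.smul_sum, Finset.card_univ, Fintype.card_fin]
      module
    have e2 : cliff η S (dirac ω s s) ψ =
        ∑ a, sgn a • ω.form s (gam η S a s) • gam η S a ψ := by
      rw [dirac_eq_sum]
      simp [LinearMap.sum_apply, smul_smul, gam]
    have e3 : gradingFierz (gam η S) ψ ((ω.form s).smulRight s) = (-13 * ω.form ψ s) • s -
        ∑ i, ∑ c, (sgn i * sgn c) • ω.form s (gam η S c (gam η S i ψ)) •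
          gam η S i (gam η S c s) + (2 : ℝ) •
        ∑ a, sgn a • ω.form s (gam η S a s) • gam η S a ψ := by
      rw [gradingFierz_apply]
      simp only [trace_mul_rankOne, LinearMap.smulRight_apply, map_smul, hg.anticomm ψ s,
        Finset.smul_sum]
      simp only [smul_smul]
      congr 2
      · congr 1; ring
      · funext x; rw [mul_assoc]
    refine Prod.ext (by simp) (Prod.ext ?_ (by simp))
    change -(ω.form ψ s • s + ω.form ψ s • s) - (spin η S (soOfSkewLinear η B hskew s) s +
      spin η S (soOfSkewLinear η B hskew s) s - (2 : ℝ) • cliff η S (dirac ω s s) ψ) = _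
    change _ = gradingFierz (gam η S) ψ ((ω.form s).smulRight s)
    -- The 13 in `gradingFierz` collects −2⟨ψ,s⟩s from ∂(Z ⊗ φ) and −11⟨ψ,s⟩s from twice the spin
    -- action of μ(s).
    rw [e1, e2, e3]
    module

/-- The diagonal entries of the skew map μ(s) vanish, so ⟨s, g_a l(e_a)⟩ = 0 for all s. A 1-cochain
of degree 1 is therefore determined by the S × V component of its differential. -/
theorem cochainOne_eq_zero {μ : S →ₗ[ℝ] So η} {l : V →ₗ[ℝ] S}
    (h : ∀ s x, vec η (μ s) x = dirac ω s (l x)) : μ = 0 ∧ l = 0 := by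
  have hg := isSymplecticGamma_gam ω
  have hl : l = 0 := by
    refine η.basis.ext fun a => hg.injective a (hg.ext_form fun s => ?_)
    have h1 := So.skew η (μ s) (η.basis a) (η.basis a)
    rw [η.symm (η.basis a), eq_neg_iff_add_eq_zero, ← two_mul, h, form_dirac] at h1
    have h2 : ω.form s (gam η S a (l (η.basis a))) = 0 :=
      (mul_eq_zero.1 h1).resolve_left two_ne_zero
    rw [hg.anticomm, h2]
    simp
  refine ⟨LinearMap.ext fun s => So.ext_vec (LinearMap.ext fun x => ?_), hl⟩
  rw [h, hl]; simp

/-- If ∂(Z ⊗ φ) is a coboundary, so is its normal form. That one vanishes on S × V and hence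
entirely, while its component at a six-element set K is 12 γ_K ψ. -/
theorem gradingMap_eq_zero {φ : Module.Dual ℝ S} (h : gradingComponent ω φ ∈ B₂ ω 1) : φ = 0 := by
  have hg := isSymplecticGamma_gam ω
  obtain ⟨ψ, hψ⟩ := hg.exists_form φ
  obtain rfl : φ = ω.form ψ := LinearMap.ext hψ
  obtain ⟨μ, l, hW⟩ := exists_normal_form ω ψ
  have hB : gradingComponent ω (ω.form ψ) - d₁ (mBracket ω) (adj ω) 1 (cochainOne μ l) ∈
      B₂ ω 1 := sub_mem h ⟨_, cochainOne_mem μ l, rfl⟩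
  obtain ⟨b, hb, hb'⟩ := hB
  obtain ⟨μ', l', rfl⟩ := exists_cochainOne hb
  rw [← hb'] at hW
  have h0 : μ' = 0 ∧ l' = 0 := cochainOne_eq_zero ω fun s x => by
    have h1 := congrArg (fun p : Poincare η S => p.2.2) ((hW s).1 x)
    rw [d₁_cochainOne] at h1
    simpa [sub_eq_zero] using h1
  have hL : ∀ s, gradingFierz (gam η S) ψ ((ω.form s).smulRight s) = 0 := fun s => by
    have h1 := congrArg (fun p : Poincare η S => p.2.1) (hW s).2
    rw [d₁_cochainOne, h0.1, h0.2] at h1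
    simpa using h1.symm
  obtain ⟨K, -, hK⟩ := Finset.exists_subset_card_eq
    (show 6 ≤ (Finset.univ : Finset (Fin 11)).card by simp)
  have h1 := hg.eq_zero_of_skew hL (hg.skew_gamma (show K ∈ skewSets by rw [mem_skewSets, hK]))
  rw [hg.gradingFierz_gamma ψ hK] at h1
  have h2 := hg.gamma_injective K
    (((smul_eq_zero.1 h1).resolve_left (by norm_num)).trans (map_zero _).symm)
  rw [h2, map_zero]

/-- Once a coboundary has removed the S × V component, subtracting the normal form of a suitable ψ
makes the component at one six-element set vanish, and `cubic_eq_zero` makes the rest vanish. -/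
theorem exists_sub_mem_B₂ {z : S × V →ₗ[ℝ] S × V →ₗ[ℝ] Poincare η S} (hz : z ∈ Z₂ ω 1) :
    ∃ φ, gradingComponent ω φ - z ∈ B₂ ω 1 := by
  have hg := isSymplecticGamma_gam ω
  have hss : ∀ z ∈ Z₂ ω 1, ∀ s t, z (s, 0) (t, 0) = (0, (z (s, 0) (t, 0)).2.1, 0) := fun z hz s t =>
    mem_grade_neg_one (hz.1 _ _ _ (mGrade_left s) _ (mGrade_left t)).2
  have hsv : ∀ z ∈ Z₂ ω 1, ∀ s v, z (s, 0) (0, v) = (0, 0, (z (s, 0) (0, v)).2.2) := fun z hz s v =>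
    mem_grade_neg_two (hz.1 _ _ _ (mGrade_left s) _ (mGrade_right v)).2
  have hvv : ∀ z ∈ Z₂ ω 1, ∀ v x, z (0, v) (0, x) = 0 := fun z hz v x => by
    have h := (hz.1 _ _ _ (mGrade_right v) _ (mGrade_right x)).2
    exact Prod.ext (h.1 (by decide)) (Prod.ext (h.2.1 (by decide)) (h.2.2 (by decide)))
  let σ : (S × V →ₗ[ℝ] S × V →ₗ[ℝ] Poincare η S) → S →ₗ[ℝ] S →ₗ[ℝ] S := fun z =>
    (z.compl₁₂ (LinearMap.inl ℝ S V) (LinearMap.inl ℝ S V)).compr₂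
      (LinearMap.fst ℝ S V ∘ₗ LinearMap.snd ℝ (So η) (S × V))
  have hσ : ∀ z s t, σ z s t = (z (s, 0) (t, 0)).2.1 := fun z s t => rfl
  have hσs : ∀ z ∈ Z₂ ω 1, ∀ s t, σ z s t = σ z t s := fun z hz s t => by
    rw [hσ, hσ, C₂_symm hz.1]
  have hcyc : ∀ z ∈ Z₂ ω 1, ∀ a s, ω.form (σ z s s) (gam η S a s) =
      η.form (η.basis a) (z (s, 0) (0, dirac ω s s)).2.2 := fun z hz a s => by
    rw [← cocycle_one ω hz s, form_basis_dirac, (hg.skew a).comm hg.alt]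
    rfl
  -- the component on `S × V` is a coboundary
  have step1 : ∃ (μ : S →ₗ[ℝ] So η) (l : V →ₗ[ℝ] S), ∀ s x,
      (z (s, 0) (0, x)).2.2 = vec η (μ s) x - dirac ω s (l x) := by
    have hψ : ∀ a b, ∃ ψ, ∀ s, η.form (η.basis a) (z (s, 0) (0, η.basis b)).2.2 = ω.form ψ s :=
      fun a b => hg.exists_form (η.form (η.basis a) ∘ₗ LinearMap.snd ℝ S V ∘ₗ
        LinearMap.snd ℝ (So η) (S × V) ∘ₗ z.flip (0, η.basis b) ∘ₗ LinearMap.inl ℝ S V)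
    choose ψ hψ using hψ
    -- With this l the map x ↦ z(s,x) + κ(s, l x) is η-skew, so it defines a map S → so(V).
    obtain ⟨l, hl⟩ := hg.exists_symmetric_part (hσs z hz) ψ fun a s => by
      rw [hcyc z hz, dirac_eq_sum]
      have : ∀ v : Fin 11 → ℝ, (z (s, 0) (0, ∑ b, v b • η.basis b)).2.2 =
          ∑ b, v b • (z (s, 0) (0, η.basis b)).2.2 := fun v => by
        have := map_sum (LinearMap.snd ℝ S V ∘ₗ LinearMap.snd ℝ (So η) (S × V) ∘ₗ z (s, 0) ∘ₗ
          LinearMap.inr ℝ S V) (fun b => v b • η.basis b) Finset.univ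
        simp only [map_smul] at this
        exact this
      rw [this, map_sum]
      refine Finset.sum_congr rfl fun b _ => ?_
      rw [map_smul, hψ, smul_eq_mul, mul_assoc]
    let l' : V →ₗ[ℝ] S := η.basis.constr ℝ l
    have hl' : ∀ b, l' (η.basis b) = l b := fun b => η.basis.constr_basis ℝ l b
    let B : S →ₗ[ℝ] Module.End ℝ V := (z.compl₁₂ (LinearMap.inl ℝ S V) (LinearMap.inr ℝ S V)).compr₂
      (LinearMap.snd ℝ S V ∘ₗ LinearMap.snd ℝ (So η) (S × V)) + (dirac ω).compl₂ l'
    have hB : ∀ s x, B s x = (z (s, 0) (0, x)).2.2 + dirac ω s (l' x) := fun s x => rfl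
    have hskew : ∀ s v x, η.form (B s v) x = -η.form v (B s x) := by
      intro s v x
      have h1 : η.form ∘ₗ B s + (η.form ∘ₗ B s).flip = 0 := by
        refine η.basis.ext fun a => η.basis.ext fun b => ?_
        change η.form (B s (η.basis a)) (η.basis b) + η.form (B s (η.basis b)) (η.basis a) = 0
        have h2 := congrArg (fun u => ω.form u s) (hl a b)
        simp only [map_add, LinearMap.add_apply] at h2
        rw [hg.anticomm (gam η S a (l b)), hg.anticomm (gam η S b (l a))] at h2
        rw [hB, hB, map_add, map_add, LinearMap.add_apply, LinearMap.add_apply,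
          η.symm _ (η.basis b), η.symm _ (η.basis a), hψ, hψ, form_dirac, form_dirac, hl', hl']
        change ω.form (ψ b a) s + ω.form s (gam η S b (l a)) +
          (ω.form (ψ a b) s + ω.form s (gam η S a (l b))) = 0
        linarith
      have h2 := LinearMap.congr_fun₂ h1 v x
      change η.form (B s v) x + η.form (B s x) v = 0 at h2
      rw [η.symm v]
      linarith
    refine ⟨soOfSkewLinear η B hskew, l', fun s x => ?_⟩
    rw [vec_soOfSkewLinear, hB, add_sub_cancel_right]
  obtain ⟨μ, l, hμ⟩ := step1
  set z₁ := z - d₁ (mBracket ω) (adj ω) 1 (cochainOne μ l) with hz₁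
  have hb₁ : d₁ (mBracket ω) (adj ω) 1 (cochainOne μ l) ∈ B₂ ω 1 := ⟨_, cochainOne_mem μ l, rfl⟩
  have hz₁m : z₁ ∈ Z₂ ω 1 := sub_mem hz (B₂_le_Z₂ ω 1 hb₁)
  have hβ₁ : ∀ s x, z₁ (s, 0) (0, x) = 0 := fun s x => by
    rw [hz₁, LinearMap.sub_apply, LinearMap.sub_apply, hsv z hz, hμ, d₁_cochainOne]
    refine Prod.ext (by simp) (Prod.ext (by simp) (by simp))
  obtain ⟨L, hL⟩ := hg.exists_linear (σ z₁)
  obtain ⟨K, -, hK⟩ := Finset.exists_subset_card_eq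
    (show 6 ≤ (Finset.univ : Finset (Fin 11)).card by simp)
  -- The factor 12 is that of `gradingFierz_gamma`, so the normal form of ψ agrees with L at γ_K.
  set ψ := (1 / 12 : ℝ) • gammaCoeff (gam η S) L K with hψ
  obtain ⟨μ', l', hW⟩ := exists_normal_form ω ψ
  set W := gradingComponent ω (ω.form ψ) - d₁ (mBracket ω) (adj ω) 1 (cochainOne μ' l') with hWdef
  have hb₂ : d₁ (mBracket ω) (adj ω) 1 (cochainOne μ' l') ∈ B₂ ω 1 := ⟨_, cochainOne_mem μ' l', rfl⟩
  have hWm : W ∈ Z₂ ω 1 := sub_mem (gradingComponent_mem ω _) (B₂_le_Z₂ ω 1 hb₂)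
  have hm := sub_mem hz₁m hWm
  have hβ : ∀ s x, (z₁ - W) (s, 0) (0, x) = 0 := fun s x => by
    rw [LinearMap.sub_apply, LinearMap.sub_apply, hβ₁, (hW s).1, sub_zero]
  have h0 : z₁ - W = 0 := by
    refine C₂_ext hm.1 (zero_mem _) (fun s t => ?_) hβ (hvv _ hm)
    rw [hss _ hm, ← hσ]
    refine (congrArg (fun u => ((0, u, 0) : Poincare η S)) (hg.cubic_eq_zero (hσs _ hm)
      (L := L - gradingFierz (gam η S) ψ) (fun s => ?_) (fun a s => ?_) hK ?_ s t)).trans rfl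
    · have h1 := congrArg (fun p : Poincare η S => p.2.1) (hW s).2
      change (W (s, 0) (s, 0)).2.1 = gradingFierz (gam η S) ψ ((ω.form s).smulRight s) at h1
      rw [LinearMap.sub_apply, hL, ← h1]
      rfl
    · rw [hcyc _ hm, hβ]; simp
    · rw [LinearMap.sub_apply, hg.gradingFierz_gamma ψ hK, ← hg.gamma_gammaCoeff L K, hψ, map_smul,
        smul_smul]
      norm_num
  refine ⟨ω.form ψ, ?_⟩
  have e : gradingComponent ω (ω.form ψ) - z = d₁ (mBracket ω) (adj ω) 1 (cochainOne μ' l') -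
      d₁ (mBracket ω) (adj ω) 1 (cochainOne μ l) := by
    rw [hz₁, hWdef] at h0
    rw [← sub_eq_zero, ← neg_eq_zero]
    refine Eq.trans ?_ h0
    abel
  rw [e]
  exact sub_mem hb₂ hb₁

/-- The isomorphism `φ ↦ [∂(Z ⊗ φ)]`. -/
def gradingEquiv : Module.Dual ℝ S ≃ₗ[ℝ] H₂ ω 1 :=
  LinearEquiv.ofBijective (cls ω 1 ∘ₗ gradingMap ω) (by
    constructor
    · refine (injective_iff_map_eq_zero _).2 fun φ h => gradingMap_eq_zero ω ?_
      have h1 : gradingMap ω φ ∈ (B₂ ω 1).submoduleOf (Z₂ ω 1) :=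
        (Submodule.Quotient.mk_eq_zero _).1 h
      exact h1
    · intro h
      obtain ⟨z, rfl⟩ := cls_surjective ω 1 h
      obtain ⟨φ, hφ⟩ := exists_sub_mem_B₂ ω z.2
      exact ⟨φ, (Submodule.Quotient.eq _).2 hφ⟩)

theorem gradingEquiv_apply (φ : Module.Dual ℝ S) :
    gradingEquiv ω φ = cls ω 1 (gradingMap ω φ) := rfl

theorem intertwines_gradingEquiv :
    Intertwines (dualRep (spin η S)) (soH ω 1) (gradingEquiv ω) := fun A φ => by
  rw [gradingEquiv_apply, gradingEquiv_apply]
  change _ = soHLin ω 1 A _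
  rw [soHLin_cls]
  exact congrArg _ (Subtype.ext (gradingComponent_equivariant ω A φ).symm)

/-- The isomorphism `S ≅ S^*` given by the symplectic structure. -/
def dualEquiv : S ≃ₗ[ℝ] Module.Dual ℝ S :=
  LinearEquiv.ofBijective ω.form ⟨fun _ _ h => (isSymplecticGamma_gam ω).ext_form fun u =>
    LinearMap.congr_fun h u, fun φ =>
      ((isSymplecticGamma_gam ω).exists_form φ).imp fun _ hs => (LinearMap.ext hs).symm⟩

theorem intertwines_dualEquiv : Intertwines (spin η S) (dualRep (spin η S)) (dualEquiv ω) :=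
  fun A s => LinearMap.ext fun t => eq_neg_of_add_eq_zero_left (ω.invariant A s t)

theorem exists_intertwines_one : ∃ e : H₂ ω 1 ≃ₗ[ℝ] S, Intertwines (soH ω 1) (spin η S) e :=
  ⟨_, ((intertwines_dualEquiv ω).trans (intertwines_gradingEquiv ω)).symm⟩

end FirstCohomology

/-! ### Operator-valued cubic equations -/

section FierzCubic

variable {S : Type*} [AddCommGroup S] [Module ℝ S] {ι : Type*} [Fintype ι]
variable {g : Fin 11 → Module.End ℝ S} {ω : LinearMap.BilinForm ℝ S}

/-- The polarisation of the cubic map `s ↦ ∑ₖ ⟨s, Aₖ s⟩ Bₖ s`, where `A'ₖ` is the adjoint of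
`Aₖ`, as a function of the rank one operator `⟨s,-⟩ s`. -/
def fierzCubic (A A' B : ι → Module.End ℝ S) : Module.End ℝ S →ₗ[ℝ] Module.End ℝ S :=
  ∑ k, ((LinearMap.trace ℝ S ∘ₗ LinearMap.mulLeft ℝ (A k)).smulRight (B k) +
    LinearMap.mulRight ℝ (A k - A' k) ∘ₗ LinearMap.mulLeft ℝ (B k))

theorem fierzCubic_apply (A A' B : ι → Module.End ℝ S) (C : Module.End ℝ S) :
    fierzCubic A A' B C =
      ∑ k, (LinearMap.trace ℝ S (A k * C) • B k + B k * C * (A k - A' k)) := by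
  simp [fierzCubic, LinearMap.sum_apply]

theorem fierzCubic_rankOne [Module.Finite ℝ S] (ω : LinearMap.BilinForm ℝ S)
    (A A' B : ι → Module.End ℝ S) (s u : S) :
    fierzCubic A A' B ((ω s).smulRight s) u =
      ∑ k, (ω s (A k s) • B k u + (ω s (A k u) - ω s (A' k u)) • B k s) := by
  rw [fierzCubic_apply, LinearMap.sum_apply]
  refine Finset.sum_congr rfl fun k _ => ?_
  simp [trace_mul_rankOne]

variable {A A' B : ι → Module.End ℝ S}

/-- At ⟨s,-⟩s the operator `fierzCubic` is the derivative at s of the cubic map, hence zero;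
`eq_zero_of_skew` extends this to all skew C. -/
theorem IsSymplecticGamma.fierzCubic_eq_zero (hg : IsSymplecticGamma g ω)
    (hA : ∀ k s t, ω (A k s) t = ω s (A' k t)) (h : ∀ s, ∑ k, ω s (A k s) • B k s = 0)
    {C : Module.End ℝ S} (hC : IsSkew ω C) : fierzCubic A A' B C = 0 := by
  have := hg.finite
  refine hg.eq_zero_of_skew (fun s => LinearMap.ext fun u => ?_) hC
  let T : S →ₗ[ℝ] S →ₗ[ℝ] S →ₗ[ℝ] S := ∑ k, (ω.compl₂ (A k) + (ω.compl₂ (A k)).flip).compr₂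
    (LinearMap.toSpanSingleton ℝ (Module.End ℝ S) (B k))
  have hT : ∀ s t u, T s t u = ∑ k, (ω s (A k t) + ω t (A k s)) • B k u := fun s t u => by
    simp [T, LinearMap.sum_apply]
  have h1 := polarize_cubic T (fun s t u => by simp only [hT, add_comm]) (fun s => by
    rw [hT]; simp only [add_smul, Finset.sum_add_distrib, h, add_zero]) s u
  have h2 : T s s u + (2 : ℝ) • T s u s =
      (2 : ℝ) • fierzCubic A A' B ((ω s).smulRight s) u := by
    rw [fierzCubic_rankOne, hT, hT, Finset.smul_sum, Finset.smul_sum, ← Finset.sum_add_distrib]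
    refine Finset.sum_congr rfl fun k _ => ?_
    rw [hg.anticomm u, hA]
    module
  rw [h2] at h1
  rw [(smul_eq_zero.1 h1).resolve_left two_ne_zero, LinearMap.zero_apply]

/-- Euler's identity: the derivative in the direction of s is three times the cubic map. -/
theorem IsSymplecticGamma.sum_eq_zero_of_fierzCubic (hg : IsSymplecticGamma g ω)
    (hA : ∀ k s t, ω (A k s) t = ω s (A' k t))
    (h : ∀ K ∈ skewSets, fierzCubic A A' B (gamma g K) = 0) (s : S) :
    ∑ k, ω s (A k s) • B k s = 0 := by
  have := hg.finite
  have h1 := LinearMap.congr_fun (hg.eq_zero_of_gamma h s) s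
  rw [fierzCubic_rankOne] at h1
  have h2 : (3 : ℝ) • ∑ k, ω s (A k s) • B k s = 0 := by
    rw [LinearMap.zero_apply] at h1
    rw [← h1, Finset.smul_sum]
    refine Finset.sum_congr rfl fun k _ => ?_
    rw [← hA, hg.anticomm (A k s)]
    module
  exact (smul_eq_zero.1 h2).resolve_left (by norm_num)

end FierzCubic

/-! ### The signed sums of the degree 2 equation -/

section SignSums

theorem chi_symmDiff (I J : Finset (Fin 11)) (a : Fin 11) :
    chi (symmDiff I J) a = chi I a * chi J a := by
  unfold chi
  by_cases h1 : a ∈ I <;> by_cases h2 : a ∈ J <;> simp [Finset.mem_symmDiff, h1, h2]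

theorem card_symmDiff_add (I J : Finset (Fin 11)) :
    (symmDiff I J).card + 2 * (I ∩ J).card = I.card + J.card := by
  have h1 := Finset.card_sdiff_add_card_inter I J
  have h2 := Finset.card_sdiff_add_card_inter J I
  rw [Finset.inter_comm J I] at h2
  rw [symmDiff_def, Finset.sup_eq_union, Finset.card_union_of_disjoint disjoint_sdiff_sdiff]
  omega

/-- The coefficient of `gamma K * gamma J` in the cubic equation of degree `2`. -/
def cubicCoeff (f : Fin 11 → ℝ) (J K : Finset (Fin 11)) : ℝ :=
  ∑ i, ∑ c, (if i = c then 0 else 1 / 2 * f i * (chi K i * chi K c * (1 + chi J i * chi J c) +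
    if symmDiff J K = {i, c} then 32 * pairSign J K else 0)) +
  ∑ a, f a * (2 * pairSign J K * (chi J a * chi K a) +
    if K = Finset.univ.erase a then 32 else 0)

theorem sum_pair_eq (D : Finset (Fin 11)) (F : Fin 11 → ℝ) :
    ∑ i, ∑ c, (if i = c then 0 else if D = {i, c} then F i else 0) =
      if D.card = 2 then ∑ i ∈ D, F i else 0 := by
  split_ifs with hD
  · rw [← Finset.sum_subset (Finset.subset_univ D)]
    · refine Finset.sum_congr rfl fun i hi => ?_
      obtain ⟨x, hx⟩ := Finset.card_eq_one.1
        (show (D.erase i).card = 1 by rw [Finset.card_erase_of_mem hi, hD])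
      have hD' : D = {i, x} := by rw [← Finset.insert_erase hi, hx]
      have hxi : x ≠ i := by
        rintro rfl
        have : x ∈ D.erase x := by rw [hx]; simp
        simp at this
      rw [Finset.sum_eq_single x]
      · rw [if_neg (Ne.symm hxi), if_pos hD']
      · intro c _ hc
        split_ifs with h1 h2
        · rfl
        · exfalso
          have : x ∈ ({i, c} : Finset (Fin 11)) := by rw [← h2, hD']; simp
          simp only [Finset.mem_insert, Finset.mem_singleton] at this
          exact this.elim hxi (Ne.symm hc)
        · rfl
      · simp
    · intro i _ hi
      refine Finset.sum_eq_zero fun c _ => ?_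
      split_ifs with h1 h2
      · rfl
      · exact absurd (by rw [h2]; simp) hi
      · rfl
  · refine Finset.sum_eq_zero fun i _ => Finset.sum_eq_zero fun c _ => ?_
    split_ifs with h1 h2
    · rfl
    · exact absurd (by rw [h2, Finset.card_pair h1]) hD
    · rfl

/-- For coefficients affine in χ_J the sums factor through the sums of χ over K, J ∆ K and J, that
is, through cardinalities. The last two terms are the exceptional traces, for |J ∆ K| = 2 and for
|K| = 10. -/
theorem cubicCoeff_eq (x y : ℝ) (J K : Finset (Fin 11)) {P Q R : ℝ} (hP : ∑ i, chi K i = P)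
    (hQ : ∑ i, chi (symmDiff J K) i = Q) (hR : ∑ i, chi J i = R) :
    cubicCoeff (fun i => x + y * chi J i) J K =
      1 / 2 * x * (P ^ 2 + Q ^ 2) + y * (P * Q) - 11 * x - y * R +
      2 * pairSign J K * (x * Q + y * P) +
      (if (symmDiff J K).card = 2 then
        16 * pairSign J K * (x * (symmDiff J K).card + y * ((R - P) / 2)) else 0) +
      ∑ a, (if K = Finset.univ.erase a then 32 * (x + y * chi J a) else 0) := by
  have e1 : ∑ i, ∑ c, (if i = c then 0 else 1 / 2 * (x + y * chi J i) *
      (chi K i * chi K c * (1 + chi J i * chi J c) +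
        if symmDiff J K = {i, c} then 32 * pairSign J K else 0)) =
      ∑ i, ∑ c, (1 / 2 * (x + y * chi J i) * (chi K i * chi K c * (1 + chi J i * chi J c)) -
        (if i = c then x + y * chi J i else 0) + (if i = c then 0 else
        if symmDiff J K = {i, c} then 16 * pairSign J K * (x + y * chi J i) else 0)) := by
    refine Finset.sum_congr rfl fun i _ => Finset.sum_congr rfl fun c _ => ?_
    by_cases hic : i = c
    · subst hic
      simp only [if_true, (isSign_chi _ _).mul_self]
      ring
    · simp only [if_neg hic]
      split_ifs <;> ring
  have e2 : ∀ i, ∑ c, 1 / 2 * (x + y * chi J i) * (chi K i * chi K c * (1 + chi J i * chi J c)) =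
      1 / 2 * x * (P * chi K i + Q * chi (symmDiff J K) i) +
      1 / 2 * y * (P * chi (symmDiff J K) i + Q * chi K i) := by
    intro i
    have : ∀ c, 1 / 2 * (x + y * chi J i) * (chi K i * chi K c * (1 + chi J i * chi J c)) =
        (1 / 2 * (x + y * chi J i) * chi K i) * chi K c +
        (1 / 2 * (x + y * chi J i) * (chi J i * chi K i)) * chi (symmDiff J K) c := fun c => by
      rw [chi_symmDiff]; ring
    rw [Finset.sum_congr rfl fun c _ => this c, Finset.sum_add_distrib, ← Finset.mul_sum,
      ← Finset.mul_sum, hP, hQ, chi_symmDiff]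
    linear_combination (1 / 2 * y * Q * chi K i) * (isSign_chi J i).mul_self
  have e3 : ∑ i ∈ symmDiff J K, chi J i = (R - P) / 2 := by
    rw [← hR, ← hP, ← Finset.sum_sub_distrib, Finset.sum_div,
      ← Finset.sum_subset (Finset.subset_univ (symmDiff J K))]
    · refine Finset.sum_congr rfl fun i hi => ?_
      have h : chi (symmDiff J K) i = -1 := if_pos hi
      rw [chi_symmDiff] at h
      linear_combination (1 / 2 * chi J i) * h - (1 / 2 * chi K i) * (isSign_chi J i).mul_self
    · intro i _ hi
      have h : chi (symmDiff J K) i = 1 := if_neg hi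
      rw [chi_symmDiff] at h
      linear_combination (1 / 2 * chi K i) * (isSign_chi J i).mul_self - (1 / 2 * chi J i) * h
  have s1 : ∑ i, ∑ c, 1 / 2 * (x + y * chi J i) * (chi K i * chi K c * (1 + chi J i * chi J c)) =
      1 / 2 * x * (P ^ 2 + Q ^ 2) + y * (P * Q) := by
    rw [Finset.sum_congr rfl fun i _ => e2 i]
    simp only [Finset.sum_add_distrib, ← Finset.mul_sum, hP, hQ]
    ring
  have s2 : ∑ i, (x + y * chi J i) = 11 * x + y * R := by
    rw [Finset.sum_add_distrib, ← Finset.mul_sum, hR]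
    simp
  have s4 : ∑ a, (x + y * chi J a) * (2 * pairSign J K * (chi J a * chi K a) +
      if K = Finset.univ.erase a then 32 else 0) = 2 * pairSign J K * (x * Q + y * P) +
      ∑ a, (if K = Finset.univ.erase a then 32 * (x + y * chi J a) else 0) := by
    have : ∀ a, (x + y * chi J a) * (2 * pairSign J K * (chi J a * chi K a) +
        if K = Finset.univ.erase a then 32 else 0) =
        2 * pairSign J K * x * chi (symmDiff J K) a + 2 * pairSign J K * y * chi K a +
        if K = Finset.univ.erase a then 32 * (x + y * chi J a) else 0 := fun a => by
      rw [chi_symmDiff]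
      split_ifs <;>
        linear_combination (2 * pairSign J K * y * chi K a) * (isSign_chi J a).mul_self
    rw [Finset.sum_congr rfl fun a _ => this a]
    simp only [Finset.sum_add_distrib, ← Finset.mul_sum, hP, hQ]
    ring
  have s5 : ∑ i ∈ symmDiff J K, 16 * pairSign J K * (x + y * chi J i) =
      16 * pairSign J K * (x * (symmDiff J K).card + y * ((R - P) / 2)) := by
    rw [← Finset.mul_sum, Finset.sum_add_distrib, ← Finset.mul_sum, e3, Finset.sum_const,
      nsmul_eq_mul, mul_comm x]
  rw [cubicCoeff, e1, s4]
  simp only [Finset.sum_add_distrib, Finset.sum_sub_distrib, s1, sum_pair_eq, Finset.sum_ite_eq,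
    Finset.mem_univ, if_true, s2, s5]
  ring

/-- By the closed form only |K| ∈ {2, 6, 10} and |J ∩ K| ≤ 4 matter, and the finitely many cases are
checked. -/
theorem cubicCoeff_four {J K : Finset (Fin 11)} (hJ : J.card = 4) (hK : K ∈ skewSets) (r : ℝ) :
    cubicCoeff (fun i => r * (1 - 3 * chi J i)) J K = 0 := by
  have h1 : (fun i => r * (1 - 3 * chi J i)) = fun i => r + (-3 * r) * chi J i :=
    funext fun i => by ring
  have h2 := card_symmDiff_add J K
  have h3 : K.card ≤ 11 := (Finset.card_le_univ K).trans (by simp)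
  have h4 : (symmDiff J K).card ≤ 11 := (Finset.card_le_univ _).trans (by simp)
  have h5 := Finset.card_le_card (Finset.inter_subset_left (s₁ := J) (s₂ := K))
  have h6 := Finset.card_le_card (Finset.inter_subset_right (s₁ := J) (s₂ := K))
  have h7 : (J ∪ K).card ≤ 11 := (Finset.card_le_univ _).trans (by simp)
  have h8 := Finset.card_union_add_card_inter J K
  rw [mem_skewSets] at hK
  rw [hJ] at h2 h5 h8
  -- A ten-element K is the complement of a single a, and then χ_J(a) = `pairSign J K`, as |J| is
  -- even.
  have hB : ∑ a, (if K = Finset.univ.erase a then 32 * (r + -3 * r * chi J a) else 0) =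
      if K.card = 10 then 32 * (r + -3 * r * pairSign J K) else 0 := by
    split_ifs with hc
    · obtain ⟨a, ha⟩ := Finset.card_eq_one.1 (show Kᶜ.card = 1 by
        rw [Finset.card_compl, hc]; rfl)
      have hKa : K = Finset.univ.erase a := by
        rw [← compl_compl K, ha]; ext; simp
      rw [Finset.sum_eq_single a, if_pos hKa, hKa, pairSign_erase_univ (by rw [hJ]; decide)]
      · intro b _ hb
        rw [if_neg]
        intro h
        exact hb (erase_univ_injective (h.symm.trans hKa))
      · simp
    · refine Finset.sum_eq_zero fun a _ => if_neg ?_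
      rintro rfl
      exact hc (card_erase_univ a)
  rw [h1, cubicCoeff_eq _ _ J K (sum_chi K) (sum_chi _) (sum_chi J), hB, hJ, pairSign_eq]
  generalize (symmDiff J K).card = d at *
  generalize (J ∩ K).card = m at *
  generalize K.card = n at *
  obtain rfl : d = 4 + n - 2 * m := by omega
  obtain rfl | rfl | rfl : n = 2 ∨ n = 6 ∨ n = 10 := by omega
  all_goals interval_cases m <;> first | omega | (norm_num; try ring)

theorem cubicCoeff_of_card_ne {x y : ℝ} {J K : Finset (Fin 11)} {j k m : ℕ} (hj : J.card = j)
    (hk : K.card = k) (hm : (J ∩ K).card = m) (h1 : k ≠ 10) (h2 : j + k ≠ 2 * m + 2) :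
    cubicCoeff (fun i => x + y * chi J i) J K =
      1 / 2 * x * ((11 - 2 * k) ^ 2 + (11 - 2 * (j + k - 2 * m)) ^ 2) +
      y * ((11 - 2 * k) * (11 - 2 * (j + k - 2 * m))) - 11 * x - y * (11 - 2 * j) +
      2 * (-1) ^ m * (x * (11 - 2 * (j + k - 2 * m)) + y * (11 - 2 * k)) := by
  have h3 := card_symmDiff_add J K
  rw [hj, hk, hm] at h3
  have h4 : ((symmDiff J K).card : ℝ) = j + k - 2 * m := by
    rw [eq_sub_iff_add_eq]; exact_mod_cast h3
  rw [cubicCoeff_eq _ _ J K (sum_chi K) (sum_chi _) (sum_chi J), if_neg (by omega),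
    Finset.sum_eq_zero fun a _ => if_neg ?_, pairSign_eq, h4, hj, hk, hm]
  · ring
  · rintro rfl
    exact h1 (hk.symm.trans (card_erase_univ a))

/-- The solutions of the cubic equations. -/
theorem eq_of_cubicCoeff_eq_zero {J : Finset (Fin 11)} (hJ : J.card % 4 = 0) {x y : ℝ}
    (h : ∀ K ∈ skewSets, cubicCoeff (fun i => x + y * chi J i) J K = 0) :
    (J.card = 4 ∧ y = -3 * x) ∨ ∀ i, x + y * chi J i = 0 := by
  have h1 : J.card ≤ 11 := (Finset.card_le_univ J).trans (by simp)
  have h2 : Jᶜ.card = 11 - J.card := by rw [Finset.card_compl, Fintype.card_fin]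
  obtain hc | hc | hc : J.card = 0 ∨ J.card = 4 ∨ J.card = 8 := by omega
  · right
    -- A six-element set gives −12 (x + y) = 0, and χ is 1 everywhere for J = ∅.
    obtain ⟨K, -, hK⟩ := Finset.exists_subset_card_eq
      (show 6 ≤ (Finset.univ : Finset (Fin 11)).card by simp)
    have h3 := h K (by rw [mem_skewSets, hK])
    obtain rfl := Finset.card_eq_zero.1 hc
    rw [cubicCoeff_of_card_ne hc hK (m := 0) (by simp) (by decide) (by decide)] at h3
    intro i
    rw [chi, if_neg (Finset.notMem_empty i)]
    norm_num at h3
    linarith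
  · left
    refine ⟨hc, ?_⟩
    -- A pair disjoint from J gives 12 x + 4 y = 0.
    obtain ⟨K, hKJ, hK⟩ := Finset.exists_subset_card_eq (show 2 ≤ Jᶜ.card by omega)
    have h3 := h K (by rw [mem_skewSets, hK])
    rw [cubicCoeff_of_card_ne hc hK (m := 0) ?_ (by decide) (by decide)] at h3
    · norm_num at h3
      linarith
    · rw [Finset.card_eq_zero, ← Finset.disjoint_iff_inter_eq_empty]
      exact Finset.disjoint_of_subset_right hKJ disjoint_compl_right
  · right
    -- A pair inside J gives 12 (x + y) = 0, and a six-element set with five elements in J gives −12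
    -- x + 4 y = 0.
    obtain ⟨K, hKJ, hK⟩ := Finset.exists_subset_card_eq (show 2 ≤ J.card by omega)
    have h3 := h K (by rw [mem_skewSets, hK])
    rw [cubicCoeff_of_card_ne hc hK (m := 2) (by rw [Finset.inter_eq_right.2 hKJ, hK])
      (by decide) (by decide)] at h3
    obtain ⟨K₁, hK₁J, hK₁⟩ := Finset.exists_subset_card_eq (show 5 ≤ J.card by omega)
    obtain ⟨K₂, hK₂J, hK₂⟩ := Finset.exists_subset_card_eq (show 1 ≤ Jᶜ.card by omega)
    have hd : Disjoint J K₂ := Finset.disjoint_of_subset_right hK₂J disjoint_compl_right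
    have hK₁₂ : (K₁ ∪ K₂).card = 6 := by
      rw [Finset.card_union_of_disjoint (Finset.disjoint_of_subset_left hK₁J hd), hK₁, hK₂]
    have h4 := h (K₁ ∪ K₂) (by rw [mem_skewSets, hK₁₂])
    rw [cubicCoeff_of_card_ne hc hK₁₂ (m := 5) (by
      rw [Finset.inter_union_distrib_left, Finset.inter_eq_right.2 hK₁J,
        Finset.disjoint_iff_inter_eq_empty.1 hd, Finset.union_empty, hK₁])
      (by decide) (by decide)] at h4
    norm_num at h3 h4
    have hx : x = 0 := by linarith
    have hy : y = 0 := by linarith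
    intro i
    rw [hx, hy]; ring

end SignSums

/-! ### The degree 2 cocycle condition as an operator equation -/

section SpencerCubic

variable {S : Type*} [AddCommGroup S] [Module ℝ S]
variable {g : Fin 11 → Module.End ℝ S} {ω : LinearMap.BilinForm ℝ S}

/-- The operator equation equivalent to the cocycle condition in degree `2`. -/
def spencerCubic (g : Fin 11 → Module.End ℝ S) (C : Module.End ℝ S) :
    (Fin 11 → Module.End ℝ S) →ₗ[ℝ] Module.End ℝ S :=
  ∑ i, ∑ c, (if i = c then 0 else (1 / 2 * (sgn i * sgn c)) •
    ((LinearMap.trace ℝ S ∘ₗ LinearMap.mulRight ℝ C ∘ₗ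
      LinearMap.mulLeft ℝ (g c * g i)).smulRight (g i * g c) +
    LinearMap.mulLeft ℝ (g i * g c * C) ∘ₗ
      (LinearMap.mulLeft ℝ (g c * g i) - LinearMap.mulRight ℝ (g i * g c)))) ∘ₗ
    LinearMap.proj i +
  ∑ a, ((-sgn a) • (LinearMap.trace ℝ S (g a * C) • LinearMap.mulLeft ℝ (g a) +
    (2 : ℝ) • LinearMap.mulRight ℝ (C * g a) ∘ₗ LinearMap.mulLeft ℝ (g a))) ∘ₗ LinearMap.proj a

theorem spencerCubic_apply (C : Module.End ℝ S) (N : Fin 11 → Module.End ℝ S) :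
    spencerCubic g C N = ∑ i, ∑ c, (if i = c then 0 else (1 / 2 * (sgn i * sgn c)) •
      (LinearMap.trace ℝ S (g c * g i * N i * C) • (g i * g c) +
        g i * g c * C * (g c * g i * N i - N i * (g i * g c)))) +
    ∑ a, (-sgn a) • (LinearMap.trace ℝ S (g a * C) • (g a * N a) +
      (2 : ℝ) • (g a * N a * (C * g a))) := by
  rw [spencerCubic, LinearMap.add_apply, LinearMap.sum_apply, LinearMap.sum_apply]
  congr 1

/-- For a ∈ I the operator anticommutes with g_a and is traceless; for I = ∅ it is central, hence a
scalar. -/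
theorem IsIrreducibleGamma.trace_smul_of_sign (hg : IsIrreducibleGamma g) {M : Module.End ℝ S}
    {I : Finset (Fin 11)} (h : ∀ a, g a * M = chi I a • (M * g a)) :
    LinearMap.trace ℝ S M • (1 : Module.End ℝ S) = if I = ∅ then (32 : ℝ) • M else 0 := by
  split_ifs with hI
  · subst hI
    exact hg.trace_smul_one fun a => by rw [h, chi, if_neg (Finset.notMem_empty a), one_smul]
  · obtain ⟨a, ha⟩ := Finset.nonempty_of_ne_empty hI
    rw [hg.trace_eq_zero (a := a) (by rw [h, chi, if_pos ha, neg_one_smul]), zero_smul]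

theorem IsGamma.mul_pair (hg : IsGamma g) {i c : Fin 11} (hic : i ≠ c) (a : Fin 11) :
    g a * (g i * g c) = chi {i, c} a • (g i * g c * g a) := by
  rw [chi_pair hic]
  by_cases hi : i = a
  · subst hi
    rw [if_pos rfl, if_neg (Ne.symm hic), mul_assoc (g i) (g c), hg.anti c i (Ne.symm hic), mul_neg]
    module
  · by_cases hc : c = a
    · subst hc
      rw [if_neg hi, if_pos rfl, ← mul_assoc, hg.anti c i (Ne.symm hic), neg_mul]
      module
    · rw [if_neg hi, if_neg hc, ← mul_assoc, hg.anti a i (Ne.symm hi), neg_mul, mul_assoc,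
        hg.anti a c (Ne.symm hc), mul_neg, neg_neg, mul_assoc]
      module

/-- Every term is a multiple of γ_K γ_J: pairs move through products with signs, and a trace is
nonzero only when J ∆ K = {i, c} or K is the complement of a. Thus the equation decouples over J. -/
theorem IsIrreducibleGamma.spencerCubic_gamma (hg : IsIrreducibleGamma g) (f : Fin 11 → ℝ)
    {J K : Finset (Fin 11)} (hJ : Even J.card) (hK : Even K.card) :
    spencerCubic g (gamma g K) (fun i => f i • gamma g J) =
      cubicCoeff f J K • (gamma g K * gamma g J) := by
  have hJK := hg.gamma_mul_gamma_comm hJ K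
  have hcomm : ∀ a, g a * (gamma g J * gamma g K) =
      chi (symmDiff J K) a • (gamma g J * gamma g K * g a) := fun a => by
    rw [← mul_assoc, hg.mul_gamma_even hJ, smul_mul_assoc, mul_assoc, hg.mul_gamma_even hK,
      mul_smul_comm, smul_smul, chi_symmDiff, mul_assoc]
  rw [spencerCubic_apply, cubicCoeff, add_smul, Finset.sum_smul, Finset.sum_smul]
  congr 1
  · refine Finset.sum_congr rfl fun i _ => ?_
    rw [Finset.sum_smul]
    refine Finset.sum_congr rfl fun c _ => ?_
    by_cases hic : i = c
    · rw [if_pos hic, if_pos hic, zero_smul]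
    rw [if_neg hic, if_neg hic]
    have hci : g c * g i = -(g i * g c) := hg.anti c i (Ne.symm hic)
    have hsq := hg.pair_sq hic
    have e1 : LinearMap.trace ℝ S (g i * g c * (gamma g J * gamma g K)) • (g i * g c) =
        (if symmDiff J K = {i, c} then -(32 * pairSign J K * (sgn i * sgn c)) else 0) •
          (gamma g K * gamma g J) := by
      have h1 := hg.trace_smul_of_sign (I := symmDiff {i, c} (symmDiff J K))
        (M := g i * g c * (gamma g J * gamma g K)) fun a => by
          rw [← mul_assoc, hg.mul_pair hic, smul_mul_assoc, mul_assoc _ (g a), hcomm,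
            mul_smul_comm, smul_smul, chi_symmDiff J K, chi_symmDiff, chi_symmDiff,
              mul_assoc (g i * g c)]
      have h2 := congrArg (fun M => g i * g c * M) h1
      simp only [mul_smul_comm, mul_one] at h2
      rw [h2]
      have h3 : symmDiff {i, c} (symmDiff J K) = ∅ ↔ symmDiff J K = {i, c} := by
        rw [← Finset.bot_eq_empty, symmDiff_eq_bot, eq_comm]
      simp only [h3]
      split_ifs
      · rw [mul_smul_comm, ← mul_assoc (g i * g c), hsq, smul_mul_assoc, one_mul, hJK]
        module
      · rw [mul_zero, zero_smul]
    have e2 : g i * g c * gamma g K * (g i * g c * gamma g J + gamma g J * (g i * g c)) =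
        (-(sgn i * sgn c) * (chi K i * chi K c * (1 + chi J i * chi J c))) •
          (gamma g K * gamma g J) := by
      have h1 : gamma g J * (g i * g c) = (chi J i * chi J c) • (g i * g c * gamma g J) := by
        rw [hg.pair_mul_gamma hJ, ((isSign_chi J i).mul (isSign_chi J c)).smul_smul]
      rw [h1, hg.pair_mul_gamma hK, mul_add, mul_smul_comm, smul_mul_assoc, mul_assoc (gamma g K),
        ← mul_assoc (g i * g c), hsq]
      simp only [smul_mul_assoc, one_mul, mul_smul_comm]
      module
    have e3 : LinearMap.trace ℝ S (g c * g i * (f i • gamma g J) * gamma g K) • (g i * g c) +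
        g i * g c * gamma g K * (g c * g i * (f i • gamma g J) -
          (f i • gamma g J) * (g i * g c)) =
        (-f i) • (LinearMap.trace ℝ S (g i * g c * (gamma g J * gamma g K)) • (g i * g c) +
          g i * g c * gamma g K * (g i * g c * gamma g J + gamma g J * (g i * g c))) := by
      rw [hci]
      simp only [mul_smul_comm, smul_mul_assoc, neg_mul, map_neg, map_smul, smul_neg, mul_assoc,
        smul_eq_mul, mul_neg, mul_sub, mul_add]
      module
    rw [e3, e1, e2, ← add_smul, smul_smul, smul_smul]
    congr 1
    have hs : sgn i * sgn c * (sgn i * sgn c) = 1 := ((isSign_sgn i).mul (isSign_sgn c)).mul_self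
    split_ifs
    · linear_combination (1 / 2 * f i * (chi K i * chi K c * (1 + chi J i * chi J c) +
        32 * pairSign J K)) * hs
    · linear_combination (1 / 2 * f i * (chi K i * chi K c * (1 + chi J i * chi J c))) * hs
  · refine Finset.sum_congr rfl fun a _ => ?_
    have e1 : g a * (f a • gamma g J) * (gamma g K * g a) =
        (-sgn a * f a * pairSign J K * (chi J a * chi K a)) • (gamma g K * gamma g J) := by
      have h1 : gamma g J * gamma g K * g a =
          (chi J a * chi K a) • (g a * (gamma g J * gamma g K)) := by
        rw [hcomm, chi_symmDiff, ((isSign_chi J a).mul (isSign_chi K a)).smul_smul]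
      rw [mul_smul_comm, smul_mul_assoc, mul_assoc, ← mul_assoc (gamma g J), h1, mul_smul_comm,
        ← mul_assoc (g a), hg.sq, smul_mul_assoc, one_mul, hJK]
      module
    have e2 : LinearMap.trace ℝ S (g a * gamma g K) • (g a * (f a • gamma g J)) =
        (if K = Finset.univ.erase a then -sgn a * 32 * f a else 0) • (gamma g K * gamma g J) := by
      split_ifs with h
      · have h1 := hg.trace_smul_one (N := g a * gamma g K) fun b => by
          by_cases hb : b = a
          · subst hb
            rw [mul_assoc, hg.gamma_mul_even hK, chi, if_neg (by rw [h]; simp), one_smul]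
          · rw [← mul_assoc, hg.anti b a hb, neg_mul, mul_assoc, hg.mul_gamma_even hK, chi,
              if_pos (by rw [h]; simp [hb]), neg_one_smul, mul_neg, neg_neg, mul_assoc]
        have h2 := congrArg (fun M => g a * M) h1
        simp only [mul_smul_comm, mul_one] at h2
        rw [mul_smul_comm, smul_comm, ← smul_mul_assoc, h2, ← mul_assoc, hg.sq]
        simp only [smul_mul_assoc, one_mul]
        module
      · rw [hg.trace_mul_gamma hK h, zero_smul, zero_smul]
    rw [e1, e2, smul_smul, ← add_smul, smul_smul]
    congr 1
    have hs := (isSign_sgn a).mul_self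
    split_ifs
    · linear_combination (f a * (2 * pairSign J K * (chi J a * chi K a) + 32)) * hs
    · linear_combination (f a * (2 * pairSign J K * (chi J a * chi K a))) * hs

end SpencerCubic

/-! ### Solutions of the degree 2 equations -/

section DegreeTwo

variable {S : Type*} [AddCommGroup S] [Module ℝ S]
variable {g : Fin 11 → Module.End ℝ S} {ω : LinearMap.BilinForm ℝ S}

/-- For `ω`-symmetric operators `N a`, the cubic equation is equivalent to its components. -/
theorem IsSymplecticGamma.cubic_iff (hg : IsSymplecticGamma g ω) {N : Fin 11 → Module.End ℝ S}
    (hN : ∀ i s t, ω (N i s) t = ω s (N i t)) :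
    (∀ s, (1 / 2 : ℝ) • ∑ i, ∑ c, (sgn i * sgn c * ω s (g c (g i (N i s)))) • g i (g c s) =
      ∑ a, (sgn a * ω s (g a s)) • g a (N a s)) ↔
    ∀ K ∈ skewSets, spencerCubic g (gamma g K) N = 0 := by
  -- One family, indexed by the pairs (i, c) and the single indices a, writes the difference of the
  -- two sides as ∑ ⟨s, A_k s⟩ B_k s. The pairs with i = c may be dropped because ⟨s, N_i s⟩ = 0 for
  -- symmetric N_i.
  let A : (Fin 11 × Fin 11) ⊕ Fin 11 → Module.End ℝ S :=
    Sum.elim (fun p => if p.1 = p.2 then 0 else g p.2 * g p.1 * N p.1) g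
  let A' : (Fin 11 × Fin 11) ⊕ Fin 11 → Module.End ℝ S :=
    Sum.elim (fun p => if p.1 = p.2 then 0 else N p.1 * (g p.1 * g p.2)) (fun a => -g a)
  let B : (Fin 11 × Fin 11) ⊕ Fin 11 → Module.End ℝ S :=
    Sum.elim (fun p => (1 / 2 * (sgn p.1 * sgn p.2)) • (g p.1 * g p.2))
      (fun a => (-sgn a) • (g a * N a))
  have hA : ∀ k s t, ω (A k s) t = ω s (A' k t) := by
    rintro (⟨i, c⟩ | a) s t
    · simp only [A, A', Sum.elim_inl]
      split_ifs
      · simp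
      · simp only [Module.End.mul_apply]
        rw [hg.skew c, hg.skew i, hN, neg_neg]
    · simp only [A, A', Sum.elim_inr, LinearMap.neg_apply, map_neg]
      rw [hg.skew a]
  have h1 : ∀ C, fierzCubic A A' B C = spencerCubic g C N := by
    intro C
    rw [fierzCubic_apply, spencerCubic_apply, Fintype.sum_sum_type, Fintype.sum_prod_type]
    congr 1
    · refine Finset.sum_congr rfl fun i _ => Finset.sum_congr rfl fun c _ => ?_
      simp only [A, A', B, Sum.elim_inl]
      split_ifs
      · simp
      · simp only [smul_mul_assoc]
        module
    · refine Finset.sum_congr rfl fun a _ => ?_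
      simp only [A, A', B, Sum.elim_inr, smul_mul_assoc, sub_neg_eq_add, mul_add, mul_assoc]
      module
  have h2 : ∀ s, ∑ k, ω s (A k s) • B k s =
      (1 / 2 : ℝ) • ∑ i, ∑ c, (sgn i * sgn c * ω s (g c (g i (N i s)))) • g i (g c s) -
      ∑ a, (sgn a * ω s (g a s)) • g a (N a s) := by
    intro s
    rw [Fintype.sum_sum_type, Fintype.sum_prod_type, sub_eq_add_neg, ← Finset.sum_neg_distrib,
      Finset.smul_sum]
    congr 1
    · refine Finset.sum_congr rfl fun i _ => ?_
      rw [Finset.smul_sum]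
      refine Finset.sum_congr rfl fun c _ => ?_
      simp only [A, B, Sum.elim_inl]
      split_ifs with h
      · have h3 : g c (g i (N i s)) = (-sgn i) • N i s := by
          have h : i = c := h
          subst h
          rw [← Module.End.mul_apply, hg.sq]; rfl
        rw [h3, map_smul, hg.apply_eq_zero (hN i)]
        simp
      · simp only [LinearMap.smul_apply, Module.End.mul_apply, smul_smul]
        congr 1; ring
    · refine Finset.sum_congr rfl fun a _ => ?_
      simp only [A, B, Sum.elim_inr, LinearMap.smul_apply, Module.End.mul_apply]
      module
  constructor
  · intro h K hK
    rw [← h1]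
    exact hg.fierzCubic_eq_zero hA (fun s => by rw [h2, h s, sub_self]) (hg.skew_gamma hK)
  · intro h s
    have h3 := hg.sum_eq_zero_of_fierzCubic hA (fun K hK => (h1 _).trans (h K hK)) s
    rw [h2] at h3
    exact sub_eq_zero.1 h3

/-- The span of the products of four distinct gamma operators. -/
def fourForms (g : Fin 11 → Module.End ℝ S) : Submodule ℝ (Module.End ℝ S) :=
  Submodule.span ℝ (gamma g '' {J | J.card = 4})

theorem gamma_mem_fourForms {J : Finset (Fin 11)} (hJ : J.card = 4) : gamma g J ∈ fourForms g :=
  Submodule.subset_span ⟨J, hJ, rfl⟩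

theorem IsSymplecticGamma.symm_fourForms (hg : IsSymplecticGamma g ω) {Φ : Module.End ℝ S}
    (hΦ : Φ ∈ fourForms g) (s t : S) : ω (Φ s) t = ω s (Φ t) := by
  induction hΦ using Submodule.span_induction with
  | mem x hx =>
    obtain ⟨J, hJ, rfl⟩ := hx
    exact hg.symm_gamma (by rw [show J.card = 4 from hJ]) s t
  | zero => simp
  | add x y _ _ hx hy => simp [hx, hy]
  | smul r x _ hx => simp [hx]

/-- The operators `N_a` with `g_a N_a = g_a Φ - 3 Φ g_a`. -/
def normalPart (g : Fin 11 → Module.End ℝ S) :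
    Module.End ℝ S →ₗ[ℝ] Fin 11 → Module.End ℝ S :=
  LinearMap.pi fun a => LinearMap.id +
    (3 * sgn a) • LinearMap.mulLeft ℝ (g a) ∘ₗ LinearMap.mulRight ℝ (g a)

theorem normalPart_apply (Φ : Module.End ℝ S) (a : Fin 11) :
    normalPart g Φ a = Φ + (3 * sgn a) • (g a * (Φ * g a)) := rfl

theorem IsGamma.mul_normalPart (hg : IsGamma g) (Φ : Module.End ℝ S) (a : Fin 11) :
    g a * normalPart g Φ a = g a * Φ - (3 : ℝ) • (Φ * g a) := by
  rw [normalPart_apply, mul_add, mul_smul_comm, ← mul_assoc (g a), hg.sq, smul_mul_assoc, one_mul,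
    smul_smul, show 3 * sgn a * -sgn a = -3 by linear_combination -3 * (isSign_sgn a).mul_self]
  module

/-- Conjugation by g_a acts on γ_J through χ_J(a). The resulting 1 − 3χ_J is the solution singled
out by `eq_of_cubicCoeff_eq_zero`. -/
theorem IsGamma.normalPart_gamma (hg : IsGamma g) {J : Finset (Fin 11)} (hJ : Even J.card)
    (a : Fin 11) : normalPart g (gamma g J) a = (1 - 3 * chi J a) • gamma g J := by
  rw [normalPart_apply, hg.gamma_mul_even hJ, mul_smul_comm, ← mul_assoc, hg.sq, smul_mul_assoc,
    one_mul, smul_smul, smul_smul]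
  have : 3 * sgn a * (chi J a * -sgn a) = -3 * chi J a := by
    linear_combination (-3 * chi J a) * (isSign_sgn a).mul_self
  rw [mul_assoc (3 * sgn a), this]
  module

theorem IsIrreducibleGamma.spencerCubic_fourForms (hg : IsIrreducibleGamma g)
    {Φ : Module.End ℝ S} (hΦ : Φ ∈ fourForms g) {K : Finset (Fin 11)} (hK : K ∈ skewSets) :
    spencerCubic g (gamma g K) (normalPart g Φ) = 0 := by
  induction hΦ using Submodule.span_induction with
  | mem x hx =>
    obtain ⟨J, hJ, rfl⟩ := hx
    have hJ : J.card = 4 := hJ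
    have hJe : Even J.card := by rw [hJ]; decide
    rw [show normalPart g (gamma g J) = fun a => (1 * (1 - 3 * chi J a)) • gamma g J from
      funext fun a => by rw [hg.normalPart_gamma hJe, one_mul],
      hg.spencerCubic_gamma _ hJe (even_of_mem_skewSets hK), cubicCoeff_four hJ hK, zero_smul]
  | zero => rw [map_zero, map_zero]
  | add x y _ _ hx hy => rw [map_add, map_add, hx, hy, add_zero]
  | smul r x _ hx => rw [map_smul, map_smul, hx, smul_zero]

/-- The cubic equation holds for `β_a = g_a Φ - 3 Φ g_a`. -/
theorem IsSymplecticGamma.cubic_fourForms (hg : IsSymplecticGamma g ω) {Φ : Module.End ℝ S}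
    (hΦ : Φ ∈ fourForms g) {β : Fin 11 → Module.End ℝ S}
    (hβ : ∀ a, β a = g a * Φ - (3 : ℝ) • (Φ * g a)) (s : S) :
    (1 / 2 : ℝ) • ∑ i, ∑ c, (sgn i * sgn c * ω s (g c (β i s))) • g i (g c s) =
      ∑ a, (sgn a * ω s (g a s)) • β a s := by
  have hN : ∀ i s t, ω (normalPart g Φ i s) t = ω s (normalPart g Φ i t) := by
    intro i s t
    simp only [normalPart_apply, LinearMap.add_apply, LinearMap.smul_apply, Module.End.mul_apply,
      map_add, map_smul, hg.symm_fourForms hΦ]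
    rw [hg.skew i, hg.symm_fourForms hΦ, hg.skew i, neg_neg]
  have h := (hg.cubic_iff hN).2 (fun K hK => hg.spencerCubic_fourForms hΦ hK) s
  simp only [hβ, ← hg.mul_normalPart]
  exact h

theorem IsIrreducibleGamma.eq_zero_of_sum_gamma (hg : IsIrreducibleGamma g)
    {c : Finset (Fin 11) → ℝ} (h : ∑ J ∈ evenSets, c J • gamma g J = 0)
    {J : Finset (Fin 11)} (hJ : J ∈ evenSets) : c J = 0 := by
  have h1 := congrArg (fun M => LinearMap.trace ℝ S (gamma g J * M)) h
  simp only [Finset.mul_sum, mul_smul_comm, map_sum, map_smul, mul_zero, map_zero] at h1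
  rw [Finset.sum_eq_single J] at h1
  · rw [hg.trace_gamma_mul_gamma (mem_evenSets.1 hJ) (mem_evenSets.1 hJ), if_pos rfl,
      smul_eq_mul] at h1
    exact (mul_eq_zero.1 h1).resolve_right
      (mul_ne_zero (by norm_num) (isSign_gammaSign J).ne_zero)
  · intro I hI hIJ
    rw [hg.trace_gamma_mul_gamma (mem_evenSets.1 hJ) (mem_evenSets.1 hI), if_neg (Ne.symm hIJ),
      smul_zero]
  · exact fun h => absurd hJ h

/-- The function t has one value on J and one off J; x and y are their half sum and half difference.
-/
theorem exists_affine_chi {J : Finset (Fin 11)} (hJ : J ≠ Finset.univ) {t : Fin 11 → ℝ}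
    (h : ∀ a c, a ≠ c → chi J a = chi J c → t a = t c) : ∃ x y, ∀ i, t i = x + y * chi J i := by
  have h' : ∀ a c, chi J a = chi J c → t a = t c := fun a c hac => by
    by_cases hc : a = c
    · rw [hc]
    · exact h a c hc hac
  obtain ⟨q, hq⟩ : ∃ q, q ∉ J := by
    by_contra! hq
    exact hJ (Finset.eq_univ_iff_forall.2 hq)
  have hq1 : chi J q = 1 := if_neg hq
  rcases J.eq_empty_or_nonempty with rfl | ⟨p, hp⟩
  · exact ⟨t q, 0, fun i => by rw [h' i q (by simp [chi])]; ring⟩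
  · have hp1 : chi J p = -1 := if_pos hp
    refine ⟨(t q + t p) / 2, (t q - t p) / 2, fun i => ?_⟩
    by_cases hi : i ∈ J
    · have hi1 : chi J i = -1 := if_pos hi
      rw [h' i p (hi1.trans hp1.symm), hi1]; ring
    · have hi1 : chi J i = 1 := if_neg hi
      rw [h' i q (hi1.trans hq1.symm), hi1]; ring

/-- The solutions of the cocycle equations in degree `2`. -/
theorem IsSymplecticGamma.exists_fourForm (hg : IsSymplecticGamma g ω)
    {β : Fin 11 → Module.End ℝ S} (h1 : ∀ a b s, ω s ((g a * β b + g b * β a) s) = 0)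
    (h2 : ∀ s, (1 / 2 : ℝ) • ∑ i, ∑ c, (sgn i * sgn c * ω s (g c (β i s))) • g i (g c s) =
      ∑ a, (sgn a * ω s (g a s)) • β a s) :
    ∃ Φ ∈ fourForms g, ∀ a, β a = g a * Φ - (3 : ℝ) • (Φ * g a) := by
  have := hg.finite
  -- The solution of β_a = g_a N_a, by g_a² = −sgn a.
  let N : Fin 11 → Module.End ℝ S := fun a => (-sgn a) • (g a * β a)
  have hN : ∀ a, g a * N a = β a := fun a => by
    simp only [N]
    rw [mul_smul_comm, ← mul_assoc, hg.sq, smul_mul_assoc, one_mul,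
      (isSign_sgn a).neg.smul_smul]
  let t : Finset (Fin 11) → Fin 11 → ℝ := fun J a =>
    1 / 32 * (gammaSign J * LinearMap.trace ℝ S (gamma g J * N a))
  have ht : ∀ a, N a = ∑ J ∈ evenSets, t J a • gamma g J := fun a => hg.eq_sum_gamma (N a)
  -- The quadratic condition `h1`, carried over from ⟨s,-⟩s to all skew C.
  have tr0 : ∀ a b {C}, IsSkew ω C →
      LinearMap.trace ℝ S ((g a * β b + g b * β a) * C) = 0 := by
    intro a b C hC
    exact hg.eq_zero_of_skew (L := LinearMap.trace ℝ S ∘ₗ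
      LinearMap.mulLeft ℝ (g a * β b + g b * β a)) (fun s => by
        rw [LinearMap.comp_apply, LinearMap.mulLeft_apply, trace_mul_rankOne, h1]) hC
  -- The case a = b: the N_a have no skew components, so they are ω-symmetric.
  have ht0 : ∀ J ∈ skewSets, ∀ a, t J a = 0 := by
    intro J hJ a
    have h3 := tr0 a a (hg.skew_gamma hJ)
    rw [add_mul, map_add, ← two_mul] at h3
    have h4 := (mul_eq_zero.1 h3).resolve_left two_ne_zero
    simp only [t, N]
    rw [LinearMap.trace_mul_comm, smul_mul_assoc, map_smul, h4]
    simp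
  have hmod : ∀ J ∈ evenSets, J ∉ skewSets → J.card % 4 = 0 := by
    intro J h3 h4
    rw [mem_evenSets, Nat.even_iff] at h3
    rw [mem_skewSets] at h4
    omega
  have hNs : ∀ a s u, ω (N a s) u = ω s (N a u) := by
    intro a s u
    rw [ht]
    simp only [LinearMap.sum_apply, LinearMap.smul_apply, map_sum, map_smul]
    refine Finset.sum_congr rfl fun J hJ => ?_
    by_cases hJ' : J ∈ skewSets
    · rw [ht0 J hJ' a, zero_smul, zero_smul]
    · rw [hg.symm_gamma (hmod J hJ hJ')]
  -- If a ≠ c and χ_J(a) = χ_J(c), then g_c g_a commutes with γ_J, so g_c g_a γ_J is skew and `tr0`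
  -- gives t_J(a) = t_J(c).
  have haff : ∀ J ∈ evenSets, J ∉ skewSets → ∃ x y, ∀ i, t J i = x + y * chi J i := by
    intro J hJ hJ'
    have hJ4 := hmod J hJ hJ'
    refine exists_affine_chi (fun h => ?_) fun a c hac hχ => ?_
    · rw [h] at hJ4
      exact absurd hJ4 (by decide)
    have hχ1 : chi J c * chi J a = 1 := by rw [hχ, (isSign_chi J c).mul_self]
    have hp := hg.pair_mul_gamma (mem_evenSets.1 hJ) c a
    rw [hχ1, one_smul] at hp
    have hC : IsSkew ω (g c * g a * gamma g J) := by
      intro s u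
      simp only [Module.End.mul_apply]
      rw [hg.skew c, hg.skew a, neg_neg, hg.symm_gamma hJ4]
      have h3 : ∀ v, gamma g J (g a (g c v)) = g a (g c (gamma g J v)) := fun v => by
        have h4 := hg.pair_mul_gamma (mem_evenSets.1 hJ) a c
        rw [mul_comm (chi J a), hχ1, one_smul] at h4
        exact (LinearMap.congr_fun h4 v).symm
      rw [h3, ← Module.End.mul_apply (g a), hg.anti a c hac]
      simp
    have h3 := tr0 a c hC
    have h4 : g a * β c + g c * β a = g c * g a * (N a - N c) := by
      rw [← hN a, ← hN c, ← mul_assoc, ← mul_assoc, hg.anti a c hac, mul_sub]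
      noncomm_ring
    rw [h4, LinearMap.trace_mul_comm, ← mul_assoc, hp, mul_assoc (gamma g J),
      hg.pair_sq (Ne.symm hac), mul_smul_comm, mul_one, smul_mul_assoc, map_smul, mul_sub,
      map_sub] at h3
    have h5 := (smul_eq_zero.1 h3).resolve_left
      (((isSign_sgn c).mul (isSign_sgn a)).neg.ne_zero)
    simp only [t]
    rw [sub_eq_zero.1 h5]
  have hcub := (hg.cubic_iff hNs).1 fun s => by
    have h3 : ∀ a u, g a (N a u) = β a u := fun a u => LinearMap.congr_fun (hN a) u
    simp only [h3]
    exact h2 s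
  have hcoef : ∀ J ∈ evenSets, ∀ K ∈ skewSets, cubicCoeff (t J) J K = 0 := by
    intro J hJ K hK
    have hN' : N = ∑ J ∈ evenSets, fun i => t J i • gamma g J := by
      funext i
      rw [Finset.sum_apply, ht]
    have h3 := hcub K hK
    rw [hN', map_sum, Finset.sum_congr rfl fun J hJ => hg.spencerCubic_gamma (t J)
      (mem_evenSets.1 hJ) (even_of_mem_skewSets hK)] at h3
    refine hg.eq_zero_of_sum_gamma (c := fun J => cubicCoeff (t J) J K) ?_ hJ
    -- Multiplication by the inverse of γ_K leaves a relation among the linearly independent γ_J.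
    have h4 := congrArg (fun M => gammaSign K • (gamma g K * M)) h3
    simp only [mul_zero, smul_zero, Finset.mul_sum, mul_smul_comm, ← mul_assoc, hg.gamma_sq,
      smul_mul_assoc, one_mul, Finset.smul_sum] at h4
    rw [← h4]
    refine Finset.sum_congr rfl fun J _ => ?_
    rw [smul_comm, (isSign_gammaSign K).smul_smul]
  -- Only |J| = 4 contributes, with t_J = x (1 − 3χ_J) and Φ = x γ_J.
  have hsol : ∀ J, ∃ Φ ∈ fourForms g, J ∈ evenSets → ∀ a,
      t J a • (g a * gamma g J) = g a * Φ - (3 : ℝ) • (Φ * g a) := by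
    intro J
    by_cases hJ : J ∈ evenSets
    swap
    · exact ⟨0, zero_mem _, fun h => absurd h hJ⟩
    by_cases hJ' : J ∈ skewSets
    · exact ⟨0, zero_mem _, fun _ a => by rw [ht0 J hJ' a]; simp⟩
    obtain ⟨x, y, hxy⟩ := haff J hJ hJ'
    rcases eq_of_cubicCoeff_eq_zero (hmod J hJ hJ') (fun K hK => by
      rw [← hcoef J hJ K hK]
      congr 1
      exact (funext hxy).symm) with ⟨h4, hy⟩ | h0
    · refine ⟨x • gamma g J, Submodule.smul_mem _ _ (gamma_mem_fourForms h4), fun _ a => ?_⟩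
      rw [hxy, hy, smul_mul_assoc, hg.gamma_mul_even (mem_evenSets.1 hJ), mul_smul_comm]
      module
    · exact ⟨0, zero_mem _, fun _ a => by rw [hxy, h0]; simp⟩
  choose Φ hΦ hΦ' using hsol
  refine ⟨∑ J ∈ evenSets, Φ J, sum_mem fun J _ => hΦ J, fun a => ?_⟩
  rw [← hN, ht, Finset.mul_sum, Finset.mul_sum, Finset.sum_mul, Finset.smul_sum,
    ← Finset.sum_sub_distrib]
  refine Finset.sum_congr rfl fun J hJ => ?_
  rw [mul_smul_comm, hΦ' J hJ]

end DegreeTwo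

/-! ### Torsion and contorsion -/

section Contorsion

variable {V : Type u} [AddCommGroup V] [Module ℝ V] (η : LorentzForm V)

/-- The vector representing a linear functional with respect to `η`. -/
def LorentzForm.sharp : (V →ₗ[ℝ] ℝ) →ₗ[ℝ] V :=
  ∑ c, (sgn c • LinearMap.applyₗ (R := ℝ) (M₂ := ℝ) (η.basis c)).smulRight (η.basis c)

theorem LorentzForm.form_sharp (φ : V →ₗ[ℝ] ℝ) (y : V) : η.form (η.sharp φ) y = φ y := by
  have h : η.sharp φ = ∑ c, (sgn c * φ (η.basis c)) • η.basis c := by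
    simp [LorentzForm.sharp, LinearMap.sum_apply]
  conv_rhs => rw [η.expand y]
  rw [h]
  simp only [map_sum, map_smul, LinearMap.sum_apply, LinearMap.smul_apply, smul_eq_mul]
  exact Finset.sum_congr rfl fun c _ => by ring

/-- A vector-valued `2`-form is the torsion of a unique `so(V)`-valued `1`-form. -/
theorem exists_contorsion (α : V →ₗ[ℝ] V →ₗ[ℝ] V) (hα : ∀ v x, α v x = -α x v) :
    ∃ l : V →ₗ[ℝ] So η, ∀ v x, vec η (l v) x - vec η (l x) v = α v x := by
  let T : V →ₗ[ℝ] V →ₗ[ℝ] V →ₗ[ℝ] ℝ := α.compr₂ η.form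
  have hT : ∀ v x y, T v x y = -T x v y := fun v x y => by
    change η.form (α v x) y = -η.form (α x v) y
    rw [hα]; simp
  -- The Koszul formula: K is skew in its last two arguments, and antisymmetrising the first two
  -- returns T.
  let K : V →ₗ[ℝ] V →ₗ[ℝ] V →ₗ[ℝ] ℝ := LinearMap.mk₂ ℝ
    (fun v x => (1 / 2 : ℝ) • (T v x - (T x).flip v + (T.flip v).flip x))
    (fun v v' x => by
      refine LinearMap.ext fun y => ?_
      simp; ring)
    (fun c v x => by
      refine LinearMap.ext fun y => ?_
      simp; ring)
    (fun v x x' => by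
      refine LinearMap.ext fun y => ?_
      simp; ring)
    (fun c v x => by
      refine LinearMap.ext fun y => ?_
      simp; ring)
  have hK : ∀ v x y, K v x y = 1 / 2 * (T v x y - T x y v + T y v x) := fun v x y => rfl
  have hB : ∀ v x y, η.form (K.compr₂ η.sharp v x) y = K v x y := fun v x y => η.form_sharp _ _
  refine ⟨soOfSkewLinear η (K.compr₂ η.sharp) fun v x y => ?_, fun v x => ?_⟩
  · rw [η.symm x, hB, hB, hK, hK]
    linarith [hT v x y, hT x y v, hT y v x]
  · refine LorentzForm.ext_form (η := η) fun y => ?_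
    rw [vec_soOfSkewLinear, vec_soOfSkewLinear, map_sub, LinearMap.sub_apply, hB, hB, hK, hK]
    change _ = T v x y
    linarith [hT v x y, hT x y v, hT y v x]

/-- A trilinear form that is symmetric in its first two and skew in its last two arguments is zero.
-/
theorem eq_zero_of_torsion {l : V →ₗ[ℝ] So η} (h : ∀ v x, vec η (l v) x = vec η (l x) v) :
    l = 0 := by
  refine LinearMap.ext fun v => So.ext_vec (LinearMap.ext fun x =>
    LorentzForm.ext_form (η := η) fun y => ?_)
  have h1 : ∀ v x y, η.form (vec η (l v) x) y = η.form (vec η (l x) v) y := fun v x y => by rw [h]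
  have h2 : ∀ v x y, η.form (vec η (l v) x) y = -η.form (vec η (l v) y) x := fun v x y => by
    rw [So.skew, η.symm x]
  rw [LinearMap.zero_apply, map_zero, LinearMap.zero_apply, map_zero, LinearMap.zero_apply]
  linarith [h1 v x y, h2 x v y, h1 x y v, h2 y x v, h1 y v x, h2 v y x]

end Contorsion

/-! ### Cochains of degree 2 -/

section DegreeTwoCochains

set_option linter.unusedSectionVars false

variable {V : Type u} [AddCommGroup V] [Module ℝ V] {η : LorentzForm V}
variable {S : Type w} [AddCommGroup S] [Module ℝ S] [Module (Cl η) S] [IsScalarTower ℝ (Cl η) S]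
variable (ω : SpinSymplectic η S)

/-- The `2`-cochain of degree `2` with components `γ` on `S × S` and `β` on `S × V`. -/
def cochainTwo (γ : S →ₗ[ℝ] S →ₗ[ℝ] So η) (β : S →ₗ[ℝ] V →ₗ[ℝ] S) :
    S × V →ₗ[ℝ] S × V →ₗ[ℝ] Poincare η S :=
  cochain (γ.compr₂ (LinearMap.inl ℝ (So η) (S × V)))
    (β.compr₂ (LinearMap.inr ℝ (So η) (S × V) ∘ₗ LinearMap.inl ℝ S V)) 0

theorem cochainTwo_apply (γ : S →ₗ[ℝ] S →ₗ[ℝ] So η) (β : S →ₗ[ℝ] V →ₗ[ℝ] S) (x y : S × V) :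
    cochainTwo γ β x y = (γ x.1 y.1, β x.1 y.2 - β y.1 x.2, 0) := by
  rw [cochainTwo, cochain_apply]
  refine Prod.ext (by simp) (Prod.ext (by simp) (by simp))

/-- `h1` is the condition on S × S × V, and `h2` is the diagonal of the one on S × S × S, recovered
by polarising a cubic and then a quadratic form. With two or more arguments in V nothing remains to
be satisfied. -/
theorem cochainTwo_mem {γ : S →ₗ[ℝ] S →ₗ[ℝ] So η} {β : S →ₗ[ℝ] V →ₗ[ℝ] S}
    (h1 : ∀ s t v, vec η (γ s t) v = dirac ω s (β t v) + dirac ω t (β s v))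
    (h2 : ∀ s, spin η S (γ s s) s = β s (dirac ω s s)) : cochainTwo γ β ∈ Z₂ ω 2 := by
  have hγ : ∀ s t, γ s t = γ t s := fun s t => So.ext_vec (LinearMap.ext fun v => by
    rw [h1, h1, add_comm])
  let T : S →ₗ[ℝ] S →ₗ[ℝ] S →ₗ[ℝ] S := γ.compr₂ (spin η S : So η →ₗ[ℝ] Module.End ℝ S) -
    (dirac ω).compr₂ β.flip
  have hT : ∀ s t r, T s t r = spin η S (γ s t) r - β r (dirac ω s t) := fun s t r => rfl
  have hTs : ∀ s t r, T s t r = T t s r := fun s t r => by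
    rw [hT, hT, hγ, dirac_symm]
  have hT0 : ∀ s t r, T s t r + (T s r t + T t r s) = 0 := fun s t r => by
    let Q : S →ₗ[ℝ] S →ₗ[ℝ] S := T.compr₂ (LinearMap.applyₗ r) + (T.flip r + (T.flip r).flip)
    refine polarize_quadratic Q (fun s t => ?_) (fun s => ?_) s t
    · change T s t r + (T s r t + T t r s) = T t s r + (T t r s + T s r t)
      rw [hTs s t, add_comm (T s r t)]
    · change T s s r + (T s r s + T s r s) = 0
      rw [← two_smul ℝ]
      exact polarize_cubic T hTs (fun s => by rw [hT, h2, sub_self]) s r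
  have hS : (-1 : ℤ) = -1 ∨ (-1 : ℤ) = -2 := Or.inl rfl
  have hV : (-2 : ℤ) = -1 ∨ (-2 : ℤ) = -2 := Or.inr rfl
  have e1 : eps (-1) = -1 := by rw [eps_neg, eps_one]
  have e2 : eps (-2) = 1 := by rw [eps_neg, eps_two]
  refine ⟨mem_C₂ (fun s t => ?_) (fun s v => ?_) (fun v x => ?_) (fun s t => ?_) (fun s v => ?_)
    (fun v x => ?_), ?_⟩
  any_goals simp only [cochainTwo_apply]
  · simp [hγ s t]
  · simp
  · simp
  · exact ⟨fun h => absurd rfl h, fun _ => by simp, fun _ => rfl⟩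
  · exact ⟨fun _ => by simp, fun h => absurd rfl h, fun _ => rfl⟩
  · exact ⟨fun _ => by simp, fun _ => by simp, fun _ => rfl⟩
  refine ext_m (fun s => ext_m (fun t => ext_m (fun r => ?_) (fun z => ?_))
      (fun y => ext_m (fun r => ?_) (fun z => ?_)))
    (fun x => ext_m (fun t => ext_m (fun r => ?_) (fun z => ?_))
      (fun y => ext_m (fun r => ?_) (fun z => ?_)))
  · rw [d₂_homog _ _ _ _ hS hS hS (mGrade_left s) (mGrade_left t) (mGrade_left r)]
    have h := hT0 s t r
    simp only [hT] at h
    norm_num [cochainTwo_apply, adj_apply, mBracket_apply, e1, e2, eps_one, eps_two, eps_zero]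
    rw [← neg_eq_zero]
    refine Eq.trans ?_ h
    abel
  · rw [d₂_homog _ _ _ _ hS hS hV (mGrade_left s) (mGrade_left t) (mGrade_right z)]
    norm_num [cochainTwo_apply, adj_apply, mBracket_apply, e1, e2, eps_one, eps_two, eps_zero, h1]
  · rw [d₂_homog _ _ _ _ hS hV hS (mGrade_left s) (mGrade_right y) (mGrade_left r)]
    norm_num [cochainTwo_apply, adj_apply, mBracket_apply, e1, e2, eps_one, eps_two, eps_zero, h1]
  · rw [d₂_homog _ _ _ _ hS hV hV (mGrade_left s) (mGrade_right y) (mGrade_right z)]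
    simp [cochainTwo_apply, adj_apply, mBracket_apply]
  · rw [d₂_homog _ _ _ _ hV hS hS (mGrade_right x) (mGrade_left t) (mGrade_left r)]
    norm_num [cochainTwo_apply, adj_apply, mBracket_apply, e1, e2, eps_one, eps_two, eps_zero,
      eps_neg, eps_four, h1]
  · rw [d₂_homog _ _ _ _ hV hS hV (mGrade_right x) (mGrade_left t) (mGrade_right z)]
    simp [cochainTwo_apply, adj_apply, mBracket_apply]
  · rw [d₂_homog _ _ _ _ hV hV hS (mGrade_right x) (mGrade_right y) (mGrade_left r)]
    simp [cochainTwo_apply, adj_apply, mBracket_apply]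
  · rw [d₂_homog _ _ _ _ hV hV hV (mGrade_right x) (mGrade_right y) (mGrade_right z)]
    simp [cochainTwo_apply, adj_apply, mBracket_apply]

/-- The `1`-cochain of degree `2` given by an `so(V)`-valued `1`-form. -/
def cochainForm (l : V →ₗ[ℝ] So η) : S × V →ₗ[ℝ] Poincare η S :=
  LinearMap.inl ℝ (So η) (S × V) ∘ₗ l ∘ₗ LinearMap.snd ℝ S V

theorem cochainForm_apply (l : V →ₗ[ℝ] So η) (x : S × V) :
    cochainForm l x = ((l x.2, 0, 0) : Poincare η S) := rfl

theorem cochainForm_mem (l : V →ₗ[ℝ] So η) :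
    (cochainForm l : S × V →ₗ[ℝ] Poincare η S) ∈ C₁ (grade η S) 2 := by
  intro i x hx
  rw [cochainForm_apply]
  exact ⟨fun h => by simp [hx.2 (by omega)], fun _ => rfl, fun _ => rfl⟩

theorem exists_cochainForm {b : S × V →ₗ[ℝ] Poincare η S} (hb : b ∈ C₁ (grade η S) 2) :
    ∃ l, b = cochainForm l := by
  refine ⟨LinearMap.fst ℝ (So η) (S × V) ∘ₗ b ∘ₗ LinearMap.inr ℝ S V,
    ext_m (fun s => ?_) fun v => ?_⟩
  · rw [cochainForm_apply, map_zero]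
    exact eq_zero_of_mem_grade (by norm_num) (hb _ _ (mGrade_left s))
  · exact mem_grade_zero (hb _ _ (mGrade_right v))

/-- The differential of `cochainForm l`. -/
theorem d₁_cochainForm (l : V →ₗ[ℝ] So η) (x y : S × V) :
    d₁ (mBracket ω) (adj ω) 2 (cochainForm l) x y =
      (-l (dirac ω x.1 y.1), spin η S (l x.2) y.1 - spin η S (l y.2) x.1,
        vec η (l x.2) y.2 - vec η (l y.2) x.2) := by
  obtain ⟨s, v⟩ := x
  obtain ⟨t, x⟩ := y
  rw [d₁_apply _ _ (mBracket_apply ω)]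
  simp only [cochainForm_apply, adj_apply, eps_two, map_zero]
  refine Prod.ext (by simp) (Prod.ext ?_ ?_)
  · simp; abel
  · simp; abel

/-- The components of the cocycle condition in degree `2`. -/
theorem cocycle_two {z : S × V →ₗ[ℝ] S × V →ₗ[ℝ] Poincare η S} (hz : z ∈ Z₂ ω 2) (s : S) :
    spin η S (z (s, 0) (s, 0)).1 s = (z (s, 0) (0, dirac ω s s)).2.1 := by
  have h := d₂_homog (mBracket ω) (adj ω) 2 z (Or.inl rfl) (Or.inl rfl) (Or.inl rfl)
    (mGrade_left s) (mGrade_left s) (mGrade_left s)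
  rw [show d₂ (mBracket ω) (adj ω) 2 z = 0 from hz.2] at h
  have e1 : eps (-1 * 2) = 1 := by rw [show (-1 * 2 : ℤ) = -2 by norm_num, eps_neg, eps_two]
  have e2 : eps (-1 * (2 + -1)) = -1 := by
    rw [show (-1 * (2 + -1) : ℤ) = -1 by norm_num, eps_neg, eps_one]
  have e3 : eps (-1 * (2 + -1 + -1)) = 1 := by
    rw [show (-1 * (2 + -1 + -1) : ℤ) = 0 by norm_num, eps_zero]
  rw [e1, e2, e3, eps_ss, mBracket_apply] at h
  dsimp only at h
  rw [C₂_skew_left hz.1] at h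
  have h1 := congrArg (fun p : Poincare η S => p.2.1) h
  simp [adj_apply] at h1
  have h2 : (3 : ℝ) • (spin η S (z (s, 0) (s, 0)).1 s - (z (s, 0) (0, dirac ω s s)).2.1) = 0 := by
    rw [← neg_eq_zero]
    refine Eq.trans ?_ h1.symm
    module
  exact sub_eq_zero.1 ((smul_eq_zero.1 h2).resolve_left (by norm_num))

/-- Vanishing on V × V removes the term z(κ(s,t), v) from the condition on S × S × V, which then
determines the S × S component from the S × V component. -/
theorem cocycle_two_vector {z : S × V →ₗ[ℝ] S × V →ₗ[ℝ] Poincare η S} (hz : z ∈ Z₂ ω 2)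
    (hα : ∀ v x, z (0, v) (0, x) = 0) (s t : S) (v : V) :
    vec η (z (s, 0) (t, 0)).1 v =
      dirac ω s (z (t, 0) (0, v)).2.1 + dirac ω t (z (s, 0) (0, v)).2.1 := by
  have h := d₂_homog (mBracket ω) (adj ω) 2 z (Or.inl rfl) (Or.inl rfl) (Or.inr rfl)
    (mGrade_left s) (mGrade_left t) (mGrade_right v)
  rw [show d₂ (mBracket ω) (adj ω) 2 z = 0 from hz.2] at h
  have e1 : eps (-1 * 2) = 1 := by rw [show (-1 * 2 : ℤ) = -2 by norm_num, eps_neg, eps_two]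
  have e2 : eps (-1 * (2 + -1)) = -1 := by
    rw [show (-1 * (2 + -1) : ℤ) = -1 by norm_num, eps_neg, eps_one]
  have e3 : eps (-2 * (2 + -1 + -1)) = 1 := by
    rw [show (-2 * (2 + -1 + -1) : ℤ) = 0 by norm_num, eps_zero]
  rw [e1, e2, e3, eps_sv, mBracket_apply, mBracket_apply, mBracket_apply] at h
  have h0 : z ((0, 0) : S × V) = 0 := map_zero z
  have h0' : z (s, 0) ((0, 0) : S × V) = 0 := map_zero (z (s, 0))
  simp only [map_zero, LinearMap.zero_apply, hα, h0, h0'] at h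
  have h1 := congrArg (fun p : Poincare η S => p.2.2) h
  simp [adj_apply] at h1
  have h2 : vec η (z (s, 0) (t, 0)).1 v - (dirac ω s (z (t, 0) (0, v)).2.1 +
      dirac ω t (z (s, 0) (0, v)).2.1) = 0 := by
    rw [← neg_eq_zero]
    refine Eq.trans ?_ h1.symm
    abel
  exact sub_eq_zero.1 h2

end DegreeTwoCochains

/-- For |J| = 4 the sum of 1 − 3χ_J(a) over a is 11 − 3 · 3 = 2. Thus the N_a determine Φ, which
gives injectivity in degree 2. -/
theorem IsGamma.sum_normalPart {S : Type*} [AddCommGroup S] [Module ℝ S]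
    {g : Fin 11 → Module.End ℝ S} (hg : IsGamma g) {Φ : Module.End ℝ S} (hΦ : Φ ∈ fourForms g) :
    ∑ a, normalPart g Φ a = (2 : ℝ) • Φ := by
  induction hΦ using Submodule.span_induction with
  | mem x hx =>
    obtain ⟨J, hJ, rfl⟩ := hx
    have hJ : J.card = 4 := hJ
    rw [Finset.sum_congr rfl fun a _ => hg.normalPart_gamma (by rw [hJ]; decide) a,
      ← Finset.sum_smul, Finset.sum_sub_distrib, ← Finset.mul_sum, sum_chi, hJ]
    norm_num
  | zero => simp
  | add x y _ _ hx hy => simp only [map_add, Pi.add_apply, Finset.sum_add_distrib, hx, hy, smul_add]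
  | smul r x _ hx => simp only [map_smul, Pi.smul_apply, ← Finset.smul_sum, hx, smul_comm r]

/-! ### Computation of the cohomology in degree 2 -/

section SecondCohomology

set_option linter.unusedSectionVars false

variable {V : Type u} [AddCommGroup V] [Module ℝ V] {η : LorentzForm V}
variable {S : Type w} [AddCommGroup S] [Module ℝ S] [Module (Cl η) S] [IsScalarTower ℝ (Cl η) S]
variable [IsSimpleModule (Cl η) S] (ω : SpinSymplectic η S)

variable (η) in
/-- The bilinear map `(s, v) ↦ v · Φ s - 3 Φ (v · s)`. -/
def fourFormField (Φ : Module.End ℝ S) : S →ₗ[ℝ] V →ₗ[ℝ] S :=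
  (cliff η S).flip ∘ₗ Φ - (3 : ℝ) • (cliff η S).flip.compr₂ Φ

theorem fourFormField_apply (Φ : Module.End ℝ S) (s : S) (v : V) :
    fourFormField η Φ s v = cliff η S v (Φ s) - (3 : ℝ) • Φ (cliff η S v s) := rfl

/-- The endomorphism `v ↦ κ(s, β(t,v)) + κ(t, β(s,v))` of `V`, for `β = fourFormField Φ`. -/
def fourFormRotation (Φ : Module.End ℝ S) : S →ₗ[ℝ] S →ₗ[ℝ] Module.End ℝ V :=
  let P : S →ₗ[ℝ] S →ₗ[ℝ] V →ₗ[ℝ] V := LinearMap.mk₂ ℝ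
    (fun s t => dirac ω s ∘ₗ fourFormField η Φ t)
    (fun s s' t => by ext v; simp) (fun r s t => by ext v; simp)
    (fun s t t' => by ext v; simp) (fun r s t => by ext v; simp)
  P + P.flip

theorem fourFormRotation_apply (Φ : Module.End ℝ S) (s t : S) (v : V) :
    fourFormRotation ω Φ s t v =
      dirac ω s (fourFormField η Φ t v) + dirac ω t (fourFormField η Φ s v) := rfl

/-- In the η-symmetric part the terms ⟨s, x·Φ(v·t)⟩ cancel in pairs, by skewness of Clifford
multiplication and symmetry of Φ. The terms ⟨s, x·v·Φt⟩ leave a multiple of η(v,x)⟨s,Φt⟩, which is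
skew in s and t. -/
theorem fourFormRotation_skew {Φ : Module.End ℝ S}
    (hΦ : ∀ s t, ω.form (Φ s) t = ω.form s (Φ t)) (s t : S) (v x : V) :
    η.form (fourFormRotation ω Φ s t v) x = -η.form v (fourFormRotation ω Φ s t x) := by
  have hg := isSymplecticGamma_gam ω
  have hc : ∀ v x s, cliff η S v (cliff η S x s) =
      -cliff η S x (cliff η S v s) - (2 * η.form v x) • s := fun v x s =>
    LinearMap.congr_fun (cliff_anticomm η S v x) s
  have h1 : ∀ s t, ω.form s (cliff η S x (Φ (cliff η S v t))) =
      -ω.form t (cliff η S v (Φ (cliff η S x s))) := by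
    intro s t
    have e := skew_cliff ω x s (Φ (cliff η S v t))
    rw [← hΦ, hg.anticomm, skew_cliff ω v] at e
    linarith
  have h2 : ω.form s (Φ t) = -ω.form t (Φ s) := by rw [← hΦ, hg.anticomm]
  rw [η.symm v]
  simp only [fourFormRotation_apply, map_add, LinearMap.add_apply, form_dirac]
  simp only [fourFormField_apply, map_sub, map_smul, smul_eq_mul]
  rw [hc x v (Φ t), hc x v (Φ s)]
  simp only [map_sub, map_neg, map_smul, smul_eq_mul]
  rw [h2]
  linarith [h1 s t, h1 t s]

/-- The `so(V)`-valued component of the cocycle attached to `Φ`. -/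
def fourFormCurvature {Φ : Module.End ℝ S} (hΦ : ∀ s t, ω.form (Φ s) t = ω.form s (Φ t)) :
    S →ₗ[ℝ] S →ₗ[ℝ] So η :=
  LinearMap.mk₂ ℝ (fun s t => soOfSkew η (fourFormRotation ω Φ s t)
      (fourFormRotation_skew ω hΦ s t))
    (fun _ _ _ => So.ext_vec (by simp [vec_soOfSkew]))
    (fun _ _ _ => So.ext_vec (by simp [vec_soOfSkew]))
    (fun _ _ _ => So.ext_vec (by simp [vec_soOfSkew]))
    (fun _ _ _ => So.ext_vec (by simp [vec_soOfSkew]))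

theorem vec_fourFormCurvature {Φ : Module.End ℝ S}
    (hΦ : ∀ s t, ω.form (Φ s) t = ω.form s (Φ t)) (s t : S) (v : V) :
    vec η (fourFormCurvature ω hΦ s t) v =
      dirac ω s (fourFormField η Φ t v) + dirac ω t (fourFormField η Φ s v) := rfl

theorem apply_dirac_eq_sum (β : S →ₗ[ℝ] V →ₗ[ℝ] S) (s : S) : β s (dirac ω s s) =
    ∑ a, (sgn a * ω.form s (gam η S a s)) • β.flip (η.basis a) s := by
  rw [dirac_eq_sum, map_sum]
  simp

/-- This is the left side of the cubic equation; its ½ is the ¼ of the spin representation times the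
two equal summands of A. -/
theorem spin_eq_sum_of_vec {A : So η} {β : S →ₗ[ℝ] V →ₗ[ℝ] S} {s : S}
    (hA : ∀ v, vec η A v = dirac ω s (β s v) + dirac ω s (β s v)) : spin η S A s =
    (1 / 2 : ℝ) • ∑ i, ∑ c, (sgn i * sgn c *
      ω.form s (gam η S c (β.flip (η.basis i) s))) • gam η S i (gam η S c s) := by
  rw [spin_eq_sum, LinearMap.smul_apply, LinearMap.sum_apply, Finset.smul_sum, Finset.smul_sum]
  refine Finset.sum_congr rfl fun i _ => ?_
  rw [LinearMap.sum_apply, Finset.smul_sum, Finset.smul_sum]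
  refine Finset.sum_congr rfl fun c _ => ?_
  rw [hA, map_add, form_basis_dirac, LinearMap.smul_apply, Module.End.mul_apply, smul_smul,
    smul_smul, LinearMap.flip_apply]
  congr 1; ring

theorem fourFormField_flip (Φ : Module.End ℝ S) (a : Fin 11) :
    (fourFormField η Φ).flip (η.basis a) = gam η S a * Φ - (3 : ℝ) • (Φ * gam η S a) := rfl

theorem fourForm_symm {Φ : Module.End ℝ S} (hΦ : Φ ∈ fourForms (gam η S)) (s t : S) :
    ω.form (Φ s) t = ω.form s (Φ t) :=
  (isSymplecticGamma_gam ω).symm_fourForms hΦ s t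

/-- The cocycle attached to `Φ ∈ fourForms`. -/
def fourFormCocycle : fourForms (gam η S) →ₗ[ℝ] Z₂ ω 2 where
  toFun Φ := ⟨cochainTwo (fourFormCurvature ω (fourForm_symm ω Φ.2)) (fourFormField η Φ.1),
    cochainTwo_mem ω (vec_fourFormCurvature ω _) fun s => by
      rw [apply_dirac_eq_sum ω, spin_eq_sum_of_vec ω (vec_fourFormCurvature ω _ s s)]
      exact (isSymplecticGamma_gam ω).cubic_fourForms Φ.2 (fourFormField_flip _) s⟩
  map_add' Φ Φ' := Subtype.ext (LinearMap.ext₂ fun x y => by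
    simp only [Submodule.coe_add, LinearMap.add_apply, cochainTwo_apply]
    refine Prod.ext (So.ext_vec (LinearMap.ext fun v => ?_)) (Prod.ext ?_ (by simp))
    · simp only [Prod.fst_add, map_add, LinearMap.add_apply, vec_fourFormCurvature,
        fourFormField_apply, map_sub, smul_add]
      abel
    · simp only [Prod.fst_add, Prod.snd_add, map_add, LinearMap.add_apply, fourFormField_apply,
        smul_add]
      abel)
  map_smul' r Φ := Subtype.ext (LinearMap.ext₂ fun x y => by
    simp only [Submodule.coe_smul, LinearMap.smul_apply, cochainTwo_apply, RingHom.id_apply]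
    refine Prod.ext (So.ext_vec (LinearMap.ext fun v => ?_)) (Prod.ext ?_ (by simp))
    · simp only [Prod.smul_fst, map_smul, LinearMap.smul_apply, vec_fourFormCurvature,
        fourFormField_apply, map_sub]
      module
    · simp only [Prod.smul_fst, Prod.smul_snd, map_smul, LinearMap.smul_apply, fourFormField_apply]
      module)

theorem fourFormCocycle_apply (Φ : fourForms (gam η S)) (x y : S × V) :
    (fourFormCocycle ω Φ).1 x y = (fourFormCurvature ω (fourForm_symm ω Φ.2) x.1 y.1,
      fourFormField η Φ.1 x.1 y.2 - fourFormField η Φ.1 y.1 x.2, 0) :=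
  cochainTwo_apply _ _ x y

theorem fourFormCocycle_equivariant (A : So η) {Φ Φ' : fourForms (gam η S)}
    (h : Φ'.1 = spin η S A * Φ.1 - Φ.1 * spin η S A) :
    soC₂ ω A (fourFormCocycle ω Φ).1 = (fourFormCocycle ω Φ').1 := by
  have h1 : ∀ s v, fourFormField η Φ'.1 s v = spin η S A (fourFormField η Φ.1 s v) -
      fourFormField η Φ.1 (spin η S A s) v - fourFormField η Φ.1 s (vec η A v) := by
    intro s v
    simp only [fourFormField_apply, h, LinearMap.sub_apply, Module.End.mul_apply, map_sub, map_smul,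
      spin_cliff, map_add]
    module
  refine LinearMap.ext₂ fun x y => ?_
  rw [soC₂_apply]
  simp only [fourFormCocycle_apply, soP_apply, soM_apply]
  refine Prod.ext (So.ext_vec (LinearMap.ext fun v => ?_)) (Prod.ext ?_ (by simp))
  · simp only [Prod.fst_sub, map_sub, LinearMap.sub_apply, vec_lie, vec_fourFormCurvature, h1,
      map_add, dirac_equivariant]
    abel
  · simp only [Prod.fst_sub, Prod.snd_sub, h1, map_sub]
    abel

/-- The cocycle vanishes on V × V, so a so(V)-valued form bounding it is torsion-free and hence
zero. Then all N_a vanish, and they sum to 2Φ. -/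
theorem fourFormCocycle_eq_zero {Φ : fourForms (gam η S)}
    (h : (fourFormCocycle ω Φ).1 ∈ B₂ ω 2) : Φ = 0 := by
  have hg := isSymplecticGamma_gam ω
  obtain ⟨b, hb, hb'⟩ := h
  obtain ⟨l, rfl⟩ := exists_cochainForm hb
  have h0 : l = 0 := eq_zero_of_torsion η fun v x => by
    have h1 := LinearMap.congr_fun₂ hb' ((0 : S), v) ((0 : S), x)
    rw [d₁_cochainForm, fourFormCocycle_apply] at h1
    exact sub_eq_zero.1 (congrArg (fun p : Poincare η S => p.2.2) h1)
  have h1 : ∀ a, normalPart (gam η S) Φ.1 a = 0 := fun a => LinearMap.ext fun s => by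
    refine hg.injective a ?_
    have h2 := LinearMap.congr_fun₂ hb' (s, (0 : V)) ((0 : S), η.basis a)
    rw [d₁_cochainForm, fourFormCocycle_apply, h0] at h2
    have h3 := congrArg (fun p : Poincare η S => p.2.1) h2
    simp only [LinearMap.zero_apply, map_zero, sub_zero] at h3
    rw [← Module.End.mul_apply, hg.mul_normalPart, LinearMap.zero_apply, map_zero]
    exact h3.symm
  have h2 := hg.sum_normalPart Φ.2
  rw [Finset.sum_congr rfl fun a _ => h1 a, Finset.sum_const_zero] at h2
  exact Subtype.ext ((smul_eq_zero.1 h2.symm).resolve_left two_ne_zero)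

/-- A contorsion removes the V × V component, and then β determines the S × S component. That the
latter is so(V)-valued and satisfies the condition on S × S × S are the two hypotheses of
`exists_fourForm`. -/
theorem exists_fourFormCocycle {z : S × V →ₗ[ℝ] S × V →ₗ[ℝ] Poincare η S} (hz : z ∈ Z₂ ω 2) :
    ∃ Φ, (fourFormCocycle ω Φ).1 - z ∈ B₂ ω 2 := by
  have hg := isSymplecticGamma_gam ω
  have hvv : ∀ z ∈ Z₂ ω 2, ∀ v x, z (0, v) (0, x) = (0, 0, (z (0, v) (0, x)).2.2) :=
    fun z hz v x => mem_grade_neg_two (hz.1 _ _ _ (mGrade_right v) _ (mGrade_right x)).2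
  obtain ⟨l, hl⟩ := exists_contorsion η ((z.compl₁₂ (LinearMap.inr ℝ S V)
    (LinearMap.inr ℝ S V)).compr₂ (LinearMap.snd ℝ S V ∘ₗ LinearMap.snd ℝ (So η) (S × V)))
    fun v x => congrArg (fun p : Poincare η S => p.2.2) (C₂_skew hz.1 v x)
  have hb : d₁ (mBracket ω) (adj ω) 2 (cochainForm l) ∈ B₂ ω 2 := ⟨_, cochainForm_mem l, rfl⟩
  set y := z - d₁ (mBracket ω) (adj ω) 2 (cochainForm l) with hy
  have hym : y ∈ Z₂ ω 2 := sub_mem hz (B₂_le_Z₂ ω 2 hb)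
  have hα : ∀ v x, y (0, v) (0, x) = 0 := fun v x => by
    rw [hvv y hym]
    refine Prod.ext rfl (Prod.ext rfl ?_)
    rw [hy, LinearMap.sub_apply, LinearMap.sub_apply, d₁_cochainForm]
    exact sub_eq_zero.2 (hl v x).symm
  have hss : ∀ s t, y (s, 0) (t, 0) = ((y (s, 0) (t, 0)).1, 0, 0) := fun s t =>
    mem_grade_zero (hym.1 _ _ _ (mGrade_left s) _ (mGrade_left t)).2
  have hsv : ∀ s v, y (s, 0) (0, v) = (0, (y (s, 0) (0, v)).2.1, 0) := fun s v =>
    mem_grade_neg_one (hym.1 _ _ _ (mGrade_left s) _ (mGrade_right v)).2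
  obtain ⟨β, hβy⟩ : ∃ β : S →ₗ[ℝ] V →ₗ[ℝ] S, ∀ s v, (y (s, 0) (0, v)).2.1 = β s v :=
    ⟨(y.compl₁₂ (LinearMap.inl ℝ S V) (LinearMap.inr ℝ S V)).compr₂
      (LinearMap.fst ℝ S V ∘ₗ LinearMap.snd ℝ (So η) (S × V)), fun _ _ => rfl⟩
  have hβ : ∀ s t v, vec η (y (s, 0) (t, 0)).1 v = dirac ω s (β t v) + dirac ω t (β s v) :=
    fun s t v => by rw [cocycle_two_vector ω hym hα, hβy, hβy]
  obtain ⟨Φ, hΦ, hΦβ⟩ := hg.exists_fourForm (β := fun a => β.flip (η.basis a))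
    (fun a b s => by
      have h1 := So.skew η (y (s, 0) (s, 0)).1 (η.basis a) (η.basis b)
      rw [hβ, hβ, η.symm, ← two_smul ℝ, ← two_smul ℝ, map_smul, map_smul, form_basis_dirac,
        form_basis_dirac, smul_eq_mul, smul_eq_mul] at h1
      simp only [LinearMap.add_apply, Module.End.mul_apply, map_add, LinearMap.flip_apply]
      linarith)
    (fun s => by
      rw [← apply_dirac_eq_sum, ← spin_eq_sum_of_vec ω (hβ s s)]
      rw [cocycle_two ω hym s, hβy])
  have hΦ' : β = fourFormField η Φ := by
    have h1 : β.flip = (fourFormField η Φ).flip :=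
      η.basis.ext fun a => (hΦβ a).trans (fourFormField_flip Φ a).symm
    exact LinearMap.ext₂ fun s v => LinearMap.congr_fun₂ h1 v s
  have h0 : (fourFormCocycle ω ⟨Φ, hΦ⟩).1 = y := by
    refine C₂_ext (fourFormCocycle ω _).2.1 hym.1 (fun s t => ?_) (fun s v => ?_) fun v x => ?_
    · rw [hss, fourFormCocycle_apply]
      refine Prod.ext (So.ext_vec (LinearMap.ext fun v => ?_)) (by simp)
      rw [hβ, hΦ', vec_fourFormCurvature]
    · rw [hsv, fourFormCocycle_apply]
      refine Prod.ext (by simp) (Prod.ext ?_ rfl)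
      rw [hβy, hΦ']
      simp
    · rw [hα, fourFormCocycle_apply]; simp
  refine ⟨⟨Φ, hΦ⟩, ?_⟩
  rw [h0, hy, sub_sub_cancel_left]
  exact neg_mem hb

/-- The isomorphism `Φ ↦ [fourFormCocycle Φ]`. -/
def fourFormEquiv : fourForms (gam η S) ≃ₗ[ℝ] H₂ ω 2 :=
  LinearEquiv.ofBijective (cls ω 2 ∘ₗ fourFormCocycle ω) (by
    constructor
    · refine (injective_iff_map_eq_zero _).2 fun Φ h => fourFormCocycle_eq_zero ω ?_
      have h1 : fourFormCocycle ω Φ ∈ (B₂ ω 2).submoduleOf (Z₂ ω 2) :=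
        (Submodule.Quotient.mk_eq_zero _).1 h
      exact h1
    · intro h
      obtain ⟨z, rfl⟩ := cls_surjective ω 2 h
      obtain ⟨Φ, hΦ⟩ := exists_fourFormCocycle ω z.2
      exact ⟨Φ, (Submodule.Quotient.eq _).2 hΦ⟩)

theorem fourFormEquiv_equivariant (A : So η) {Φ Φ' : fourForms (gam η S)}
    (h : Φ'.1 = spin η S A * Φ.1 - Φ.1 * spin η S A) :
    fourFormEquiv ω Φ' = soH ω 2 A (fourFormEquiv ω Φ) := by
  change cls ω 2 (fourFormCocycle ω Φ') = soHLin ω 2 A (cls ω 2 (fourFormCocycle ω Φ))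
  rw [soHLin_cls]
  exact congrArg _ (Subtype.ext (fourFormCocycle_equivariant ω A h).symm)

end SecondCohomology

/-! ### Irreducibility of the space of four-forms -/

section GammaFourForms

variable {S : Type*} [AddCommGroup S] [Module ℝ S] {g : Fin 11 → Module.End ℝ S}

theorem IsGamma.lie_pair_gamma (hg : IsGamma g) {J : Finset (Fin 11)} (hJ : Even J.card)
    (a b : Fin 11) : g a * g b * gamma g J - gamma g J * (g a * g b) =
      (1 - chi J a * chi J b) • (g a * g b * gamma g J) := by
  rw [hg.pair_mul_gamma hJ, smul_smul, sub_mul, one_mul,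
    ((isSign_chi J a).mul (isSign_chi J b)).mul_self]
  module

theorem mem_fourForms_iff {Φ : Module.End ℝ S} : Φ ∈ fourForms g ↔
    ∃ c : Finset (Fin 11) → ℝ, ∑ J ∈ Finset.univ.powersetCard 4, c J • gamma g J = Φ := by
  rw [fourForms, ← Submodule.mem_span_image_finset_iff_exists_fun']
  congr! 3
  ext J; simp

/-- An invariant space of four-forms contains the components of its elements. -/
theorem IsGamma.gamma_mem_of_sum_mem (hg : IsGamma g) {U : Submodule ℝ (Module.End ℝ S)}
    (hU : ∀ a b, a ≠ b → ∀ M ∈ U, g a * g b * M - M * (g a * g b) ∈ U)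
    {c : Finset (Fin 11) → ℝ} (h : ∑ J ∈ Finset.univ.powersetCard 4, c J • gamma g J ∈ U)
    {I : Finset (Fin 11)} (hI : I.card = 4) : c I • gamma g I ∈ U := by
  have key : ∀ P : Finset (Fin 11 × Fin 11), (∀ p ∈ P, p.1 ≠ p.2) →
      ∑ J ∈ Finset.univ.powersetCard 4 with ∀ p ∈ P, chi J p.1 * chi J p.2 = -1,
        c J • gamma g J ∈ U := by
    intro P
    induction P using Finset.induction_on with
    | empty => intro _; simpa using h
    | insert p P _ ih =>
      intro hP
      obtain ⟨a, b⟩ := p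
      have hab : a ≠ b := hP (a, b) (Finset.mem_insert_self _ _)
      have h1 := ih fun p hp => hP p (Finset.mem_insert_of_mem hp)
      -- This multiple of the double commutator with g_a g_b is the projector onto the γ_J for which
      -- J contains exactly one of a and b.
      have h2 := U.smul_mem (-(1 / 4) * (sgn a * sgn b)) (hU a b hab _ (hU a b hab _ h1))
      convert h2 using 1
      simp only [Finset.mul_sum, Finset.sum_mul, ← Finset.sum_sub_distrib, Finset.smul_sum]
      rw [Finset.sum_filter, Finset.sum_filter]
      refine Finset.sum_congr rfl fun J hJ => ?_
      have hJe : Even J.card := by rw [(Finset.mem_powersetCard.1 hJ).2]; decide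
      by_cases hP' : ∀ p ∈ P, chi J p.1 * chi J p.2 = -1
      swap
      · rw [if_neg hP', if_neg fun h => hP' fun p hp => h p (Finset.mem_insert_of_mem hp)]
      rw [if_pos hP']
      have e1 : g a * g b * (c J • gamma g J) - c J • gamma g J * (g a * g b) =
          (c J * (1 - chi J a * chi J b)) • (g a * g b * gamma g J) := by
        rw [mul_smul_comm, smul_mul_assoc, ← smul_sub, hg.lie_pair_gamma hJe, smul_smul]
      have e2 : g a * g b * (g a * g b * gamma g J) - g a * g b * gamma g J * (g a * g b) =
          (-(sgn a * sgn b) * (1 - chi J a * chi J b)) • gamma g J := by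
        rw [mul_assoc (g a * g b) (gamma g J), ← mul_sub, hg.lie_pair_gamma hJe, mul_smul_comm,
          ← mul_assoc (g a * g b), hg.pair_sq hab, smul_mul_assoc, one_mul, smul_smul, mul_comm]
      rw [e1, mul_smul_comm, smul_mul_assoc, ← smul_sub, e2, smul_smul, smul_smul]
      have h3 : sgn a * sgn b * (sgn a * sgn b) = 1 :=
        ((isSign_sgn a).mul (isSign_sgn b)).mul_self
      rcases (isSign_chi J a).mul (isSign_chi J b) with h | h
      · rw [if_neg fun h' => by
          have := h' (a, b) (Finset.mem_insert_self _ _)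
          simp only [h] at this
          norm_num at this, h]
        simp
      · rw [if_pos fun p hp => by
          rcases Finset.mem_insert.1 hp with rfl | hp
          · exact h
          · exact hP' p hp, h]
        congr 1
        linear_combination (-c J) * h3
  -- A set that separates every element of I from every element outside I is I or its complement,
  -- and the complement has seven elements.
  have h1 := key (I ×ˢ Iᶜ) fun p hp h => by
    rw [Finset.mem_product, Finset.mem_compl] at hp
    exact hp.2 (h ▸ hp.1)
  rwa [Finset.sum_eq_single_of_mem I] at h1
  · refine Finset.mem_filter.2 ⟨Finset.mem_powersetCard.2 ⟨Finset.subset_univ _, hI⟩,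
      fun p hp => ?_⟩
    rw [Finset.mem_product, Finset.mem_compl] at hp
    simp [chi, hp.1, hp.2]
  · intro J hJ hJI
    exfalso
    rw [Finset.mem_filter, Finset.mem_powersetCard] at hJ
    obtain ⟨⟨-, hJ4⟩, hJP⟩ := hJ
    have h2 : ∀ a ∈ I, ∀ b ∉ I, ¬(a ∈ J ↔ b ∈ J) := by
      intro a ha b hb hab
      have := hJP (a, b) (Finset.mem_product.2 ⟨ha, Finset.mem_compl.2 hb⟩)
      by_cases h : a ∈ J
      · simp only [chi, if_pos h, if_pos (hab.1 h)] at this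
        norm_num at this
      · simp only [chi, if_neg h, if_neg fun h' => h (hab.2 h')] at this
        norm_num at this
    by_cases h3 : I ⊆ J
    · exact hJI (Finset.eq_of_subset_of_card_le h3 (by rw [hI, hJ4])).symm
    · obtain ⟨a, ha, haJ⟩ := Finset.not_subset.1 h3
      have h4 : Iᶜ ⊆ J := fun b hb => by
        by_contra hbJ
        exact h2 a ha b (Finset.mem_compl.1 hb) (by simp [haJ, hbJ])
      have := Finset.card_le_card h4
      rw [Finset.card_compl, hI, hJ4, Fintype.card_fin] at this
      omega

/-- For a ∈ I ∖ J and b ∈ J ∖ I, the commutator with g_a g_b turns γ_I into a nonzero multiple of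
the product with a replaced by b, which brings I one step closer to J. -/
theorem IsGamma.gamma_mem_of_gamma_mem (hg : IsGamma g) {U : Submodule ℝ (Module.End ℝ S)}
    (hU : ∀ a b, a ≠ b → ∀ M ∈ U, g a * g b * M - M * (g a * g b) ∈ U)
    {J : Finset (Fin 11)} (n : ℕ) : ∀ {I : Finset (Fin 11)}, (I \ J).card = n →
      I.card = J.card → Even J.card → gamma g I ∈ U → gamma g J ∈ U := by
  induction n with
  | zero =>
    intro I h0 hIJ _ h
    rw [Finset.card_eq_zero, Finset.sdiff_eq_empty_iff_subset] at h0
    rwa [← Finset.eq_of_subset_of_card_le h0 hIJ.ge]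
  | succ n ih =>
    intro I hn hIJ hJe h
    obtain ⟨a, ha⟩ : (I \ J).Nonempty := Finset.card_pos.1 (by omega)
    obtain ⟨b, hb⟩ : (J \ I).Nonempty := Finset.card_pos.1 (by
      rw [Finset.card_sdiff_comm hIJ.symm]; omega)
    rw [Finset.mem_sdiff] at ha hb
    have hab : a ≠ b := fun h => hb.2 (h ▸ ha.1)
    obtain ⟨r, hr, h1⟩ := hg.mul_gamma_symmDiff I b
    obtain ⟨r', hr', h2⟩ := hg.mul_gamma_symmDiff (symmDiff I {b}) a
    have h3 := hU a b hab _ h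
    rw [hg.lie_pair_gamma (hIJ ▸ hJe), mul_assoc, h1, mul_smul_comm, h2, smul_smul, smul_smul,
      Submodule.smul_mem_iff] at h3
    · have e : symmDiff (symmDiff I {b}) {a} = insert b (I.erase a) := by
        ext i
        simp only [Finset.mem_symmDiff, Finset.mem_singleton, Finset.mem_insert, Finset.mem_erase]
        by_cases hia : i = a
        · subst hia; simp [hab, ha.1]
        · by_cases hib : i = b
          · subst hib; simp [hb.2, hia]
          · simp [hia, hib]
      rw [e] at h3
      refine ih (I := insert b (I.erase a)) ?_ ?_ hJe h3
      · have : insert b (I.erase a) \ J = (I \ J).erase a := by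
          rw [Finset.insert_sdiff_of_mem _ hb.1, Finset.erase_sdiff_comm]
        rw [this, Finset.card_erase_of_mem (Finset.mem_sdiff.2 ha), hn, Nat.add_sub_cancel]
      · rw [Finset.card_insert_of_notMem (by simp [hb.2]), Finset.card_erase_of_mem ha.1, ← hIJ]
        have : 0 < I.card := Finset.card_pos.2 ⟨a, ha.1⟩
        omega
    · refine mul_ne_zero (mul_ne_zero ?_ hr.ne_zero) hr'.ne_zero
      simp only [chi, if_pos ha.1, if_neg hb.2]
      norm_num

/-- The space of four-forms has no invariant subspaces. -/
theorem IsGamma.eq_bot_or_fourForms_le (hg : IsGamma g) {U : Submodule ℝ (Module.End ℝ S)}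
    (hU4 : U ≤ fourForms g)
    (hU : ∀ a b, a ≠ b → ∀ M ∈ U, g a * g b * M - M * (g a * g b) ∈ U) :
    U = ⊥ ∨ fourForms g ≤ U := by
  refine or_iff_not_imp_left.2 fun h => ?_
  obtain ⟨M, hM, hM0⟩ := Submodule.exists_mem_ne_zero_of_ne_bot h
  obtain ⟨c, rfl⟩ := mem_fourForms_iff.1 (hU4 hM)
  obtain ⟨I, hI, hcI⟩ := Finset.exists_ne_zero_of_sum_ne_zero hM0
  have hI4 := (Finset.mem_powersetCard.1 hI).2
  have hIU := (U.smul_mem_iff fun h0 => hcI (by rw [h0, zero_smul])).1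
    (hg.gamma_mem_of_sum_mem hU hM hI4)
  refine Submodule.span_le.2 ?_
  rintro _ ⟨J, hJ, rfl⟩
  have hJ : J.card = 4 := hJ
  exact hg.gamma_mem_of_gamma_mem hU _ rfl (hI4.trans hJ.symm) (by rw [hJ]; decide) hIU

theorem IsGamma.prod_eq_smul_gamma (hg : IsGamma g) {f : Fin 4 → Fin 11}
    (hf : Function.Injective f) : ∃ r, IsSign r ∧
      g (f 0) * (g (f 1) * (g (f 2) * g (f 3))) = r • gamma g (Finset.univ.image f) := by
  obtain ⟨r0, h0, e0⟩ := hg.mul_gamma_symmDiff ∅ (f 3)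
  obtain ⟨r1, h1, e1⟩ := hg.mul_gamma_symmDiff (symmDiff ∅ {f 3}) (f 2)
  obtain ⟨r2, h2, e2⟩ := hg.mul_gamma_symmDiff (symmDiff (symmDiff ∅ {f 3}) {f 2}) (f 1)
  obtain ⟨r3, h3, e3⟩ := hg.mul_gamma_symmDiff
    (symmDiff (symmDiff (symmDiff ∅ {f 3}) {f 2}) {f 1}) (f 0)
  rw [gamma_empty, mul_one] at e0
  refine ⟨r0 * r1 * r2 * r3, ((h0.mul h1).mul h2).mul h3, ?_⟩
  have h01 : f 0 ≠ f 1 := hf.ne (by decide)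
  have h02 : f 0 ≠ f 2 := hf.ne (by decide)
  have h03 : f 0 ≠ f 3 := hf.ne (by decide)
  have h12 : f 1 ≠ f 2 := hf.ne (by decide)
  have h13 : f 1 ≠ f 3 := hf.ne (by decide)
  have h23 : f 2 ≠ f 3 := hf.ne (by decide)
  have e : symmDiff (symmDiff (symmDiff (symmDiff ∅ {f 3}) {f 2}) {f 1}) {f 0} =
      Finset.univ.image f := by
    ext i
    have h : i ∈ Finset.univ.image f ↔ i = f 0 ∨ i = f 1 ∨ i = f 2 ∨ i = f 3 := by
      simp [Fin.exists_fin_succ, eq_comm]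
    rw [h]
    simp only [Finset.mem_symmDiff, Finset.mem_singleton, Finset.notMem_empty]
    grind
  simp only [e0, e1, e2, e3, e, mul_smul_comm, smul_smul]

/-- Adjacent transpositions generate the permutations, and each of them reverses the sign by one
anticommutation. -/
theorem IsGamma.prod_comp_perm (hg : IsGamma g) {f : Fin 4 → Fin 11} (hf : Function.Injective f)
    (σ : Equiv.Perm (Fin 4)) : g (f (σ 0)) * (g (f (σ 1)) * (g (f (σ 2)) * g (f (σ 3)))) =
      (Equiv.Perm.sign σ : ℤ) • (g (f 0) * (g (f 1) * (g (f 2) * g (f 3)))) := by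
  have hσ : σ ∈ Submonoid.closure (Set.range fun i : Fin 3 => Equiv.swap i.castSucc i.succ) := by
    rw [Equiv.Perm.mclosure_swap_castSucc_succ]; trivial
  induction hσ using Submonoid.closure_induction_right with
  | one => simp
  | mul_right σ _ τ hτ ih =>
    obtain ⟨i, rfl⟩ := hτ
    have h : ∀ a b, a ≠ b → g (f (σ a)) * g (f (σ b)) = -(g (f (σ b)) * g (f (σ a))) :=
      fun a b hab => hg.anti _ _ ((hf.comp σ.injective).ne hab)
    rw [map_mul, Equiv.Perm.sign_swap i.castSucc_lt_succ.ne, mul_neg, mul_one, Units.val_neg,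
      neg_smul,
      ← ih]
    have sw : ∀ (i : Fin 3) (k l : Fin 4), Equiv.swap i.castSucc i.succ k = l →
        (σ * Equiv.swap i.castSucc i.succ) k = σ l := fun _ _ _ h => congrArg σ h
    have hi : i = 0 ∨ i = 1 ∨ i = 2 := by fin_cases i <;> simp
    rcases hi with rfl | rfl | rfl
    · have e := h 1 0 (by decide)
      rw [sw 0 0 1 (by decide), sw 0 1 0 (by decide), sw 0 2 2 (by decide), sw 0 3 3 (by decide),
        ← mul_assoc, e, neg_mul, mul_assoc]
    · have e := h 2 1 (by decide)
      rw [sw 1 0 0 (by decide), sw 1 1 2 (by decide), sw 1 2 1 (by decide), sw 1 3 3 (by decide),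
        ← mul_assoc (g (f (σ 2))), e, neg_mul, mul_assoc, mul_neg]
    · have e := h 3 2 (by decide)
      rw [sw 2 0 0 (by decide), sw 2 1 1 (by decide), sw 2 2 3 (by decide), sw 2 3 2 (by decide),
        e, mul_neg, mul_neg]

end GammaFourForms

/-! ### The fourth exterior power as four-fold Clifford products -/

section Quantization

set_option linter.unusedSectionVars false

variable {V : Type u} [AddCommGroup V] [Module ℝ V] (η : LorentzForm V)
variable (S : Type w) [AddCommGroup S] [Module ℝ S] [Module (Cl η) S] [IsScalarTower ℝ (Cl η) S]

/-- The product `v₁ · v₂ · v₃ · v₄ ·` of four Clifford multiplications. -/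
def cliffProd : MultilinearMap ℝ (fun _ : Fin 4 => V) (Module.End ℝ S) :=
  (MultilinearMap.mkPiAlgebraFin ℝ 4 (Module.End ℝ S)).compLinearMap fun _ => cliff η S

theorem cliffProd_apply (v : Fin 4 → V) : cliffProd η S v =
    cliff η S (v 0) * (cliff η S (v 1) * (cliff η S (v 2) * cliff η S (v 3))) := by
  simp [cliffProd, List.ofFn_succ]

/-- The Leibniz rule for the commutator, from [A, v·] = (A v)·. -/
theorem cliffProd_equivariant (A : So η) (v : Fin 4 → V) :
    spin η S A * cliffProd η S v - cliffProd η S v * spin η S A =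
      ∑ i, cliffProd η S (Function.update v i (vec η A (v i))) := by
  have h : ∀ x, spin η S A * cliff η S x = cliff η S x * spin η S A + cliff η S (vec η A x) :=
    fun x => LinearMap.ext fun s => spin_cliff η S A x s
  simp only [Fin.sum_univ_four, cliffProd_apply, Function.update_self,
    Function.update_of_ne (show (0 : Fin 4) ≠ 1 by decide),
    Function.update_of_ne (show (0 : Fin 4) ≠ 2 by decide),
    Function.update_of_ne (show (0 : Fin 4) ≠ 3 by decide),
    Function.update_of_ne (show (1 : Fin 4) ≠ 0 by decide),
    Function.update_of_ne (show (1 : Fin 4) ≠ 2 by decide),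
    Function.update_of_ne (show (1 : Fin 4) ≠ 3 by decide),
    Function.update_of_ne (show (2 : Fin 4) ≠ 0 by decide),
    Function.update_of_ne (show (2 : Fin 4) ≠ 1 by decide),
    Function.update_of_ne (show (2 : Fin 4) ≠ 3 by decide),
    Function.update_of_ne (show (3 : Fin 4) ≠ 0 by decide),
    Function.update_of_ne (show (3 : Fin 4) ≠ 1 by decide),
    Function.update_of_ne (show (3 : Fin 4) ≠ 2 by decide)]
  rw [← mul_assoc, h, add_mul, mul_assoc, ← mul_assoc (spin η S A), h, add_mul,
    mul_assoc (cliff η S (v 1)),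
    ← mul_assoc (spin η S A), h, add_mul, mul_assoc (cliff η S (v 2)), h]
  noncomm_ring

/-- The antisymmetrised Clifford product of four vectors, as a linear map on `Λ⁴ V`. -/
def quantization : ⋀[ℝ]^4 V →ₗ[ℝ] Module.End ℝ S :=
  exteriorPower.alternatingMapLinearEquiv (MultilinearMap.alternatization (cliffProd η S))

theorem quantization_ιMulti (v : Fin 4 → V) : quantization η S (exteriorPower.ιMulti ℝ 4 v) =
    ∑ σ : Equiv.Perm (Fin 4), (Equiv.Perm.sign σ : ℤ) • cliffProd η S (v ∘ σ) := by
  rw [quantization, exteriorPower.alternatingMapLinearEquiv_apply_ιMulti,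
    MultilinearMap.alternatization_apply]
  rfl

theorem quantization_equivariant (A : So η) (w : ⋀[ℝ]^4 V) :
    quantization η S (extRep η 4 A w) =
      spin η S A * quantization η S w - quantization η S w * spin η S A := by
  have h : quantization η S ∘ₗ extRep η 4 A =
      (LinearMap.mulLeft ℝ (spin η S A) - LinearMap.mulRight ℝ (spin η S A)) ∘ₗ
        quantization η S := by
    refine exteriorPower.linearMap_ext (AlternatingMap.ext fun v => ?_)
    change quantization η S (extDer 4 (vec η A) (exteriorPower.ιMulti ℝ 4 v)) =
      spin η S A * quantization η S (exteriorPower.ιMulti ℝ 4 v) -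
        quantization η S (exteriorPower.ιMulti ℝ 4 v) * spin η S A
    rw [extDer_ιMulti, map_sum]
    simp only [quantization_ιMulti, Finset.mul_sum, Finset.sum_mul, mul_smul_comm, smul_mul_assoc,
      ← Finset.sum_sub_distrib, ← smul_sub, cliffProd_equivariant]
    rw [Finset.sum_comm]
    refine Finset.sum_congr rfl fun σ _ => ?_
    rw [← Finset.smul_sum]
    congr 1
    -- Replacing slot i after the permutation is replacing slot σ i before it.
    refine (Equiv.sum_comp σ _).symm.trans (Finset.sum_congr rfl fun i _ => ?_)
    rw [Function.update_comp_equiv, Equiv.symm_apply_apply]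
    rfl
  exact LinearMap.congr_fun h w

-- On distinct basis vectors the sign of a permutation cancels the anticommutation sign, so all 4! =
-- 24 terms of the antisymmetrisation agree.
variable {S} in
theorem quantization_basis (I : Set.powersetCard (Fin 11) 4) :
    ∃ r : ℝ, r ≠ 0 ∧ quantization η S (η.basis.exteriorPower 4 I) = r • gamma (gam η S) I.1 := by
  have hg := isGamma_gam η S
  have hI : I.1.card = 4 := I.2
  obtain ⟨f, hf⟩ : ∃ f : Fin 4 → Fin 11, f = Finset.orderEmbOfFin I.1 hI := ⟨_, rfl⟩
  have hfi : Function.Injective f := hf ▸ (Finset.orderEmbOfFin I.1 hI).injective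
  obtain ⟨r, hr, e⟩ := hg.prod_eq_smul_gamma hfi
  refine ⟨24 * r, mul_ne_zero (by norm_num) hr.ne_zero, ?_⟩
  have h1 : η.basis.exteriorPower 4 I = exteriorPower.ιMulti ℝ 4 (η.basis ∘ f) := by
    rw [exteriorPower.basis_apply, hf]; rfl
  have h2 : ∀ σ : Equiv.Perm (Fin 4),
      (Equiv.Perm.sign σ : ℤ) • cliffProd η S ((η.basis ∘ f) ∘ σ) = r • gamma (gam η S) I.1 := by
    intro σ
    rw [cliffProd_apply]
    change (Equiv.Perm.sign σ : ℤ) • (gam η S (f (σ 0)) * (gam η S (f (σ 1)) *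
      (gam η S (f (σ 2)) * gam η S (f (σ 3))))) = _
    rw [hg.prod_comp_perm hfi, e, smul_smul, ← Units.val_mul, Int.units_mul_self, Units.val_one,
      one_smul, hf, Finset.image_orderEmbOfFin_univ]
  rw [h1, quantization_ιMulti, Finset.sum_congr rfl fun σ _ => h2 σ, Finset.sum_const,
    Finset.card_univ, Fintype.card_perm, Fintype.card_fin]
  rw [show Nat.factorial 4 = 24 from rfl, ← Nat.cast_smul_eq_nsmul ℝ, smul_smul]
  norm_num

variable [IsSimpleModule (Cl η) S]

/-- The images of the basis four-vectors are nonzero multiples of distinct γ_J, which are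
trace-orthogonal. -/
theorem quantization_injective : Function.Injective (quantization η S) := by
  have hg := isIrreducibleGamma_gam η S
  choose r hr e using quantization_basis (S := S) η
  refine (injective_iff_map_eq_zero _).2 fun w hw => ?_
  refine (η.basis.exteriorPower 4).ext_elem fun J => ?_
  have h1 := congrArg (fun M => LinearMap.trace ℝ S (gamma (gam η S) J.1 * M)) hw
  have hc : ∀ I : Set.powersetCard (Fin 11) 4, Even I.1.card := fun I => by
    rw [show I.1.card = 4 from I.2]; decide
  rw [← (η.basis.exteriorPower 4).sum_repr w] at h1
  simp only [map_sum, map_smul, e, Finset.mul_sum, mul_smul_comm, mul_zero, map_zero] at h1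
  rw [Finset.sum_eq_single J] at h1
  · rw [hg.trace_gamma_mul_gamma (hc J) (hc J), if_pos rfl, smul_eq_mul, smul_eq_mul] at h1
    rw [map_zero]
    exact (mul_eq_zero.1 h1).resolve_right (mul_ne_zero (hr J)
      (mul_ne_zero (by norm_num) (isSign_gammaSign _).ne_zero))
  · intro I _ hIJ
    rw [hg.trace_gamma_mul_gamma (hc J) (hc I), if_neg fun h => hIJ (Subtype.ext h.symm)]
    simp
  · exact fun h => absurd (Finset.mem_univ J) h

theorem range_quantization : LinearMap.range (quantization η S) = fourForms (gam η S) := by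
  choose r hr e using quantization_basis (S := S) η
  apply le_antisymm
  · rintro _ ⟨w, rfl⟩
    rw [← (η.basis.exteriorPower 4).sum_repr w, map_sum]
    refine sum_mem fun I _ => ?_
    rw [map_smul, e]
    exact Submodule.smul_mem _ _ (Submodule.smul_mem _ _ (gamma_mem_fourForms I.2))
  · refine Submodule.span_le.2 ?_
    rintro _ ⟨J, hJ, rfl⟩
    refine ⟨(r ⟨J, hJ⟩)⁻¹ • η.basis.exteriorPower 4 ⟨J, hJ⟩, ?_⟩
    rw [map_smul, e, smul_smul, inv_mul_cancel₀ (hr _), one_smul]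

/-- The isomorphism of `Λ⁴ V` with the span of the products of four gamma operators. -/
def quantizationEquiv : ⋀[ℝ]^4 V ≃ₗ[ℝ] fourForms (gam η S) :=
  (LinearEquiv.ofInjective _ (quantization_injective η S)).trans
    (LinearEquiv.ofEq _ _ (range_quantization η S))

variable {η S} (ω : SpinSymplectic η S)

theorem exists_intertwines_two :
    ∃ e : H₂ ω 2 ≃ₗ[ℝ] ⋀[ℝ]^4 V, Intertwines (soH ω 2) (extRep η 4) e :=
  ⟨((quantizationEquiv η S).trans (fourFormEquiv ω)).symm, Intertwines.symm fun A w =>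
    fourFormEquiv_equivariant ω A (quantization_equivariant η S A w)⟩

end Quantization

/-- S serves only as a model: the image of an invariant subspace under `quantization` is stable
under commutators with g_a g_b, which is twice the spin action of a rotation, so
`eq_bot_or_fourForms_le` applies. -/
theorem isIrreducibleRep_extRep_four {V : Type u} [AddCommGroup V] [Module ℝ V]
    (η : LorentzForm V) (S : Type w) [AddCommGroup S] [Module ℝ S] [Module (Cl η) S]
    [IsScalarTower ℝ (Cl η) S] [IsSimpleModule (Cl η) S] : IsIrreducibleRep (extRep η 4) := by
  have hg := isGamma_gam η S
  obtain ⟨J, -, hJ⟩ := Finset.exists_subset_card_eq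
    (show 4 ≤ (Finset.univ : Finset (Fin 11)).card by simp)
  refine ⟨?_, fun U hU => ?_⟩
  · exact ⟨_, 0, (η.basis.exteriorPower 4).ne_zero ⟨J, hJ⟩⟩
  · have h4 : U.map (quantization η S) ≤ fourForms (gam η S) := by
      rw [← range_quantization]
      exact LinearMap.map_le_range
    rcases hg.eq_bot_or_fourForms_le h4 (by
      rintro a b hab _ ⟨w, hw, rfl⟩
      refine ⟨(2 : ℝ) • extRep η 4 (rotation η (η.basis a) (η.basis b)) w,
        U.smul_mem _ (hU _ w hw), ?_⟩
      rw [map_smul, quantization_equivariant, spin_rotation η S hab, smul_mul_assoc, mul_smul_comm]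
      module) with h | h
    · left
      exact Submodule.map_injective_of_injective (quantization_injective η S)
        (h.trans (Submodule.map_bot _).symm)
    · right
      rw [← range_quantization, LinearMap.range_eq_map] at h
      refine Submodule.eq_top_iff'.2 fun w => ?_
      obtain ⟨w', hw', e⟩ := h ⟨w, trivial, rfl⟩
      rwa [← quantization_injective η S e]

end Spencer

end

/-! ### The main theorem -/

theorem theorem1 {V : Type*} [AddCommGroup V] [Module ℝ V] (η : Spencer.LorentzForm V)
    {S : Type*} [AddCommGroup S] [Module ℝ S] [Module (Spencer.Cl η) S]
    [IsScalarTower ℝ (Spencer.Cl η) S] [IsSimpleModule (Spencer.Cl η) S]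
    (ω : Spencer.SpinSymplectic η S) :
    -- `H^{1,2}(m,p) ≅ S` as representations of `so(V)`; it is irreducible
    ((∃ e : Spencer.H₂ ω 1 ≃ₗ[ℝ] S,
        Spencer.Intertwines (Spencer.soH ω 1) (Spencer.spin η S) e) ∧
      Spencer.IsIrreducibleRep (Spencer.soH ω 1)) ∧
    -- it is represented by the cocycles `∂(Z ⊗ φ)`, for `φ ∈ S^*`
    (∃ e : Module.Dual ℝ S ≃ₗ[ℝ] Spencer.H₂ ω 1,
      Spencer.Intertwines (Spencer.dualRep (Spencer.spin η S)) (Spencer.soH ω 1) e ∧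
      ∀ φ : Module.Dual ℝ S, ∃ z : Spencer.Z₂ ω 1,
        (∀ x y, Spencer.gradingCocycle ω φ x y = ((0 : ℝ), z.1 x y)) ∧
        e φ = Spencer.cls ω 1 z) ∧
    -- `H^{2,2}(m,p) ≅ Λ⁴ V` as representations of `so(V)`; it is irreducible
    ((∃ e : Spencer.H₂ ω 2 ≃ₗ[ℝ] ⋀[ℝ]^4 V,
        Spencer.Intertwines (Spencer.soH ω 2) (Spencer.extRep η 4) e) ∧
      Spencer.IsIrreducibleRep (Spencer.soH ω 2)) ∧
    -- `H^{3,2}(m,p) = H^{4,2}(m,p) = 0`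
    Subsingleton (Spencer.H₂ ω 3) ∧ Subsingleton (Spencer.H₂ ω 4) ∧
    -- for `d ≥ 5` already the cochains vanish
    (∀ d : ℤ, 5 ≤ d →
      Spencer.C₂ (S := S) (V := V) (Spencer.grade η S) d = ⊥ ∧
        Subsingleton (Spencer.H₂ ω d)) := by
  obtain ⟨e₁, he₁⟩ := Spencer.exists_intertwines_one ω
  obtain ⟨e₂, he₂⟩ := Spencer.exists_intertwines_two ω
  refine ⟨⟨⟨e₁, he₁⟩, (Spencer.isIrreducibleRep_spin).of_intertwines e₁ he₁⟩,
    ⟨Spencer.gradingEquiv ω, Spencer.intertwines_gradingEquiv ω, fun φ =>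
      ⟨Spencer.gradingMap ω φ, fun x y => ?_, Spencer.gradingEquiv_apply ω φ⟩⟩,
    ⟨⟨e₂, he₂⟩, (Spencer.isIrreducibleRep_extRep_four η S).of_intertwines e₂ he₂⟩,
    Spencer.subsingleton_H₂_three ω, Spencer.subsingleton_H₂_four ω,
    fun d hd => ⟨Spencer.C₂_eq_bot hd, Spencer.subsingleton_H₂_of_le ω hd⟩⟩
  rw [Spencer.gradingCocycle_apply]
  exact congrArg (Prod.mk 0) (Spencer.gradingComponent_apply ω φ x y).symm
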